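/- Let $Q\in\mathbb C$ with $0<|Q|<1$ and put $q=Q^6$, $a_i=\alpha_i^6$, $c=\gamma^6$, $\alpha_0\alpha_1\alpha_2=Q$. Write $(a;q)_\infty=\prod_{i\ge0}(1-aq^i)$, $(a;p,q)_\infty=\prod_{i,j\ge0}(1-p^iq^ja)$, $\Theta(a;q)=(a;q)_\infty(qa^{-1};q)_\infty$, $\Gamma(a;p,q)=(pqa^{-1};p,q)_\infty/(a;p,q)_\infty$, and ${}_1\varphi_1$ for the basic hypergeometric series. **The $\tau$ functions of $q$-$\mathrm P_{\rm III}$.** Let $A,B$ be functions of $(\alpha_0,\alpha_2)\in(\mathbb C^\times)^2$, put $A_{n,m}(\alpha_0,\alpha_2)=A(Q^n\alpha_0,Q^{-m}\alpha_2)$, similarly $B_{n,m}$, and suppose that $A_{n,m},B_{n,m}$ have period one in $n$ and in $m$. Put $$F_{n,m}=\frac{A_{n,m}}{(a_2^{-2}q^{2m+2};q^2)_\infty}\,{}_1\varphi_1\!\left({0\atop a_2^2q^{-2m}};q^2,a_2^2a_0^2q^{2n-2m}\right)+B_{n,m}\frac{\Theta(a_0^2a_2^2q^{2n-2m-2};q^2)}{(a_2^2q^{-2m-2};q^2)_\infty\Theta(a_0^2q^{2n};q^2)}\,{}_1\varphi_1\!\left({0\atop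 a_2^{-2}q^{2m+4}};q^2,a_0^2q^{2n+2}\right),$$ $\psi_N^{n,m}=\det(F_{n-i+j,m})_{i,j=1}^N$ for $N>0$, $\psi_0^{n,m}=1$, $\psi_N^{n,m}=0$ for $N<0$, and $$\tau_N^{n,m}=(-1)^{N(N+1)/2}Q^{-2(2n-m)N^2+6nN}\alpha_0^{-4N^2+6N}\alpha_2^{-2N^2}\left(\frac{\Theta(-Q^{-6n}\alpha_0^{-6};Q^6)\,\Theta(-Q^{6m}\alpha_2^{-6};Q^6)}{\Theta(Q^{-6(n-m)}\alpha_0^{-6}\alpha_2^{-6};Q^6)}\right)^{N}$$ $$\times\,\Gamma(Q^{2n-m+1}\alpha_0^2\alpha_2;Q,Q)\,\Gamma(Q^{-n+2m-1}\alpha_1^2\alpha_0;Q,Q)\,\Gamma(Q^{-n-m}\alpha_2^2\alpha_1;Q,Q)\,\psi_N^{n,m-1}.$$ **The action.** For $i\in\mathbb Z/3\mathbb Z$ put $u_i=q^{-1/3}c^{-2/3}a_i=Q^{-2}\gamma^{-4}\alpha_i^6$, $v_i=q^{1/3}c^{2/3}a_i=Q^2\gamma^4\alpha_i^6$, $u_i^{1/2}=Q^{-1}\gamma^{-2}\alpha_i^3$,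 $v_i^{1/2}=Q\gamma^2\alpha_i^3$. Let $s_i(\alpha_i)=\alpha_i^{-1}$, $s_i(\alpha_j)=\alpha_j\alpha_i$ $(j\ne i)$, $$s_i(\tau_i)=\frac{u_i\tau_{i+1}\overline\tau_{i-1}+\overline\tau_{i+1}\tau_{i-1}}{u_i^{1/2}\overline\tau_i},\qquad s_i(\overline\tau_i)=\frac{v_i\overline\tau_{i+1}\tau_{i-1}+\tau_{i+1}\overline\tau_{i-1}}{v_i^{1/2}\tau_i},$$ the other $\tau_j,\overline\tau_j$ being fixed; $\pi$ raises all indices by one; $s_i,\pi$ fix $\gamma$; $r$ exchanges $\tau_i$ and $\overline\tau_i$, fixes $\alpha_i$, and $r(\gamma)=Q^{-1}\gamma^{-1}$; $w_0$ fixes $\tau_i,\alpha_i$, $w_0(\gamma)=\gamma^{-1}$, and $$w_0(\overline\tau_i)=\frac{\alpha_{i+1}^2\left(\overline\tau_i\tau_{i+1}\tau_{i+2}+u_{i-1}\tau_i\overline\tau_{i+1}\tau_{i+2}+u_{i+1}^{-1}\tau_i\tau_{i+1}\overline\tau_{i+2}\right)}{\alpha_{i+2}^2\,\overline\tau_{i+1}\overline\tau_{i+2}}.$$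 Put $R_1=\pi^2s_1$ (which equals $s_2T_2^{-1}$ with $T_2=s_1\pi s_2$) and $T_4=rw_0$; an element $w$ acts on functions by $(w.F)(p)=F(p.w)$. **Theorem.** Let $\alpha_2=Q^{1/2}$ (a fixed square root; $Q^{k/2}$ means $\alpha_2^k$), and let $D$ be the set of generic $\alpha_0$, that is $\alpha_0\neq0$, $\alpha_0^{12}\notin Q^{6\mathbb Z}$, $\alpha_0^2\alpha_2\notin Q^{\mathbb Z}$. Suppose that $R_1(A_{n,m})=B_{n,m}$ at $\alpha_2=Q^{1/2}$. Put $\tau_N^{2n}=\tau_N^{n,0}$, $\tau_N^{2n-1}=\tau_N^{n,1}$ at $\alpha_2=Q^{1/2}$. Then $\tau_N^k$ $(k,N\in\mathbb Z,\ \alpha_0\in D)$ are hypergeometric $\tau$ functions of $q$-$\mathrm P_{\rm II}$, that is: 1. $\tau_N^k=0$ for $N<0$; $\tau_0^k\ne0$; and $D$ is stable under $\alpha_0\mapsto Q^{k/2}\alpha_0$ with $\tau_N^k(\alpha_0)=\tau_N^0(Q^{k/2}\alpha_0)$. 2. They are consistent with the action of $\langle R_1,T_4\rangle$: at $(k,N)$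 take the parameters $(Q^{k/2}\alpha_0,\;Q^{1/2-k/2}\alpha_0^{-1},\;Q^{1/2})$, $\gamma=Q^N$, and $(\tau_0,\tau_1,\tau_2)=(\tau_N^{k-2},\tau_N^k,\tau_N^{k-1})$, $(\overline\tau_0,\overline\tau_1,\overline\tau_2)=(\tau_{N+1}^{k-2},\tau_{N+1}^k,\tau_{N+1}^{k-1})$; then $R_1^{\pm1}$ and $T_4^{\pm1}$ take these data to those at $(k\pm1,N)$ and $(k,N\pm1)$, whenever the $\tau$'s in the denominators are nonzero. The relations for $R_1$, $T_4$, $T_4^{-1}$ with denominators cleared hold for all $k,N\in\mathbb Z$. 3. For all $k,N\in\mathbb Z$, $$\tau_{N+1}^{k}\tau_{N-1}^{k+1}-Q^{(k-4N+1)/2}\alpha_0\,\tau_N^{k+2}\tau_N^{k-1}-Q^{-k+4N-1}\alpha_0^{-2}\,\tau_N^{k+1}\tau_N^{k}=0.$$ 4. With $X_k(N)=q^{(2N+1)/3}\dfrac{\tau_{N+1}^k\tau_N^{k-1}}{\tau_N^k\tau_{N+1}^{k-1}}$, where $q^{(2N+1)/3}=Q^{2(2N+1)}$, and $q^{k/2}=\alpha_2^{6k}$: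 if $\tau_N^j,\tau_{N+1}^j\ne0$ for $k-2\le j\le k+1$, then $a_0q^{k/2}+X_k\neq0$ and $q$-$\mathrm P_{\rm II}$ holds with $c=1$: $$X_{k+1}=\frac{q^{2N+1}}{X_kX_{k-1}}\,\frac{1+a_0q^{k/2}X_k}{a_0q^{k/2}+X_k}.$$ Moreover this is a one-parameter family: two pairs $(A,B)$, $(A',B')$ as above give the same $\tau_N^k$ (for all $k,N$ and all $\alpha_0\in D$) if and only if $A(\cdot,Q^{1/2})=A'(\cdot,Q^{1/2})$ on $D$; and every function $a$ on $\mathbb C^\times$ with $a(Qx)=a(x)$ occurs as $A(\cdot,Q^{1/2})$ for such a pair. -/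

import Mathlib

noncomputable section

namespace QPainleve

/-! ### Basic q-analysis -/

/-- The finite q-shifted factorial `(a;q)_k`. -/
def qFactorial (a q : ℂ) (k : ℕ) : ℂ := ∏ i ∈ Finset.range k, (1 - a * q ^ i)

/-- The infinite q-shifted factorial `(a;q)_∞`. -/
def qInf (a q : ℂ) : ℂ := ∏' i : ℕ, (1 - a * q ^ i)

/-- The double infinite q-shifted factorial `(a;p,q)_∞`. -/
def qInf₂ (a p q : ℂ) : ℂ := ∏' ij : ℕ × ℕ, (1 - p ^ ij.1 * q ^ ij.2 * a)

/-- The Jacobi theta function `Θ(a;q) = (a;q)_∞ (q a⁻¹;q)_∞`. -/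
def theta (a q : ℂ) : ℂ := qInf a q * qInf (q * a⁻¹) q

/-- The elliptic gamma function `Γ(a;p,q) = (p q a⁻¹;p,q)_∞ / (a;p,q)_∞`. -/
def ellGamma (a p q : ℂ) : ℂ := qInf₂ (p * q * a⁻¹) p q / qInf₂ a p q

/-- The basic hypergeometric series `₁φ₁(a; b; q, z)`. -/
def phi₁₁ (a b q z : ℂ) : ℂ :=
  ∑' n : ℕ, qFactorial a q n / (qFactorial b q n * qFactorial q q n)
    * ((-1) ^ n * q ^ (n * (n - 1) / 2)) * z ^ n

/-! ### The hypergeometric τ functions of q-P_III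

Here `x`, `y` stand for `α₀`, `α₂`; further `α₁ = Q / (α₀ α₂)`, `aᵢ = αᵢ ^ 6`, `q = Q ^ 6`. -/

/-- `A_{n,m}`, i.e. `T₁ⁿ T₂ᵐ` applied to a function `A` of `(α₀, α₂)`. -/
def latticeFun (Q : ℂ) (A : ℂ → ℂ → ℂ) (n m : ℤ) (x y : ℂ) : ℂ := A (Q ^ n * x) (Q ^ (-m) * y)

/-- `A_{n,m}` has period one with respect to `n` and `m`. -/
def PeriodOne (Q : ℂ) (A : ℂ → ℂ → ℂ) : Prop :=
  ∀ x y : ℂ, x ≠ 0 → y ≠ 0 → ∀ n m : ℤ,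
    latticeFun Q A (n + 1) m x y = latticeFun Q A n m x y ∧
    latticeFun Q A n (m + 1) x y = latticeFun Q A n m x y

/-- The entries `F_{n,m}`. -/
def entryF (Q : ℂ) (A B : ℂ → ℂ → ℂ) (n m : ℤ) (x y : ℂ) : ℂ :=
  let q : ℂ := Q ^ 6
  let a₀ : ℂ := x ^ 6
  let a₂ : ℂ := y ^ 6
  latticeFun Q A n m x y / qInf (a₂ ^ (-2 : ℤ) * q ^ (2 * m + 2)) (q ^ 2)
      * phi₁₁ 0 (a₂ ^ 2 * q ^ (-2 * m)) (q ^ 2) (a₂ ^ 2 * a₀ ^ 2 * q ^ (2 * n - 2 * m))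
    + latticeFun Q B n m x y
      * (theta (a₀ ^ 2 * a₂ ^ 2 * q ^ (2 * n - 2 * m - 2)) (q ^ 2)
          / (qInf (a₂ ^ 2 * q ^ (-2 * m - 2)) (q ^ 2) * theta (a₀ ^ 2 * q ^ (2 * n)) (q ^ 2)))
      * phi₁₁ 0 (a₂ ^ (-2 : ℤ) * q ^ (2 * m + 4)) (q ^ 2) (a₀ ^ 2 * q ^ (2 * n + 2))

/-- The Toeplitz determinants `ψ_N^{n,m}`: `1` for `N = 0` and `0` for `N < 0`. -/
def detPsi (Q : ℂ) (A B : ℂ → ℂ → ℂ) (n m N : ℤ) (x y : ℂ) : ℂ :=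
  if N < 0 then 0 else
    Matrix.det (Matrix.of fun i j : Fin N.toNat =>
      entryF Q A B (n - ((i : ℕ) : ℤ) + ((j : ℕ) : ℤ)) m x y)

/-- The hypergeometric τ functions `τ_N^{n,m}` of q-P_III, as functions of `α₀` and `α₂`. -/
def tauIII (Q : ℂ) (A B : ℂ → ℂ → ℂ) (n m N : ℤ) (α₀ α₂ : ℂ) : ℂ :=
  let α₁ : ℂ := Q / (α₀ * α₂)
  (-1) ^ (N * (N + 1) / 2) * Q ^ (-2 * (2 * n - m) * N ^ 2 + 6 * n * N)
    * α₀ ^ (-4 * N ^ 2 + 6 * N) * α₂ ^ (-2 * N ^ 2)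
    * (theta (-(Q ^ (-6 * n) * α₀ ^ (-6 : ℤ))) (Q ^ 6)
        * theta (-(Q ^ (6 * m) * α₂ ^ (-6 : ℤ))) (Q ^ 6)
        / theta (Q ^ (-6 * (n - m)) * α₀ ^ (-6 : ℤ) * α₂ ^ (-6 : ℤ)) (Q ^ 6)) ^ N
    * ellGamma (Q ^ (2 * n - m + 1) * α₀ ^ 2 * α₂) Q Q
    * ellGamma (Q ^ (-n + 2 * m - 1) * α₁ ^ 2 * α₀) Q Q
    * ellGamma (Q ^ (-n - m) * α₂ ^ 2 * α₁) Q Q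
    * detPsi Q A B n (m - 1) N α₀ α₂

/-- `τ_N^{2n} = τ_N^{n,0}` and `τ_N^{2n-1} = τ_N^{n,1}`, as functions of `α₀` (for fixed `α₂`). -/
def tauII (Q α₂ : ℂ) (A B : ℂ → ℂ → ℂ) (k N : ℤ) (α₀ : ℂ) : ℂ :=
  if Even k then tauIII Q A B (k / 2) 0 N α₀ α₂ else tauIII Q A B ((k + 1) / 2) 1 N α₀ α₂

/-! ### The birational action of the affine Weyl group on parameters and τ variables

A group element `w` acts on the arguments from the right, `(w.F)(p) = F(p.w)`; for each generator
the map `p ↦ p.w` is defined, and `p.(w w') = (p.w).w'`. Indices live in `ℤ/3ℤ`, realised as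
`Fin 3` with its modular arithmetic. -/

/-- The generalized Cartan matrix of type `A₂⁽¹⁾`. -/
def cartan (i j : Fin 3) : ℤ := if i = j then 2 else -1

/-- Values of the parameters `αᵢ`, `γ` and of the variables `τᵢ`, `τ̄ᵢ`. -/
@[ext] structure Pt where
  α : Fin 3 → ℂ
  γ : ℂ
  τ : Fin 3 → ℂ
  τb : Fin 3 → ℂ

/-- `u = q^{-1/3} c^{-2/3} a` for `a = α ^ 6`, `c = γ ^ 6`, `q = Q ^ 6`. -/
def uPar (Q γ α : ℂ) : ℂ := Q ^ (-2 : ℤ) * γ ^ (-4 : ℤ) * α ^ 6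
/-- `u^{1/2}`. -/
def uHalf (Q γ α : ℂ) : ℂ := Q ^ (-1 : ℤ) * γ ^ (-2 : ℤ) * α ^ 3
/-- `v = q^{1/3} c^{2/3} a`. -/
def vPar (Q γ α : ℂ) : ℂ := Q ^ 2 * γ ^ 4 * α ^ 6
/-- `v^{1/2}`. -/
def vHalf (Q γ α : ℂ) : ℂ := Q * γ ^ 2 * α ^ 3

/-- `sᵢ` on the parameters `α`. -/
def sPar (i : Fin 3) (α : Fin 3 → ℂ) : Fin 3 → ℂ := fun j => α j * α i ^ (-cartan i j)

/-- `π` on the parameters `α`. -/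
def piPar (α : Fin 3 → ℂ) : Fin 3 → ℂ := fun i => α (i + 1)

/-- `R₁ = π² s₁` on the parameters `α`. -/
def R₁Par (α : Fin 3 → ℂ) : Fin 3 → ℂ := sPar 1 (piPar (piPar α))

def sAct (Q : ℂ) (i : Fin 3) (p : Pt) : Pt where
  α := sPar i p.α
  γ := p.γ
  τ := Function.update p.τ i
    ((uPar Q p.γ (p.α i) * p.τ (i + 1) * p.τb (i - 1) + p.τb (i + 1) * p.τ (i - 1))
      / (uHalf Q p.γ (p.α i) * p.τb i))
  τb := Function.update p.τb i
    ((vPar Q p.γ (p.α i) * p.τb (i + 1) * p.τ (i - 1) + p.τ (i + 1) * p.τb (i - 1))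
      / (vHalf Q p.γ (p.α i) * p.τ i))

def piAct (p : Pt) : Pt where
  α := piPar p.α
  γ := p.γ
  τ := fun i => p.τ (i + 1)
  τb := fun i => p.τb (i + 1)

/-- `r`; on `c` it is `c ↦ 1 / (q c)` because `f₀ f₁ f₂ = q c²` and `r(fᵢ) = 1 / fᵢ`. -/
def rAct (Q : ℂ) (p : Pt) : Pt where
  α := p.α
  γ := (Q * p.γ)⁻¹
  τ := p.τb
  τb := p.τ

/-- `w₀`; on `c` it is `c ↦ 1 / c` because `w₀(f₀ f₁ f₂) = q² / (f₀ f₁ f₂)`. -/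
def w₀Act (Q : ℂ) (p : Pt) : Pt where
  α := p.α
  γ := p.γ⁻¹
  τ := p.τ
  τb := fun i =>
    p.α (i + 1) ^ 2
        * (p.τb i * p.τ (i + 1) * p.τ (i + 2)
          + uPar Q p.γ (p.α (i - 1)) * p.τ i * p.τb (i + 1) * p.τ (i + 2)
          + (uPar Q p.γ (p.α (i + 1)))⁻¹ * p.τ i * p.τ (i + 1) * p.τb (i + 2))
      / (p.α (i + 2) ^ 2 * p.τb (i + 1) * p.τb (i + 2))

/-- `R₁ = π² s₁`. -/
def R₁ (Q : ℂ) (p : Pt) : Pt := sAct Q 1 (piAct (piAct p))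
/-- `R₁⁻¹ = s₁ π`. -/
def R₁Inv (Q : ℂ) (p : Pt) : Pt := piAct (sAct Q 1 p)
/-- `T₂ = s₁ π s₂`. -/
def T₂ (Q : ℂ) (p : Pt) : Pt := sAct Q 2 (piAct (sAct Q 1 p))
/-- `T₄ = r w₀`. -/
def T₄ (Q : ℂ) (p : Pt) : Pt := w₀Act Q (rAct Q p)
/-- `T₄⁻¹ = w₀ r`. -/
def T₄Inv (Q : ℂ) (p : Pt) : Pt := rAct Q (w₀Act Q p)

/-- `p' = p.R₁` with the denominators cleared. -/
structure R₁Rel (Q : ℂ) (p p' : Pt) : Prop where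
  α : p'.α = R₁Par p.α
  γ : p'.γ = p.γ
  τ₀ : p'.τ 0 = p.τ 2
  τ₂ : p'.τ 2 = p.τ 1
  τb₀ : p'.τb 0 = p.τb 2
  τb₂ : p'.τb 2 = p.τb 1
  τ₁ : uHalf Q p.γ (p.α 0) * p.τb 0 * p'.τ 1
    = uPar Q p.γ (p.α 0) * p.τ 1 * p.τb 2 + p.τb 1 * p.τ 2
  τb₁ : vHalf Q p.γ (p.α 0) * p.τ 0 * p'.τb 1
    = vPar Q p.γ (p.α 0) * p.τb 1 * p.τ 2 + p.τ 1 * p.τb 2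

/-- `p' = p.T₄` with the denominators cleared. -/
structure T₄Rel (Q : ℂ) (p p' : Pt) : Prop where
  α : p'.α = p.α
  γ : p'.γ = Q * p.γ
  τ : p'.τ = p.τb
  τb : ∀ i, p.α (i + 2) ^ 2 * p.τ (i + 1) * p.τ (i + 2) * p'.τb i
    = p.α (i + 1) ^ 2
        * (p.τ i * p.τb (i + 1) * p.τb (i + 2)
          + vPar Q p.γ (p.α (i - 1)) * p.τb i * p.τ (i + 1) * p.τb (i + 2)
          + (vPar Q p.γ (p.α (i + 1)))⁻¹ * p.τb i * p.τb (i + 1) * p.τ (i + 2))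

/-- `p' = p.T₄⁻¹` with the denominators cleared. -/
structure T₄InvRel (Q : ℂ) (p p' : Pt) : Prop where
  α : p'.α = p.α
  γ : Q * p'.γ = p.γ
  τb : p'.τb = p.τ
  τ : ∀ i, p.α (i + 2) ^ 2 * p.τb (i + 1) * p.τb (i + 2) * p'.τ i
    = p.α (i + 1) ^ 2
        * (p.τb i * p.τ (i + 1) * p.τ (i + 2)
          + uPar Q p.γ (p.α (i - 1)) * p.τ i * p.τb (i + 1) * p.τ (i + 2)
          + (uPar Q p.γ (p.α (i + 1)))⁻¹ * p.τ i * p.τ (i + 1) * p.τb (i + 2))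

/-! ### Hypergeometric τ functions of q-P_II -/

/-- The parameters `(α₀, α₁, α₂)` with `α₀ α₁ α₂ = Q`. -/
def parPt (Q α₀ α₂ : ℂ) : Fin 3 → ℂ := ![α₀, Q / (α₀ * α₂), α₂]

/-- The point of the τ lattice at `(k, N)`, i.e. `R₁ᵏ T₄ᴺ` applied to `α`, `γ = 1` and
`τ₀ = τ_0^{-2}`, `τ₁ = τ_0^0`, `τ₂ = τ_0^{-1}`, `τ̄₀ = τ_1^{-2}`, `τ̄₁ = τ_1^0`, `τ̄₂ = τ_1^{-1}`;
recall that `α₂ ^ k` is `Q ^ (k / 2)`. -/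
def latticePt (Q α₂ : ℂ) (T : ℤ → ℤ → ℂ → ℂ) (k N : ℤ) (α₀ : ℂ) : Pt where
  α := parPt Q (α₂ ^ k * α₀) α₂
  γ := Q ^ N
  τ := ![T (k - 2) N α₀, T k N α₀, T (k - 1) N α₀]
  τb := ![T (k - 2) (N + 1) α₀, T k (N + 1) α₀, T (k - 1) (N + 1) α₀]

/-- The dependent variable `X_k(N) = f_{0,N}^k` of q-P_II in terms of the τ functions. -/
def fromTau (Q : ℂ) (T : ℤ → ℤ → ℂ → ℂ) (k N : ℤ) (α₀ : ℂ) : ℂ :=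
  Q ^ (2 * (2 * N + 1))
    * (T k (N + 1) α₀ * T (k - 1) N α₀ / (T k N α₀ * T (k - 1) (N + 1) α₀))

/-- `T k N α₀ = τ_N^k` (for `α₀ ∈ D`, on the line `α₂ = Q^{1/2}`, `γ = 1`) is a family of
hypergeometric τ functions of q-P_II: it vanishes for `N < 0`, is consistent with the action of
`⟨R₁, T₄⟩`, and satisfies the bilinear equation of q-P_II and, for its ratios, q-P_II itself. -/
structure IsHypergeometricTauII (Q α₂ : ℂ) (D : Set ℂ) (T : ℤ → ℤ → ℂ → ℂ) : Prop where
  boundary : ∀ k N : ℤ, N < 0 → ∀ α₀ ∈ D, T k N α₀ = 0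
  ne_zero : ∀ k : ℤ, ∀ α₀ ∈ D, T k 0 α₀ ≠ 0
  /-- `τ_N^k(α₀) = τ_N^0(Q^{k/2} α₀)`. -/
  shift : ∀ k N : ℤ, ∀ α₀ ∈ D, α₂ ^ k * α₀ ∈ D ∧ T k N α₀ = T 0 N (α₂ ^ k * α₀)
  R₁_act : ∀ k N : ℤ, ∀ α₀ ∈ D,
    (latticePt Q α₂ T k N α₀).τ 0 ≠ 0 → (latticePt Q α₂ T k N α₀).τb 0 ≠ 0 →
      R₁ Q (latticePt Q α₂ T k N α₀) = latticePt Q α₂ T (k + 1) N α₀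
  R₁Inv_act : ∀ k N : ℤ, ∀ α₀ ∈ D,
    (latticePt Q α₂ T k N α₀).τ 1 ≠ 0 → (latticePt Q α₂ T k N α₀).τb 1 ≠ 0 →
      R₁Inv Q (latticePt Q α₂ T k N α₀) = latticePt Q α₂ T (k - 1) N α₀
  T₄_act : ∀ k N : ℤ, ∀ α₀ ∈ D, (∀ i, (latticePt Q α₂ T k N α₀).τ i ≠ 0) →
    T₄ Q (latticePt Q α₂ T k N α₀) = latticePt Q α₂ T k (N + 1) α₀
  T₄Inv_act : ∀ k N : ℤ, ∀ α₀ ∈ D, (∀ i, (latticePt Q α₂ T k N α₀).τb i ≠ 0) →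
    T₄Inv Q (latticePt Q α₂ T k N α₀) = latticePt Q α₂ T k (N - 1) α₀
  R₁_rel : ∀ k N : ℤ, ∀ α₀ ∈ D,
    R₁Rel Q (latticePt Q α₂ T k N α₀) (latticePt Q α₂ T (k + 1) N α₀)
  T₄_rel : ∀ k N : ℤ, ∀ α₀ ∈ D,
    T₄Rel Q (latticePt Q α₂ T k N α₀) (latticePt Q α₂ T k (N + 1) α₀)
  T₄Inv_rel : ∀ k N : ℤ, ∀ α₀ ∈ D,
    T₄InvRel Q (latticePt Q α₂ T k N α₀) (latticePt Q α₂ T k (N - 1) α₀)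
  bilinear : ∀ k N : ℤ, ∀ α₀ ∈ D,
    T k (N + 1) α₀ * T (k + 1) (N - 1) α₀
      - α₂ ^ (k - 4 * N + 1) * α₀ * T (k + 2) N α₀ * T (k - 1) N α₀
      - Q ^ (-k + 4 * N - 1) * α₀ ^ (-2 : ℤ) * T (k + 1) N α₀ * T k N α₀ = 0
  /-- q-P_II with `a₀ = α₀ ^ 6`, `q = Q ^ 6`, `q^{k/2} = α₂ ^ (6 k)`, `c = 1`. -/
  qPII : ∀ k N : ℤ, ∀ α₀ ∈ D,
    (∀ j ∈ Finset.Icc (k - 2) (k + 1), T j N α₀ ≠ 0 ∧ T j (N + 1) α₀ ≠ 0) →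
      α₀ ^ 6 * α₂ ^ (6 * k) + fromTau Q T k N α₀ ≠ 0 ∧
      fromTau Q T (k + 1) N α₀ =
        (Q ^ 6) ^ (2 * N + 1) / (fromTau Q T k N α₀ * fromTau Q T (k - 1) N α₀)
          * ((1 + α₀ ^ 6 * α₂ ^ (6 * k) * fromTau Q T k N α₀)
            / (α₀ ^ 6 * α₂ ^ (6 * k) + fromTau Q T k N α₀))

/-- The values of `α₀` for which, on the line `α₂ = Q^{1/2}`, no theta or elliptic gamma function
in `τ_N^k` has a zero or a pole. -/
def generic (Q α₂ : ℂ) : Set ℂ :=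
  {α₀ | α₀ ≠ 0 ∧ ∀ j : ℤ, α₀ ^ 12 ≠ Q ^ (6 * j) ∧ α₀ ^ 2 * α₂ ≠ Q ^ j}

/-- The coefficients `A_{n,m}`, `B_{n,m}` are periodic and `R₁(A_{n,m}) = B_{n,m}` holds at the
given value of `α₂`. -/
structure Symmetrized (Q α₂ : ℂ) (A B : ℂ → ℂ → ℂ) : Prop where
  periodA : PeriodOne Q A
  periodB : PeriodOne Q B
  R₁_A : ∀ n m : ℤ, ∀ α₀ : ℂ, α₀ ≠ 0 →
    latticeFun Q A n m (R₁Par (parPt Q α₀ α₂) 0) (R₁Par (parPt Q α₀ α₂) 2)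
      = latticeFun Q B n m α₀ α₂

/-- `R₁ T₂ = s₂`, that is `R₁ = s₂ T₂⁻¹`, wherever the maps involved are defined. -/
theorem T₂_R₁ (Q : ℂ) (p : Pt) (hQ : Q ≠ 0) (hγ : p.γ ≠ 0) (hα : p.α 0 ≠ 0)
    (hτ : p.τ 0 ≠ 0) (hτb : p.τb 0 ≠ 0)
    (h : uPar Q p.γ (p.α 0) * p.τ 1 * p.τb 2 + p.τb 1 * p.τ 2 ≠ 0)
    (h' : vPar Q p.γ (p.α 0) * p.τb 1 * p.τ 2 + p.τ 1 * p.τb 2 ≠ 0) :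
    T₂ Q (R₁ Q p) = sAct Q 2 p := by
  unfold T₂ R₁
  congr 1
  simp only [uPar, vPar] at h h'
  have e1 : (1 : Fin 3) + 1 = 2 := rfl
  have e2 : (2 : Fin 3) + 1 = 0 := rfl
  ext i
  · fin_cases i <;>
      simp [piAct, sAct, piPar, sPar, cartan, e1, e2] <;> field_simp
  · rfl
  · fin_cases i
    · simp [piAct, sAct, piPar, sPar, cartan, e1, e2, uPar, uHalf, vPar, vHalf, Function.update]
      field_simp
      ring
    · simp [piAct, sAct, e1, e2]
    · simp [piAct, sAct, e1, e2]
  · fin_cases i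
    · simp [piAct, sAct, piPar, sPar, cartan, e1, e2, uPar, uHalf, vPar, vHalf, Function.update]
      field_simp
      have h2 : p.α 0 ^ 6 * p.τ 1 * p.τb 2 + Q ^ 2 * p.γ ^ 4 * p.τb 1 * p.τ 2 ≠ 0 := by
        intro hz
        apply h
        field_simp
        linear_combination hz
      rw [div_eq_one_iff_eq h2]
      ring
    · simp [piAct, sAct, e1, e2]
    · simp [piAct, sAct, e1, e2]

end QPainleve

end

open QPainleve

open QPainleve

/-! Write `y` for `Q^{1/2}` and `q = y ^ 12`. On the line `α₂ = y` the map `R₁` fixes `α₂` and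
multiplies `α₀` by `y`, so it is a square root of the shift `α₀ ↦ Q α₀`. The hypothesis on the
coefficients becomes `B(u) = A(y u)`. Therefore the entries `F_{n,-1}` and `F_{n,0}`, which look
like two different sequences, are up to a theta ratio the values at `y ^ (2n) α₀` and `y ^ (2n-1)
α₀` of one function, `entryFun`. Consequently `τ_N^k` is one function `tauLine` evaluated at `y ^ k
α₀` (`tauII_eq_tauLine`), and everything reduces to identities along one orbit of multiplication by
`y`.

The contiguity relations of `₁φ₁` give `entryFun` a three-term recurrence in `w ↦ y w`. The theta
quotient in `τ` is exactly the gauge that turns its coefficients into monomials: `h k = β h (k+2) +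
γ k h (k+1)` with `γ (k+2) = δ γ k` (`gaugedSeq_recurrence`). For any such sequence let `D_N(k) =
det h (k + 2(j - i))`. Column operations based on the recurrence show that `D_N(k-1)`, `D_N(k)`,
`D_N(k+1)` and the determinants with one or two rows fewer share all columns but two. Three-term
Plücker relations then yield four bilinear identities, `toeplitzInt_relation_last`, `_first`,
`_upper` and `_lower`.

Each identity multiplies values at the orbit positions 0, 3 or 1, 2. The elliptic gamma factors
satisfy a bilinear relation between the same pairs (`gammaFactor_bilinear`), so the identities pass
to the `τ` functions (`OrbitRelations`). The relations `last` and `first` are the action of `R₁`;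
`upper` is the bilinear equation of the theorem; each trilinear relation for `T₄` or its inverse is
a combination of two of the four; the quotient of `first` by `last` is q-P_II.

For the parameter count, `τ_1^k` is a nonzero multiple of `entryFun`, which is linear in `A`. Its
values at `w` and `y w` form a 2 × 2 system for `A(w)` and `A(y w)` whose determinant is, up to
nonzero factors, the q-analogue of `cos² + sin² = 1` (`qCos_mul_qCos_add`), so `A` is recovered. -/

namespace QPainleve

/-! ### Bordered determinants and the three-term Plücker relation -/

section Bordered

variable {K : Type*} {M : ℕ}

/-- The square matrix with columns `u`, `A 0, …, A (M - 1)`, `v`. -/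
def borderedMatrix (A : Fin M → Fin (M + 2) → K) (u v : Fin (M + 2) → K) :
    Matrix (Fin (M + 2)) (Fin (M + 2)) K :=
  Matrix.of fun i j => (Fin.cons u (Fin.snoc A v : Fin (M + 1) → Fin (M + 2) → K) :
    Fin (M + 2) → Fin (M + 2) → K) j i

theorem borderedMatrix_updateCol_zero (A : Fin M → Fin (M + 2) → K) (u v w : Fin (M + 2) → K) :
    (borderedMatrix A u v).updateCol 0 w = borderedMatrix A w v := by
  ext i j
  refine Fin.cases ?_ (fun j => ?_) j <;> simp [borderedMatrix]

theorem borderedMatrix_updateCol_last (A : Fin M → Fin (M + 2) → K) (u v w : Fin (M + 2) → K) :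
    (borderedMatrix A u v).updateCol (Fin.last _) w = borderedMatrix A u w := by
  ext i j
  refine Fin.cases ?_ (fun j => ?_) j
  · simp [borderedMatrix, Fin.ext_iff]
  · refine Fin.lastCases ?_ (fun j => ?_) j
    · simp [borderedMatrix]
    · simp [borderedMatrix, Fin.ext_iff, j.2.ne]

variable [Field K]

/-- The determinant with columns `u`, `A 0, …, A (M - 1)`, `v`. -/
def borderedDet (A : Fin M → Fin (M + 2) → K) (u v : Fin (M + 2) → K) : K :=
  (borderedMatrix A u v).det


theorem cramer_borderedMatrix_zero (A : Fin M → Fin (M + 2) → K) (u v w : Fin (M + 2) → K) :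
    (borderedMatrix A u v).cramer w 0 = borderedDet A w v := by
  rw [Matrix.cramer_apply, borderedMatrix_updateCol_zero, borderedDet]

theorem cramer_borderedMatrix_last (A : Fin M → Fin (M + 2) → K) (u v w : Fin (M + 2) → K) :
    (borderedMatrix A u v).cramer w (Fin.last _) = borderedDet A u w := by
  rw [Matrix.cramer_apply, borderedMatrix_updateCol_last, borderedDet]

/-- `borderedDet A u v` as a linear functional of `u`. -/
def borderedFunctional (A : Fin M → Fin (M + 2) → K) (v : Fin (M + 2) → K) :
    (Fin (M + 2) → K) →ₗ[K] K :=
  LinearMap.proj 0 ∘ₗ (borderedMatrix A 0 v).cramer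

theorem borderedFunctional_apply (A : Fin M → Fin (M + 2) → K) (u v : Fin (M + 2) → K) :
    borderedFunctional A v u = borderedDet A u v := by
  simp [borderedFunctional, cramer_borderedMatrix_zero]

theorem borderedDet_column (A : Fin M → Fin (M + 2) → K) (v : Fin (M + 2) → K) (j : Fin M) :
    borderedDet A (A j) v = 0 := by
  refine Matrix.det_zero_of_column_eq (i := 0) (j := j.castSucc.succ) (by simp [Fin.ext_iff]) ?_
  intro i
  simp [borderedMatrix]

/-- The three-term Plücker relation. -/
theorem borderedDet_plucker (A : Fin M → Fin (M + 2) → K) (a b c e : Fin (M + 2) → K) :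
    borderedDet A a b * borderedDet A c e
      = borderedDet A c b * borderedDet A a e + borderedDet A a c * borderedDet A b e := by
  -- Cramer's rule expands `det(a, A, b) • c` in the columns of the matrix. The functional `det(·,
  -- A, e)` kills the inner columns, so only the terms of `a` and `b` survive.
  have h := Matrix.mulVec_cramer (borderedMatrix A a b) c
  have h2 := congrArg (borderedFunctional A e) h
  rw [Matrix.mulVec_eq_sum, map_sum, map_smul, Fin.sum_univ_succ, Fin.sum_univ_castSucc] at h2
  have hz : ∀ j : Fin M, borderedFunctional A e
      (MulOpposite.op ((borderedMatrix A a b).cramer c j.castSucc.succ) •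
        (borderedMatrix A a b).transpose j.castSucc.succ) = 0 := by
    intro j
    have : (borderedMatrix A a b).transpose j.castSucc.succ = A j := by
      ext i
      simp [borderedMatrix]
    rw [this, op_smul_eq_smul, map_smul, borderedFunctional_apply, borderedDet_column, smul_zero]
  rw [Finset.sum_eq_zero fun j _ => hz j] at h2
  have e0 : (borderedMatrix A a b).transpose 0 = a := by
    ext i; simp [borderedMatrix]
  have e1 : (borderedMatrix A a b).transpose (Fin.last M).succ = b := by
    ext i; simp [borderedMatrix]
  have hc := cramer_borderedMatrix_last A a b c
  rw [← Fin.succ_last] at hc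
  simp only [op_smul_eq_smul, map_smul, e0, e1, borderedFunctional_apply,
    cramer_borderedMatrix_zero, hc, smul_eq_mul] at h2
  have h3 : (borderedMatrix A a b).det = borderedDet A a b := rfl
  rw [h3] at h2
  linear_combination -h2

theorem borderedDet_self (A : Fin M → Fin (M + 2) → K) (v : Fin (M + 2) → K) :
    borderedDet A v v = 0 := by
  refine Matrix.det_zero_of_column_eq (i := 0) (j := Fin.last _) (by simp [Fin.ext_iff]) ?_
  intro i
  rw [← Fin.succ_last]
  simp [borderedMatrix]

theorem borderedDet_swap (A : Fin M → Fin (M + 2) → K) (u v : Fin (M + 2) → K) :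
    borderedDet A u v = -borderedDet A v u := by
  have h1 : ∀ a b c, borderedDet A (a + b) c = borderedDet A a c + borderedDet A b c := by
    intro a b c
    simp only [← borderedFunctional_apply, map_add]
  have h2 : ∀ a b c, borderedDet A a (b + c) = borderedDet A a b + borderedDet A a c := by
    intro a b c
    rw [← cramer_borderedMatrix_last A a 0, map_add, Pi.add_apply,
      cramer_borderedMatrix_last, cramer_borderedMatrix_last]
  have := borderedDet_self A (u + v)
  rw [h1, h2, h2, borderedDet_self, borderedDet_self] at this
  linear_combination this

theorem borderedDet_single_zero (A : Fin M → Fin (M + 2) → K) (v : Fin (M + 2) → K) :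
    borderedDet A (Pi.single 0 1) v = (Matrix.of fun i j : Fin (M + 1) =>
      (Fin.snoc A v : Fin (M + 1) → Fin (M + 2) → K) j i.succ).det := by
  rw [borderedDet, Matrix.det_succ_column_zero, Finset.sum_eq_single 0]
  · simp only [borderedMatrix, Matrix.of_apply, Fin.cons_zero, Pi.single_eq_same, Fin.val_zero,
      pow_zero, one_mul]
    congr 1
  · intro i _ hi
    simp [borderedMatrix, hi]
  · simp

theorem borderedDet_single_last (A : Fin M → Fin (M + 2) → K) (u : Fin (M + 2) → K) :
    borderedDet A u (Pi.single (Fin.last _) 1) = (Matrix.of fun i j : Fin (M + 1) =>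
      (Fin.cons u A : Fin (M + 1) → Fin (M + 2) → K) j i.castSucc).det := by
  rw [borderedDet, Matrix.det_succ_column _ (Fin.last _), Finset.sum_eq_single (Fin.last _)]
  · have h0 : borderedMatrix A u (Pi.single (Fin.last _) 1) (Fin.last _) (Fin.last _) = 1 := by
      simp only [borderedMatrix, Matrix.of_apply]
      rw [Fin.cons_snoc_eq_snoc_cons, Fin.snoc_last, Pi.single_eq_same]
    rw [h0, ← two_mul, pow_mul]
    simp only [neg_one_sq, one_pow, one_mul]
    congr 1
    ext i j
    simp only [borderedMatrix, Matrix.submatrix_apply, Matrix.of_apply, Fin.succAbove_last]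
    rw [Fin.cons_snoc_eq_snoc_cons, Fin.snoc_castSucc]
  · intro i _ hi
    have h0 : borderedMatrix A u (Pi.single (Fin.last _) 1) i (Fin.last _) = 0 := by
      simp only [borderedMatrix, Matrix.of_apply]
      rw [Fin.cons_snoc_eq_snoc_cons, Fin.snoc_last, Pi.single_eq_of_ne hi]
    rw [h0]
    ring
  · simp

theorem borderedDet_single_single (A : Fin M → Fin (M + 2) → K) :
    borderedDet A (Pi.single 0 1) (Pi.single (Fin.last _) 1)
      = (Matrix.of fun i j : Fin M => A j i.castSucc.succ).det := by
  rw [borderedDet_single_last, Matrix.det_succ_column_zero, Finset.sum_eq_single 0]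
  · simp only [Matrix.of_apply, Fin.cons_zero, Fin.castSucc_zero, Pi.single_eq_same, Fin.val_zero,
      pow_zero, one_mul]
    congr 1
  · intro i _ hi
    have : i.castSucc ≠ 0 := by simpa using hi
    simp [this]
  · simp

/-- Moving the last of `M + 1` columns to the front is a cyclic rotation, of sign `(-1) ^ M`. -/
theorem det_snoc_eq_det_cons {m : Type*} (A : Fin M → m → K)
    (v : m → K) (g : Fin (M + 1) → m) :
    (Matrix.of fun i j : Fin (M + 1) => (Fin.snoc A v : Fin (M + 1) → m → K) j (g i)).det
      = (-1) ^ M * (Matrix.of fun i j : Fin (M + 1) =>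
          (Fin.cons v A : Fin (M + 1) → m → K) j (g i)).det := by
  have h := Matrix.det_permute' (finRotate (M + 1)) (Matrix.of fun i j : Fin (M + 1) =>
          (Fin.cons v A : Fin (M + 1) → m → K) j (g i))
  rw [sign_finRotate] at h
  simp only [Nat.add_sub_cancel, Units.val_pow_eq_pow_val, Units.val_neg, Units.val_one,
    Int.cast_pow, Int.cast_neg, Int.cast_one] at h
  rw [← h]
  congr 1
  ext i j
  rw [Fin.snoc_eq_cons_rotate]
  rfl

end Bordered

/-! ### Toeplitz determinants of a sequence with a three-term recurrence -/

section Toeplitz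

variable {K : Type*} [Field K]

/-- The Toeplitz determinant `det (h (k + 2 (j - i)))` of size `N`. -/
def toeplitz (h : ℤ → K) (N : ℕ) (k : ℤ) : K :=
  (Matrix.of fun i j : Fin N => h (k + 2 * ((j : ℕ) : ℤ) - 2 * ((i : ℕ) : ℤ))).det

theorem prod_mul_pow_fin (n : ℕ) (c d : K) :
    ∏ j : Fin n, (c * d ^ (j : ℕ)) = c ^ n * d ^ (n.choose 2) := by
  rw [Fin.prod_univ_eq_prod_range (fun j => c * d ^ j) n, Finset.prod_mul_distrib,
    Finset.prod_const, Finset.card_range, Finset.prod_pow_eq_pow_sum, Finset.sum_range_id,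
    Nat.choose_two_right]

/-- Recognizes a bordered determinant as a Toeplitz determinant: the row factors `μ ε ^ i` come out
of the determinant. -/
theorem det_rowScaled_toeplitz (h : ℤ → K) (n : ℕ) (k : ℤ) (μ ε : K) (f : Fin n → Fin n → K)
    (hf : ∀ i j : Fin n, f i j
      = μ * ε ^ (i : ℕ) * h (k + 2 * ((j : ℕ) : ℤ) - 2 * ((i : ℕ) : ℤ))) :
    (Matrix.of f).det = μ ^ n * ε ^ (n.choose 2) * toeplitz h n k := by
  have : Matrix.of f = Matrix.of fun i j : Fin n => (μ * ε ^ (i : ℕ))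
      * (Matrix.of fun i j : Fin n => h (k + 2 * ((j : ℕ) : ℤ) - 2 * ((i : ℕ) : ℤ))) i j := by
    ext i j
    exact hf i j
  rw [this, Matrix.det_mul_column, prod_mul_pow_fin, toeplitz]

variable {h γ : ℤ → K} {β δ : K}

theorem gamma_add_two_mul (hδ : ∀ k, γ (k + 2) = δ * γ k) (hδ0 : δ ≠ 0) (k n : ℤ) :
    γ (k + 2 * n) = δ ^ n * γ k := by
  induction n using Int.induction_on with
  | zero => simp
  | succ n ih =>
    rw [show k + 2 * ((n : ℤ) + 1) = k + 2 * n + 2 by ring, hδ, ih, zpow_add_one₀ hδ0]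
    ring
  | pred n ih =>
    have := hδ (k + 2 * (-(n : ℤ) - 1))
    rw [show k + 2 * (-(n : ℤ) - 1) + 2 = k + 2 * -(n : ℤ) by ring, ih] at this
    rw [zpow_sub_one₀ hδ0]
    rw [mul_right_comm, this]
    field_simp

/-- The recurrence along the entries of two adjacent columns. -/
theorem column_recurrence (hrec : ∀ k, h k = β * h (k + 2) + γ k * h (k + 1))
    (hδ : ∀ k, γ (k + 2) = δ * γ k) (hδ0 : δ ≠ 0) (k : ℤ) (i j : ℕ) :
    h (k - 1 + 2 * (j : ℤ) - 2 * (i : ℤ)) = β * h (k + 1 + 2 * (j : ℤ) - 2 * (i : ℤ))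
      + γ (k - 1) * δ ^ j * (δ⁻¹ ^ i * h (k + 2 * (j : ℤ) - 2 * (i : ℤ))) := by
  rw [hrec (k - 1 + 2 * (j : ℤ) - 2 * (i : ℤ)),
    show k - 1 + 2 * (j : ℤ) - 2 * (i : ℤ) = k - 1 + 2 * ((j : ℤ) - i) by ring,
    gamma_add_two_mul hδ hδ0, zpow_sub₀ hδ0, zpow_natCast, zpow_natCast,
    show k - 1 + 2 * ((j : ℤ) - i) + 2 = k + 1 + 2 * (j : ℤ) - 2 * (i : ℤ) by ring,
    show k - 1 + 2 * ((j : ℤ) - i) + 1 = k + 2 * (j : ℤ) - 2 * (i : ℤ) by ring, inv_pow]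
  field_simp

/-- Column reduction of a Toeplitz determinant that keeps the last column. -/
theorem toeplitz_eq_lastColumn (hrec : ∀ k, h k = β * h (k + 2) + γ k * h (k + 1))
    (hδ : ∀ k, γ (k + 2) = δ * γ k) (hδ0 : δ ≠ 0) (n : ℕ) (k : ℤ) (f : Fin (n + 1) → Fin n → K)
    (g : Fin (n + 1) → K)
    (hf : ∀ i j, f i j = δ⁻¹ ^ (i : ℕ) * h (k + 2 * ((j : ℕ) : ℤ) - 2 * ((i : ℕ) : ℤ)))
    (hg : ∀ i, g i = h (k - 1 + 2 * (n : ℤ) - 2 * ((i : ℕ) : ℤ))) :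
    toeplitz h (n + 1) (k - 1) = γ (k - 1) ^ n * δ ^ (n.choose 2)
      * (Matrix.of fun i j => (Fin.snoc (f i) (g i) : Fin (n + 1) → K) j).det := by
  -- The recurrence expresses a column through the one on its right, while the column-operation
  -- lemma refers to the preceding column; hence both matrices are reversed.
  have e1 := Matrix.det_submatrix_equiv_self (Fin.revPerm (n := n + 1))
    (Matrix.of fun i j : Fin (n + 1) => h (k - 1 + 2 * ((j : ℕ) : ℤ) - 2 * ((i : ℕ) : ℤ)))
  set X : Matrix (Fin (n + 1)) (Fin (n + 1)) K :=
    Matrix.of fun i j => (Fin.snoc (f i) (g i) : Fin (n + 1) → K) j with hX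
  set v : Fin (n + 1) → K :=
    (Fin.snoc (fun j : Fin n => γ (k - 1) * δ ^ (j : ℕ)) 1 : Fin (n + 1) → K) with hv
  have e2 := Matrix.det_submatrix_equiv_self (Fin.revPerm (n := n + 1))
    (Matrix.of fun i j => v j * X i j)
  have e3 : ∏ i, v i = γ (k - 1) ^ n * δ ^ (n.choose 2) := by
    rw [Fin.prod_univ_castSucc]
    simp only [hv, Fin.snoc_castSucc, Fin.snoc_last, mul_one]
    exact prod_mul_pow_fin n _ _
  rw [Matrix.det_mul_row, e3] at e2
  rw [← e2, toeplitz, ← e1]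
  refine Matrix.det_eq_of_forall_col_eq_smul_add_pred (fun _ => β) ?_ ?_
  · intro i
    simp [hv, hX, hg]
  · intro i j
    simp only [Matrix.submatrix_apply, Matrix.of_apply, Fin.revPerm_apply, Fin.rev_succ,
      Fin.rev_castSucc, hv, hX, Fin.snoc_castSucc, hf, Fin.val_castSucc, Fin.val_succ]
    rw [column_recurrence hrec hδ hδ0]
    push_cast
    rw [show k - 1 + 2 * (((j.rev : ℕ) : ℤ) + 1) = k + 1 + 2 * ((j.rev : ℕ) : ℤ) by ring]
    ring

/-- Column reduction of a Toeplitz determinant that keeps the first column. -/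
theorem toeplitz_eq_firstColumn (hrec : ∀ k, h k = β * h (k + 2) + γ k * h (k + 1))
    (hδ : ∀ k, γ (k + 2) = δ * γ k) (hβ : β ≠ 0) (hδ0 : δ ≠ 0) (n : ℕ) (k : ℤ)
    (f : Fin (n + 1) → Fin n → K) (g : Fin (n + 1) → K)
    (hf : ∀ i j, f i j = δ⁻¹ ^ (i : ℕ) * h (k + 2 * (((j : ℕ) : ℤ) + 1) - 2 * ((i : ℕ) : ℤ)))
    (hg : ∀ i, g i = h (k + 1 - 2 * ((i : ℕ) : ℤ))) :
    toeplitz h (n + 1) (k + 1) = (-β⁻¹ * γ (k - 1) * δ) ^ n * δ ^ (n.choose 2)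
      * (Matrix.of fun i j => (Fin.cons (g i) (f i) : Fin (n + 1) → K) j).det := by
  set X : Matrix (Fin (n + 1)) (Fin (n + 1)) K :=
    Matrix.of fun i j => (Fin.cons (g i) (f i) : Fin (n + 1) → K) j with hX
  set v : Fin (n + 1) → K :=
    (Fin.cons 1 (fun j : Fin n => -β⁻¹ * γ (k - 1) * δ * δ ^ (j : ℕ)) : Fin (n + 1) → K) with hv
  have e3 : ∏ i, v i = (-β⁻¹ * γ (k - 1) * δ) ^ n * δ ^ (n.choose 2) := by
    rw [Fin.prod_univ_succ]
    simp only [hv, Fin.cons_zero, Fin.cons_succ, one_mul]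
    exact prod_mul_pow_fin n _ _
  rw [← e3, ← Matrix.det_mul_row, toeplitz]
  refine Matrix.det_eq_of_forall_col_eq_smul_add_pred (fun _ => β⁻¹) ?_ ?_
  · intro i
    simp [hv, hX, hg]
  · intro i j
    simp only [Matrix.of_apply, hv, hX, Fin.cons_succ, hf, Fin.val_castSucc, Fin.val_succ]
    have := column_recurrence hrec hδ hδ0 k i (j + 1)
    push_cast at this ⊢
    rw [show k - 1 + 2 * (((j : ℕ) : ℤ) + 1) = k + 1 + 2 * ((j : ℕ) : ℤ) by ring] at this
    rw [this]
    field_simp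
    ring

end Toeplitz

/-! ### Ten minors and four bilinear relations of Toeplitz determinants -/

section ToeplitzRelations

variable {K : Type*} [Field K] {h γ : ℤ → K} {β δ : K}

/-- The vector of the scaled column `j` of a Toeplitz determinant. -/
def toeplitzColumn (h : ℤ → K) (δ : K) (k : ℤ) (m : ℕ) (j : ℤ) : Fin m → K :=
  fun i => δ⁻¹ ^ (i : ℕ) * h (k + 2 * j - 2 * ((i : ℕ) : ℤ))

/-- The vector of the unscaled column `j`, with the index of `h` lowered by one. -/
def toeplitzBorder (h : ℤ → K) (k : ℤ) (m : ℕ) (j : ℤ) : Fin m → K :=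
  fun i => h (k - 1 + 2 * j - 2 * ((i : ℕ) : ℤ))

/-- The inner columns shared by all determinants in the Plücker relations. -/
def toeplitzInner (h : ℤ → K) (δ : K) (k : ℤ) (M : ℕ) : Fin M → Fin (M + 2) → K :=
  fun j => toeplitzColumn h δ k (M + 2) (((j : ℕ) : ℤ) + 1)

/-- Five vectors are used beside the inner columns: the scaled columns 0 and `M + 1`, the border
(whose two positions 1 and `M + 1` are proportional modulo the inner columns), and the first and
last unit vectors. Each of their ten pairs gives a Toeplitz determinant of size `M`, `M + 1` or `M +
2`, a unit vector deleting a row. This is the first of the ten. -/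
theorem borderedDet_column_column (k : ℤ) (M : ℕ) :
    borderedDet (toeplitzInner h δ k M) (toeplitzColumn h δ k (M + 2) 0)
      (toeplitzColumn h δ k (M + 2) (M + 1))
      = δ⁻¹ ^ ((M + 2).choose 2) * toeplitz h (M + 2) k := by
  have := det_rowScaled_toeplitz h (M + 2) k 1 δ⁻¹
    (fun i j => (borderedMatrix (toeplitzInner h δ k M) (toeplitzColumn h δ k (M + 2) 0)
      (toeplitzColumn h δ k (M + 2) (M + 1))) i j) ?_
  · rw [one_pow, one_mul] at this
    exact this
  · intro i j
    refine Fin.cases ?_ (fun j => Fin.lastCases ?_ (fun j => ?_) j) j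
    · simp [borderedMatrix, toeplitzColumn]
    · simp [borderedMatrix, toeplitzColumn]
    · simp [borderedMatrix, toeplitzColumn, toeplitzInner]

theorem borderedDet_column_border (hrec : ∀ k, h k = β * h (k + 2) + γ k * h (k + 1))
    (hδ : ∀ k, γ (k + 2) = δ * γ k) (hδ0 : δ ≠ 0) (k : ℤ) (M : ℕ) :
    γ (k - 1) ^ (M + 1) * δ ^ ((M + 1).choose 2) *
      borderedDet (toeplitzInner h δ k M) (toeplitzColumn h δ k (M + 2) 0)
        (toeplitzBorder h k (M + 2) (M + 1))
      = toeplitz h (M + 2) (k - 1) := by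
  rw [toeplitz_eq_lastColumn hrec hδ hδ0 (M + 1) k
    (fun i j => δ⁻¹ ^ (i : ℕ) * h (k + 2 * ((j : ℕ) : ℤ) - 2 * ((i : ℕ) : ℤ)))
    (fun i => h (k - 1 + 2 * ((M + 1 : ℕ) : ℤ) - 2 * ((i : ℕ) : ℤ)))
    (fun _ _ => rfl) (fun _ => rfl), borderedDet]
  congr 2
  ext i j
  refine Fin.lastCases ?_ (fun j => ?_) j
  · simp [borderedMatrix, Fin.cons_snoc_eq_snoc_cons, toeplitzBorder]
  · refine Fin.cases ?_ (fun j => ?_) j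
    · simp [borderedMatrix, toeplitzColumn]
    · simp only [Matrix.of_apply, Fin.snoc_castSucc]
      simp [borderedMatrix, toeplitzColumn, toeplitzInner]

theorem borderedDet_border_column (hrec : ∀ k, h k = β * h (k + 2) + γ k * h (k + 1))
    (hδ : ∀ k, γ (k + 2) = δ * γ k) (hβ : β ≠ 0) (hδ0 : δ ≠ 0) (k : ℤ) (M : ℕ) :
    (-β⁻¹ * γ (k - 1) * δ) ^ (M + 1) * δ ^ ((M + 1).choose 2) *
      borderedDet (toeplitzInner h δ k M) (toeplitzBorder h k (M + 2) 1)
        (toeplitzColumn h δ k (M + 2) (M + 1))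
      = toeplitz h (M + 2) (k + 1) := by
  rw [toeplitz_eq_firstColumn hrec hδ hβ hδ0 (M + 1) k
    (fun i j => δ⁻¹ ^ (i : ℕ) * h (k + 2 * (((j : ℕ) : ℤ) + 1) - 2 * ((i : ℕ) : ℤ)))
    (fun i => h (k + 1 - 2 * ((i : ℕ) : ℤ)))
    (fun _ _ => rfl) (fun _ => rfl), borderedDet]
  congr 2
  ext i j
  refine Fin.cases ?_ (fun j => Fin.lastCases ?_ (fun j => ?_) j) j
  · simp [borderedMatrix, toeplitzBorder]
    ring_nf
  · simp [borderedMatrix, toeplitzColumn]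
  · simp [borderedMatrix, toeplitzColumn, toeplitzInner]

theorem toeplitzBorder_succ (hrec : ∀ k, h k = β * h (k + 2) + γ k * h (k + 1))
    (hδ : ∀ k, γ (k + 2) = δ * γ k) (hδ0 : δ ≠ 0) (k : ℤ) (m j : ℕ) :
    toeplitzBorder h k m j = β • toeplitzBorder h k m (j + 1)
      + (γ (k - 1) * δ ^ j) • toeplitzColumn h δ k m j := by
  ext i
  simp only [toeplitzBorder, toeplitzColumn, Pi.add_apply, Pi.smul_apply, smul_eq_mul]
  rw [column_recurrence hrec hδ hδ0]
  ring_nf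

/-- By the recurrence, border `j` equals `β` times border `j + 1` plus a multiple of column `j`, and
for `1 ≤ j ≤ M` that column is an inner one. This identifies the border in `D(k+1)` with the one in
`D(k-1)`. -/
theorem borderedDet_border_one (hrec : ∀ k, h k = β * h (k + 2) + γ k * h (k + 1))
    (hδ : ∀ k, γ (k + 2) = δ * γ k) (hδ0 : δ ≠ 0) (k : ℤ) (M : ℕ) (v : Fin (M + 2) → K) :
    borderedDet (toeplitzInner h δ k M) (toeplitzBorder h k (M + 2) 1) v
      = β ^ M * borderedDet (toeplitzInner h δ k M) (toeplitzBorder h k (M + 2) (M + 1)) v := by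
  have key : ∀ j : ℕ, j ≤ M →
      borderedDet (toeplitzInner h δ k M) (toeplitzBorder h k (M + 2) 1) v
        = β ^ j * borderedDet (toeplitzInner h δ k M) (toeplitzBorder h k (M + 2) (j + 1)) v := by
    intro j
    induction j with
    | zero => intro _; simp
    | succ j ih =>
      intro hj
      have e := toeplitzBorder_succ hrec hδ hδ0 k (M + 2) (j + 1)
      have e2 : toeplitzColumn h δ k (M + 2) ((j + 1 : ℕ) : ℤ)
          = toeplitzInner h δ k M ⟨j, hj⟩ := by
        simp [toeplitzInner]
      rw [ih (by omega)]
      push_cast at e e2 ⊢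
      rw [e, e2, ← borderedFunctional_apply, map_add, map_smul, map_smul, borderedFunctional_apply,
        borderedFunctional_apply, borderedDet_column]
      simp only [smul_eq_mul, mul_zero, add_zero]
      ring
  exact key M le_rfl

theorem borderedDet_column_last (k : ℤ) (M : ℕ) :
    borderedDet (toeplitzInner h δ k M) (toeplitzColumn h δ k (M + 2) 0)
      (Pi.single (Fin.last _) 1) = δ⁻¹ ^ ((M + 1).choose 2) * toeplitz h (M + 1) k := by
  rw [borderedDet_single_last]
  have := det_rowScaled_toeplitz h (M + 1) k 1 δ⁻¹ (fun i j =>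
    (Fin.cons (toeplitzColumn h δ k (M + 2) 0) (toeplitzInner h δ k M) :
      Fin (M + 1) → Fin (M + 2) → K) j i.castSucc) ?_
  · rwa [one_pow, one_mul] at this
  · intro i j
    refine Fin.cases ?_ (fun j => ?_) j
    · simp [toeplitzColumn]
    · simp [toeplitzColumn, toeplitzInner]

theorem borderedDet_border_last (hrec : ∀ k, h k = β * h (k + 2) + γ k * h (k + 1))
    (hδ : ∀ k, γ (k + 2) = δ * γ k) (hβ : β ≠ 0) (hδ0 : δ ≠ 0) (k : ℤ) (M : ℕ) :
    (-β⁻¹ * γ (k - 1) * δ) ^ M * δ ^ (M.choose 2) *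
      borderedDet (toeplitzInner h δ k M) (toeplitzBorder h k (M + 2) 1)
        (Pi.single (Fin.last _) 1) = toeplitz h (M + 1) (k + 1) := by
  rw [toeplitz_eq_firstColumn hrec hδ hβ hδ0 M k
    (fun i j => δ⁻¹ ^ (i : ℕ) * h (k + 2 * (((j : ℕ) : ℤ) + 1) - 2 * ((i : ℕ) : ℤ)))
    (fun i => h (k + 1 - 2 * ((i : ℕ) : ℤ)))
    (fun _ _ => rfl) (fun _ => rfl), borderedDet_single_last]
  congr 2
  ext i j
  refine Fin.cases ?_ (fun j => ?_) j
  · simp [toeplitzBorder]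
    ring_nf
  · simp [toeplitzColumn, toeplitzInner]

theorem borderedDet_lastColumn_last (k : ℤ) (M : ℕ) :
    borderedDet (toeplitzInner h δ k M) (toeplitzColumn h δ k (M + 2) (M + 1))
      (Pi.single (Fin.last _) 1)
      = (-1) ^ M * (δ⁻¹ ^ ((M + 1).choose 2) * toeplitz h (M + 1) (k + 2)) := by
  have := det_rowScaled_toeplitz h (M + 1) (k + 2) 1 δ⁻¹ (fun i j =>
    (Fin.snoc (toeplitzInner h δ k M) (toeplitzColumn h δ k (M + 2) (M + 1)) :
      Fin (M + 1) → Fin (M + 2) → K) j i.castSucc) ?_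
  · rw [one_pow, one_mul] at this
    rw [← this, borderedDet_single_last, det_snoc_eq_det_cons (g := Fin.castSucc), ← mul_assoc,
      ← mul_pow]
    simp
  · intro i j
    refine Fin.lastCases ?_ (fun j => ?_) j
    · simp [toeplitzColumn]
      exact Or.inl (by ring_nf)
    · simp [toeplitzColumn, toeplitzInner]
      exact Or.inl (by ring_nf)

theorem borderedDet_first_column (k : ℤ) (M : ℕ) :
    borderedDet (toeplitzInner h δ k M) (Pi.single 0 1) (toeplitzColumn h δ k (M + 2) (M + 1))
      = δ⁻¹ ^ (M + 1) * δ⁻¹ ^ ((M + 1).choose 2) * toeplitz h (M + 1) k := by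
  rw [borderedDet_single_zero]
  refine det_rowScaled_toeplitz h (M + 1) k δ⁻¹ δ⁻¹ (fun i j =>
    (Fin.snoc (toeplitzInner h δ k M) (toeplitzColumn h δ k (M + 2) (M + 1)) :
      Fin (M + 1) → Fin (M + 2) → K) j i.succ) ?_
  intro i j
  refine Fin.lastCases ?_ (fun j => ?_) j
  · simp [toeplitzColumn]
    ring_nf
  · simp [toeplitzColumn, toeplitzInner]
    ring_nf

theorem borderedDet_first_border (hrec : ∀ k, h k = β * h (k + 2) + γ k * h (k + 1))
    (hδ : ∀ k, γ (k + 2) = δ * γ k) (hδ0 : δ ≠ 0) (k : ℤ) (M : ℕ) :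
    γ (k - 1) ^ M * δ ^ (M.choose 2) *
      borderedDet (toeplitzInner h δ k M) (Pi.single 0 1) (toeplitzBorder h k (M + 2) (M + 1))
      = δ⁻¹ ^ M * toeplitz h (M + 1) (k - 1) := by
  rw [toeplitz_eq_lastColumn hrec hδ hδ0 M k
    (fun i j => δ⁻¹ ^ (i : ℕ) * h (k + 2 * ((j : ℕ) : ℤ) - 2 * ((i : ℕ) : ℤ)))
    (fun i => h (k - 1 + 2 * ((M : ℕ) : ℤ) - 2 * ((i : ℕ) : ℤ)))
    (fun _ _ => rfl) (fun _ => rfl), borderedDet_single_zero, mul_left_comm]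
  congr 1
  -- Deleting row 0 shifts the row index, so each of the `M` scaled columns gains a factor `δ⁻¹` and
  -- the unscaled border gains none.
  have hp : ∏ j : Fin (M + 1), (Fin.snoc (fun _ : Fin M => δ⁻¹) 1 : Fin (M + 1) → K) j
      = δ⁻¹ ^ M := by
    rw [Fin.prod_univ_castSucc]
    simp
  rw [← hp, ← Matrix.det_mul_row]
  congr 1
  ext i j
  refine Fin.lastCases ?_ (fun j => ?_) j
  · simp [toeplitzBorder]
    ring_nf
  · simp [toeplitzColumn, toeplitzInner]
    ring_nf

theorem borderedDet_first_firstColumn (k : ℤ) (M : ℕ) :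
    borderedDet (toeplitzInner h δ k M) (Pi.single 0 1) (toeplitzColumn h δ k (M + 2) 0)
      = (-1) ^ M *
        (δ⁻¹ ^ (M + 1) * δ⁻¹ ^ ((M + 1).choose 2) * toeplitz h (M + 1) (k - 2)) := by
  rw [borderedDet_single_zero, det_snoc_eq_det_cons (g := Fin.succ)]
  congr 1
  refine det_rowScaled_toeplitz h (M + 1) (k - 2) δ⁻¹ δ⁻¹ (fun i j =>
    (Fin.cons (toeplitzColumn h δ k (M + 2) 0) (toeplitzInner h δ k M) :
      Fin (M + 1) → Fin (M + 2) → K) j i.succ) ?_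
  intro i j
  refine Fin.cases ?_ (fun j => ?_) j
  · simp [toeplitzColumn]
    ring_nf
  · simp [toeplitzColumn, toeplitzInner]
    ring_nf

theorem borderedDet_first_last (k : ℤ) (M : ℕ) :
    borderedDet (toeplitzInner h δ k M) (Pi.single 0 1) (Pi.single (Fin.last _) 1)
      = δ⁻¹ ^ M * δ⁻¹ ^ (M.choose 2) * toeplitz h M k := by
  rw [borderedDet_single_single]
  refine det_rowScaled_toeplitz h M k δ⁻¹ δ⁻¹ (fun i j =>
    toeplitzInner h δ k M j i.castSucc.succ) ?_
  intro i j
  simp [toeplitzColumn, toeplitzInner]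
  ring_nf

theorem eq_pow_mul_of_eq_inv_pow_mul {a b : K} (hδ0 : δ ≠ 0) (n : ℕ) (h : a = δ⁻¹ ^ n * b) :
    b = δ ^ n * a := by
  rw [h, inv_pow]
  field_simp

theorem neg_one_pow_mul_self_eq_one (M : ℕ) : ((-1 : K) ^ M) * (-1) ^ M = 1 := by
  rw [← mul_pow]
  simp

theorem eq_neg_one_pow_mul {a b : K} (M : ℕ) (h : a = (-1) ^ M * b) : b = (-1) ^ M * a := by
  rw [h, ← mul_assoc, neg_one_pow_mul_self_eq_one, one_mul]

/-- Plücker relation for column 0, the border, column `M + 1` and the last unit vector, where `N = M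
+ 1`. For `N = 0` it is the recurrence itself. -/
theorem toeplitz_relation_last (hrec : ∀ k, h k = β * h (k + 2) + γ k * h (k + 1))
    (hδ : ∀ k, γ (k + 2) = δ * γ k) (hβ : β ≠ 0) (hδ0 : δ ≠ 0) (N : ℕ) (k : ℤ) :
    δ ^ N * toeplitz h (N + 1) (k - 1) * toeplitz h N (k + 2)
      = γ (k - 1) * toeplitz h (N + 1) k * toeplitz h N (k + 1)
        + β * toeplitz h N k * toeplitz h (N + 1) (k + 1) := by
  cases N with
  | zero =>
    have := hrec (k - 1)
    rw [show k - 1 + 2 = k + 1 by ring, show k - 1 + 1 = k by ring] at this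
    simp [toeplitz, this, add_comm]
  | succ M =>
    have hp := borderedDet_plucker (toeplitzInner h δ k M)
      (toeplitzColumn h δ k (M + 2) 0) (toeplitzBorder h k (M + 2) (M + 1))
      (toeplitzColumn h δ k (M + 2) (M + 1)) (Pi.single (Fin.last _) 1)
    have h1 := eq_pow_mul_of_eq_inv_pow_mul hδ0 _
      (borderedDet_column_column (h := h) (δ := δ) k M)
    have h2 := borderedDet_column_border hrec hδ hδ0 k M
    have h3 := borderedDet_border_column hrec hδ hβ hδ0 k M
    have h4 := eq_pow_mul_of_eq_inv_pow_mul hδ0 _ (borderedDet_column_last (h := h) (δ := δ) k M)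
    have h5 := borderedDet_border_last hrec hδ hβ hδ0 k M
    have h6 := eq_pow_mul_of_eq_inv_pow_mul hδ0 _
      (eq_neg_one_pow_mul _ (borderedDet_lastColumn_last (h := h) (δ := δ) k M)).symm
    rw [borderedDet_border_one hrec hδ hδ0] at h3 h5
    rw [borderedDet_swap _ (toeplitzColumn h δ k (M + 2) (M + 1)) (toeplitzBorder _ _ _ _)] at hp
    rw [← h2, ← h3, h1, h4, ← h5, h6]
    simp only [Nat.choose_succ_succ' (M + 1) 1, Nat.choose_succ_succ' M 1, Nat.choose_one_right,
      pow_add, mul_pow, neg_pow β⁻¹, inv_pow, pow_one]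
    field_simp
    linear_combination γ (k - 1) * γ (k - 1) ^ M * hp

/-- The same with the first unit vector in place of the last. -/
theorem toeplitz_relation_first (hrec : ∀ k, h k = β * h (k + 2) + γ k * h (k + 1))
    (hδ : ∀ k, γ (k + 2) = δ * γ k) (hβ : β ≠ 0) (hδ0 : δ ≠ 0) (N : ℕ) (k : ℤ) :
    β * toeplitz h N (k - 2) * toeplitz h (N + 1) (k + 1)
      = δ ^ N * (toeplitz h (N + 1) (k - 1) * toeplitz h N k
        - γ (k - 1) * toeplitz h (N + 1) k * toeplitz h N (k - 1)) := by
  cases N with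
  | zero =>
    have := hrec (k - 1)
    rw [show k - 1 + 2 = k + 1 by ring, show k - 1 + 1 = k by ring] at this
    simp [toeplitz, this]
  | succ M =>
    have hp := borderedDet_plucker (toeplitzInner h δ k M)
      (toeplitzColumn h δ k (M + 2) 0) (toeplitzBorder h k (M + 2) (M + 1))
      (toeplitzColumn h δ k (M + 2) (M + 1)) (Pi.single 0 1)
    have h1 := eq_pow_mul_of_eq_inv_pow_mul hδ0 _
      (borderedDet_column_column (h := h) (δ := δ) k M)
    have h2 := borderedDet_column_border hrec hδ hδ0 k M
    have h3 := borderedDet_border_column hrec hδ hβ hδ0 k M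
    have h4 := eq_neg_one_pow_mul _ (borderedDet_first_firstColumn (h := h) (δ := δ) k M)
    rw [← pow_add] at h4
    replace h4 := eq_pow_mul_of_eq_inv_pow_mul hδ0 _ h4.symm
    have h5 := eq_pow_mul_of_eq_inv_pow_mul hδ0 _
      (borderedDet_first_border hrec hδ hδ0 k M)
    have h6 := borderedDet_first_column (h := h) (δ := δ) k M
    rw [← pow_add] at h6
    replace h6 := eq_pow_mul_of_eq_inv_pow_mul hδ0 _ h6
    rw [borderedDet_border_one hrec hδ hδ0] at h3
    rw [borderedDet_swap _ (toeplitzColumn h δ k (M + 2) (M + 1)) (toeplitzBorder _ _ _ _),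
      borderedDet_swap _ _ (Pi.single 0 1), borderedDet_swap _ _ (Pi.single 0 1),
      borderedDet_swap _ _ (Pi.single 0 1)] at hp
    rw [← h2, ← h3, h1, h4, h5, h6]
    simp only [Nat.choose_succ_succ' (M + 1) 1, Nat.choose_succ_succ' M 1, Nat.choose_one_right,
      pow_add, mul_pow, neg_pow β⁻¹, inv_pow, pow_one]
    rcases neg_one_pow_eq_or K M with hs | hs <;> rw [hs] <;> field_simp <;>
      linear_combination γ (k - 1) * γ (k - 1) ^ M * hp

/-- Both unit vectors together with column 0 and the border. Two rows are deleted in one factor,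
which makes three consecutive sizes appear. -/
theorem toeplitz_relation_upper (hrec : ∀ k, h k = β * h (k + 2) + γ k * h (k + 1))
    (hδ : ∀ k, γ (k + 2) = δ * γ k) (hβ : β ≠ 0) (hδ0 : δ ≠ 0) (N : ℕ) (k : ℤ) :
    δ ^ (N + 1) * toeplitz h (N + 2) (k - 1) * toeplitz h N k
      = γ (k - 1) * (δ ^ (N + 1) * toeplitz h (N + 1) k * toeplitz h (N + 1) (k - 1)
        - toeplitz h (N + 1) (k - 2) * toeplitz h (N + 1) (k + 1)) := by
  have hp := borderedDet_plucker (toeplitzInner h δ k N)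
    (toeplitzColumn h δ k (N + 2) 0) (toeplitzBorder h k (N + 2) (N + 1))
    (Pi.single 0 1) (Pi.single (Fin.last _) 1)
  have h1 := borderedDet_column_border hrec hδ hδ0 k N
  have h2 := borderedDet_first_last (h := h) (δ := δ) k N
  rw [← pow_add] at h2
  replace h2 := eq_pow_mul_of_eq_inv_pow_mul hδ0 _ h2
  have h3 := eq_neg_one_pow_mul _ (borderedDet_first_firstColumn (h := h) (δ := δ) k N)
  rw [← pow_add] at h3
  replace h3 := eq_pow_mul_of_eq_inv_pow_mul hδ0 _ h3.symm
  have h4 := borderedDet_border_last hrec hδ hβ hδ0 k N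
  have h5 := eq_pow_mul_of_eq_inv_pow_mul hδ0 _ (borderedDet_column_last (h := h) (δ := δ) k N)
  have h6 := eq_pow_mul_of_eq_inv_pow_mul hδ0 _ (borderedDet_first_border hrec hδ hδ0 k N)
  rw [borderedDet_border_one hrec hδ hδ0] at h4
  rw [borderedDet_swap _ _ (Pi.single 0 1)] at hp
  rw [← h1, h2, h3, ← h4, h5, h6]
  simp only [Nat.choose_succ_succ' N 1, Nat.choose_one_right,
    pow_add, mul_pow, neg_pow β⁻¹, inv_pow, pow_one]
  rcases neg_one_pow_eq_or K N with hs | hs <;> rw [hs] <;> field_simp <;>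
    linear_combination γ (k - 1) * γ (k - 1) ^ N * hp

/-- Both unit vectors together with the border and column `N + 1`; this mirrors the previous
relation. -/
theorem toeplitz_relation_lower (hrec : ∀ k, h k = β * h (k + 2) + γ k * h (k + 1))
    (hδ : ∀ k, γ (k + 2) = δ * γ k) (hβ : β ≠ 0) (hδ0 : δ ≠ 0) (N : ℕ) (k : ℤ) :
    β * toeplitz h (N + 2) (k + 1) * toeplitz h N k
      = γ (k - 1) * (δ ^ (N + 1) * toeplitz h (N + 1) (k - 1) * toeplitz h (N + 1) (k + 2)
        - toeplitz h (N + 1) (k + 1) * toeplitz h (N + 1) k) := by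
  have hp := borderedDet_plucker (toeplitzInner h δ k N)
    (toeplitzBorder h k (N + 2) (N + 1)) (toeplitzColumn h δ k (N + 2) (N + 1))
    (Pi.single 0 1) (Pi.single (Fin.last _) 1)
  have h1 := borderedDet_border_column hrec hδ hβ hδ0 k N
  have h2 := borderedDet_first_last (h := h) (δ := δ) k N
  rw [← pow_add] at h2
  replace h2 := eq_pow_mul_of_eq_inv_pow_mul hδ0 _ h2
  have h3 := eq_pow_mul_of_eq_inv_pow_mul hδ0 _ (borderedDet_first_border hrec hδ hδ0 k N)
  have h4 := eq_pow_mul_of_eq_inv_pow_mul hδ0 _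
      (eq_neg_one_pow_mul _ (borderedDet_lastColumn_last (h := h) (δ := δ) k N)).symm
  have h5 := borderedDet_border_last hrec hδ hβ hδ0 k N
  have h6 := borderedDet_first_column (h := h) (δ := δ) k N
  rw [← pow_add] at h6
  replace h6 := eq_pow_mul_of_eq_inv_pow_mul hδ0 _ h6
  rw [borderedDet_border_one hrec hδ hδ0] at h1 h5
  rw [borderedDet_swap _ _ (Pi.single 0 1)] at hp
  rw [← h1, h2, h3, h4, ← h5, h6]
  simp only [Nat.choose_succ_succ' N 1, Nat.choose_one_right,
    pow_add, mul_pow, neg_pow β⁻¹, inv_pow, pow_one]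
  field_simp
  linear_combination -γ (k - 1) * γ (k - 1) ^ N * hp

end ToeplitzRelations

/-! ### The bilinear relations for all integer sizes -/

section ToeplitzInt

variable {K : Type*} [Field K] {h γ : ℤ → K} {β δ : K}

/-- The Toeplitz determinant of integer size, zero for negative sizes. -/
def toeplitzInt (h : ℤ → K) (N k : ℤ) : K := if N < 0 then 0 else toeplitz h N.toNat k

theorem toeplitzInt_natCast (h : ℤ → K) (n : ℕ) (k : ℤ) : toeplitzInt h n k = toeplitz h n k := by
  simp [toeplitzInt]

theorem toeplitzInt_of_neg (h : ℤ → K) {N : ℤ} (hN : N < 0) (k : ℤ) : toeplitzInt h N k = 0 := by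
  simp [toeplitzInt, hN]

theorem toeplitzInt_zero (h : ℤ → K) (k : ℤ) : toeplitzInt h 0 k = 1 := by
  simp [toeplitzInt, toeplitz]

theorem toeplitzInt_one (h : ℤ → K) (k : ℤ) : toeplitzInt h 1 k = h k := by
  simp [toeplitzInt, toeplitz]

theorem toeplitzInt_relation_last (hrec : ∀ k, h k = β * h (k + 2) + γ k * h (k + 1))
    (hδ : ∀ k, γ (k + 2) = δ * γ k) (hβ : β ≠ 0) (hδ0 : δ ≠ 0) (N k : ℤ) :
    δ ^ N * toeplitzInt h (N + 1) (k - 1) * toeplitzInt h N (k + 2)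
      = γ (k - 1) * toeplitzInt h (N + 1) k * toeplitzInt h N (k + 1)
        + β * toeplitzInt h N k * toeplitzInt h (N + 1) (k + 1) := by
  rcases lt_or_ge N 0 with hN | hN
  -- Every term has a factor of size `N`.
  · simp [toeplitzInt_of_neg h hN]
  · lift N to ℕ using hN
    have := toeplitz_relation_last hrec hδ hβ hδ0 N k
    simp only [← toeplitzInt_natCast] at this
    exact_mod_cast this

theorem toeplitzInt_relation_first (hrec : ∀ k, h k = β * h (k + 2) + γ k * h (k + 1))
    (hδ : ∀ k, γ (k + 2) = δ * γ k) (hβ : β ≠ 0) (hδ0 : δ ≠ 0) (N k : ℤ) :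
    β * toeplitzInt h N (k - 2) * toeplitzInt h (N + 1) (k + 1)
      = δ ^ N * (toeplitzInt h (N + 1) (k - 1) * toeplitzInt h N k
        - γ (k - 1) * toeplitzInt h (N + 1) k * toeplitzInt h N (k - 1)) := by
  rcases lt_or_ge N 0 with hN | hN
  · simp [toeplitzInt_of_neg h hN]
  · lift N to ℕ using hN
    have := toeplitz_relation_first hrec hδ hβ hδ0 N k
    simp only [← toeplitzInt_natCast] at this
    exact_mod_cast this

theorem toeplitzInt_relation_upper (hrec : ∀ k, h k = β * h (k + 2) + γ k * h (k + 1))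
    (hδ : ∀ k, γ (k + 2) = δ * γ k) (hβ : β ≠ 0) (hδ0 : δ ≠ 0) (N k : ℤ) :
    δ ^ N * toeplitzInt h (N + 1) (k - 1) * toeplitzInt h (N - 1) k
      = γ (k - 1) * (δ ^ N * toeplitzInt h N k * toeplitzInt h N (k - 1)
        - toeplitzInt h N (k - 2) * toeplitzInt h N (k + 1)) := by
  rcases lt_trichotomy N 0 with hN | rfl | hN
  · simp [toeplitzInt_of_neg h hN, toeplitzInt_of_neg h (show N - 1 < 0 by lia)]
  -- Size `-1` annihilates the left side, and the bracket on the right is `1 - 1`.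
  · simp [toeplitzInt_zero, toeplitzInt_of_neg]
  · obtain ⟨M, rfl⟩ : ∃ M : ℕ, N = M + 1 := ⟨(N - 1).toNat, by lia⟩
    have := toeplitz_relation_upper hrec hδ hβ hδ0 M k
    simp only [← toeplitzInt_natCast] at this
    push_cast at this
    rw [add_sub_cancel_right, add_assoc]
    exact_mod_cast this

theorem toeplitzInt_relation_lower (hrec : ∀ k, h k = β * h (k + 2) + γ k * h (k + 1))
    (hδ : ∀ k, γ (k + 2) = δ * γ k) (hβ : β ≠ 0) (hδ0 : δ ≠ 0) (N k : ℤ) :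
    β * toeplitzInt h (N + 1) (k + 1) * toeplitzInt h (N - 1) k
      = γ (k - 1) * (δ ^ N * toeplitzInt h N (k - 1) * toeplitzInt h N (k + 2)
        - toeplitzInt h N (k + 1) * toeplitzInt h N k) := by
  rcases lt_trichotomy N 0 with hN | rfl | hN
  · simp [toeplitzInt_of_neg h hN, toeplitzInt_of_neg h (show N - 1 < 0 by lia)]
  · simp [toeplitzInt_zero, toeplitzInt_of_neg]
  · obtain ⟨M, rfl⟩ : ∃ M : ℕ, N = M + 1 := ⟨(N - 1).toNat, by lia⟩
    have := toeplitz_relation_lower hrec hδ hβ hδ0 M k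
    simp only [← toeplitzInt_natCast] at this
    push_cast at this
    rw [add_sub_cancel_right, add_assoc]
    exact_mod_cast this

end ToeplitzInt

/-! ### Infinite products, theta functions and the elliptic gamma function -/

section Products

variable {q : ℂ}

theorem summable_norm_neg_mul_pow (hq : ‖q‖ < 1) (a : ℂ) : Summable fun i : ℕ => ‖-(a * q ^ i)‖ := by
  simp only [norm_neg, norm_mul, norm_pow]
  exact (summable_geometric_of_lt_one (norm_nonneg q) hq).mul_left _

theorem multipliable_one_sub_mul_pow (hq : ‖q‖ < 1) (a : ℂ) :
    Multipliable fun i : ℕ => 1 - a * q ^ i := by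
  simpa only [sub_eq_add_neg] using
    multipliable_one_add_of_summable (summable_norm_neg_mul_pow hq a)

theorem qInf_eq_mul (hq : ‖q‖ < 1) (a : ℂ) : qInf a q = (1 - a) * qInf (q * a) q := by
  have h : ∀ i : ℕ, 1 - a * q ^ (i + 1) = 1 - q * a * q ^ i := fun i => by ring
  rw [qInf, tprod_eq_zero_mul', qInf]
  · simp only [h, pow_zero, mul_one]
  · simp only [h]
    exact multipliable_one_sub_mul_pow hq _

theorem qInf_ne_zero (hq : ‖q‖ < 1) {a : ℂ} (ha : ∀ i : ℕ, a * q ^ i ≠ 1) : qInf a q ≠ 0 := by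
  have := tprod_one_add_ne_zero_of_summable (f := fun i : ℕ => -(a * q ^ i)) ?_
    (summable_norm_neg_mul_pow hq a)
  · simpa only [qInf, sub_eq_add_neg] using this
  · intro i
    rw [← sub_eq_add_neg, sub_ne_zero]
    exact (ha i).symm

theorem qInf_mul_qInf_neg (hq : ‖q‖ < 1) (a : ℂ) :
    qInf a q * qInf (-a) q = qInf (a ^ 2) (q ^ 2) := by
  rw [qInf, qInf, ← (multipliable_one_sub_mul_pow hq a).tprod_mul
    (multipliable_one_sub_mul_pow hq (-a)), qInf]
  refine tprod_congr fun i => ?_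
  ring

theorem theta_mul_self (hq : ‖q‖ < 1) (hq0 : q ≠ 0) {w : ℂ} (hw : w ≠ 0) :
    theta (q * w) q = -w⁻¹ * theta w q := by
  rw [theta, theta, qInf_eq_mul hq w, show q * (q * w)⁻¹ = w⁻¹ by field_simp,
    qInf_eq_mul hq w⁻¹]
  field_simp
  ring

theorem theta_div (hq0 : q ≠ 0) (w : ℂ) : theta (q * w⁻¹) q = theta w q := by
  rw [theta, theta, mul_inv, inv_inv, mul_inv_cancel_left₀ hq0, mul_comm]

theorem theta_ne_zero (hq : ‖q‖ < 1) (hq0 : q ≠ 0) {w : ℂ} (hw : w ≠ 0)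
    (h : ∀ j : ℤ, w ≠ q ^ j) : theta w q ≠ 0 := by
  refine mul_ne_zero (qInf_ne_zero hq fun i hi => h (-i) ?_)
    (qInf_ne_zero hq fun i hi => h (i + 1) ?_)
  · rw [zpow_neg, zpow_natCast]
    exact eq_inv_of_mul_eq_one_left hi
  · rw [zpow_add_one₀ hq0, zpow_natCast]
    field_simp at hi
    rw [← hi]
    ring

theorem theta_mul_theta_neg (hq : ‖q‖ < 1) (w : ℂ) :
    theta w q * theta (-w) q = theta (w ^ 2) (q ^ 2) := by
  rw [theta, theta, theta, ← qInf_mul_qInf_neg hq, show q ^ 2 * (w ^ 2)⁻¹ = (q * w⁻¹) ^ 2 by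
    rw [mul_pow, inv_pow], ← qInf_mul_qInf_neg hq, inv_neg, mul_neg]
  ring

theorem summable_norm_neg_pow_mul_pow_mul (hq : ‖q‖ < 1) (a : ℂ) :
    Summable fun ij : ℕ × ℕ => ‖-(q ^ ij.1 * q ^ ij.2 * a)‖ := by
  have h := summable_geometric_of_lt_one (norm_nonneg q) hq
  have h2 := (h.mul_of_nonneg h (fun i => by positivity) fun i => by positivity).mul_right ‖a‖
  simpa only [norm_neg, norm_mul, norm_pow] using h2

theorem multipliable_one_sub_pow_mul_pow_mul (hq : ‖q‖ < 1) (a : ℂ) :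
    Multipliable fun ij : ℕ × ℕ => 1 - q ^ ij.1 * q ^ ij.2 * a := by
  simpa only [sub_eq_add_neg] using
    multipliable_one_add_of_summable (summable_norm_neg_pow_mul_pow_mul hq a)

/-- The double product as an iterated one, so that shifting the argument strips off one row
`(a;q)_∞`. -/
theorem hasProd_qInf (hq : ‖q‖ < 1) (a : ℂ) :
    HasProd (fun i : ℕ => qInf (q ^ i * a) q) (qInf₂ a q q) := by
  refine HasProd.prod_fiberwise (multipliable_one_sub_pow_mul_pow_mul hq a).hasProd fun i => ?_
  have : HasProd _ (qInf (q ^ i * a) q) :=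
    (multipliable_one_sub_mul_pow hq (q ^ i * a)).hasProd
  convert this using 2 with j
  ring

theorem qInf₂_eq_mul (hq : ‖q‖ < 1) (a : ℂ) :
    qInf₂ a q q = qInf a q * qInf₂ (q * a) q q := by
  have h : ∀ i : ℕ, qInf (q ^ (i + 1) * a) q = qInf (q ^ i * (q * a)) q := fun i => by
    rw [pow_succ, mul_assoc]
  rw [← (hasProd_qInf hq a).tprod_eq, tprod_eq_zero_mul', ← (hasProd_qInf hq (q * a)).tprod_eq]
  · simp only [h, pow_zero, one_mul]
  · simp only [h]
    exact (hasProd_qInf hq (q * a)).multipliable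

theorem qInf₂_ne_zero (hq : ‖q‖ < 1) {a : ℂ} (ha : ∀ i : ℕ, a * q ^ i ≠ 1) : qInf₂ a q q ≠ 0 := by
  have := tprod_one_add_ne_zero_of_summable (f := fun ij : ℕ × ℕ => -(q ^ ij.1 * q ^ ij.2 * a)) ?_
    (summable_norm_neg_pow_mul_pow_mul hq a)
  · simpa only [qInf₂, sub_eq_add_neg] using this
  · intro ij
    rw [← sub_eq_add_neg, sub_ne_zero, ← pow_add, mul_comm]
    exact (ha _).symm

theorem ellGamma_ne_zero (hq : ‖q‖ < 1) (hq0 : q ≠ 0) {z : ℂ} (hz : z ≠ 0)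
    (h : ∀ j : ℤ, z ≠ q ^ j) : ellGamma z q q ≠ 0 := by
  refine div_ne_zero (qInf₂_ne_zero hq fun i hi => h (i + 2) ?_)
    (qInf₂_ne_zero hq fun i hi => h (-i) ?_)
  · rw [zpow_add₀ hq0, zpow_natCast]
    field_simp at hi
    rw [← hi]
    norm_cast
    ring
  · rw [zpow_neg, zpow_natCast]
    exact eq_inv_of_mul_eq_one_left hi

/-- The shift strips one row from the numerator of `Γ(qz)` and one from the denominator of `Γ(z)`;
the two rows are the two factors of `Θ(z)`. -/
theorem ellGamma_mul_self (hq : ‖q‖ < 1) (hq0 : q ≠ 0) {z : ℂ} (hz : z ≠ 0)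
    (h : ∀ j : ℤ, z ≠ q ^ j) : ellGamma (q * z) q q = theta z q * ellGamma z q q := by
  have h1 : qInf z q ≠ 0 := (mul_ne_zero_iff.mp (theta_ne_zero hq hq0 hz h)).1
  rw [ellGamma, ellGamma, theta, show q * q * (q * z)⁻¹ = q * z⁻¹ by field_simp,
    qInf₂_eq_mul hq (q * z⁻¹), qInf₂_eq_mul hq z, ← mul_assoc q q z⁻¹]
  field_simp

end Products

/-! ### Contiguity relations of `₁φ₁` -/

section BasicHypergeometric

open Filter Topology

variable {b p : ℂ}

theorem qFactorial_succ (a q : ℂ) (n : ℕ) :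
    qFactorial a q (n + 1) = qFactorial a q n * (1 - a * q ^ n) := Finset.prod_range_succ _ _

theorem qFactorial_succ' (a q : ℂ) (n : ℕ) :
    qFactorial a q (n + 1) = (1 - a) * qFactorial (a * q) q n := by
  rw [qFactorial, Finset.prod_range_succ', mul_comm, qFactorial]
  simp only [pow_zero, mul_one, pow_succ']
  congr 1
  exact Finset.prod_congr rfl fun i _ => by ring

theorem qFactorial_zero_left (q : ℂ) (n : ℕ) : qFactorial 0 q n = 1 := by
  simp [qFactorial]

theorem qFactorial_ne_zero {a q : ℂ} (h : ∀ n : ℕ, a * q ^ n ≠ 1) (n : ℕ) :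
    qFactorial a q n ≠ 0 :=
  Finset.prod_ne_zero_iff.mpr fun i _ => sub_ne_zero.mpr (h i).symm

/-- The general term of `₁φ₁(0; b; p, z)`. -/
noncomputable def phiTerm (b p z : ℂ) (n : ℕ) : ℂ :=
  (-1) ^ n * p ^ (n * (n - 1) / 2) * z ^ n / (qFactorial b p n * qFactorial p p n)

theorem phi_eq_tsum (b p z : ℂ) : phi₁₁ 0 b p z = ∑' n, phiTerm b p z n := by
  refine tsum_congr fun n => ?_
  rw [qFactorial_zero_left, phiTerm]
  ring

theorem phiTerm_zero (b p z : ℂ) : phiTerm b p z 0 = 1 := by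
  simp [phiTerm, qFactorial]

theorem triangle_succ (n : ℕ) : (n + 1) * (n + 1 - 1) / 2 = n * (n - 1) / 2 + n := by
  rw [← Finset.sum_range_id, ← Finset.sum_range_id, Finset.sum_range_succ]

theorem phiTerm_succ (b p z : ℂ) (n : ℕ) :
    phiTerm b p z (n + 1)
      = phiTerm b p z n * (-(p ^ n * z) / ((1 - b * p ^ n) * (1 - p * p ^ n))) := by
  rw [phiTerm, phiTerm, triangle_succ, qFactorial_succ, qFactorial_succ, div_mul_div_comm]
  congr 1
  · ring
  · ring

theorem phiTerm_mul (b p z c : ℂ) (n : ℕ) : phiTerm b p (c * z) n = c ^ n * phiTerm b p z n := by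
  rw [phiTerm, phiTerm, mul_pow]
  ring

/-- The factor `p ^ (n(n-1)/2)` makes the ratio of consecutive terms tend to 0 for every `z`. No
condition on `b` is needed: once a denominator vanishes, all later terms are 0 by the convention `x
/ 0 = 0`. -/
theorem summable_norm_phiTerm (hp : ‖p‖ < 1) (b z : ℂ) : Summable fun n => ‖phiTerm b p z n‖ := by
  have h0 : Tendsto (fun n : ℕ => p ^ n) atTop (𝓝 0) :=
    tendsto_pow_atTop_nhds_zero_of_norm_lt_one hp
  have h1 : Tendsto (fun n : ℕ => -(p ^ n * z) / ((1 - b * p ^ n) * (1 - p * p ^ n))) atTop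
      (𝓝 (-(0 * z) / ((1 - b * 0) * (1 - p * 0)))) :=
    (h0.mul_const z).neg.div (((h0.const_mul b).const_sub 1).mul ((h0.const_mul p).const_sub 1))
      (by simp)
  have h2 := h1.norm
  simp only [zero_mul, neg_zero, zero_div, norm_zero] at h2
  refine summable_of_ratio_norm_eventually_le (r := 1 / 2) (by norm_num) ?_
  filter_upwards [h2.eventually (ge_mem_nhds (show (0 : ℝ) < 1 / 2 by norm_num))] with n hn
  rw [norm_norm, norm_norm, phiTerm_succ, norm_mul, mul_comm]
  exact mul_le_mul_of_nonneg_right hn (norm_nonneg _)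

theorem summable_phiTerm (hp : ‖p‖ < 1) (b z : ℂ) : Summable (phiTerm b p z) :=
  (summable_norm_phiTerm hp b z).of_norm

/-- Compare coefficients of `z ^ (n+1)`: the factor `1 - p ^ (n+1)` produced by the difference
cancels the last factor of `(p;p)_{n+1}`. -/
theorem phi_sub_phi_mul (hp : ‖p‖ < 1) (hb : ∀ n : ℕ, b * p ^ n ≠ 1)
    (hpn : ∀ n : ℕ, p * p ^ n ≠ 1)
    (z : ℂ) :
    phi₁₁ 0 b p z - phi₁₁ 0 b p (p * z) = -z / (1 - b) * phi₁₁ 0 (b * p) p (p * z) := by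
  have hb0 : 1 - b ≠ 0 := sub_ne_zero.mpr (by simpa using (hb 0).symm)
  rw [phi_eq_tsum, phi_eq_tsum, phi_eq_tsum, (summable_phiTerm hp b z).tsum_eq_zero_add,
    (summable_phiTerm hp b (p * z)).tsum_eq_zero_add, phiTerm_zero, phiTerm_zero,
    add_sub_add_left_eq_sub, ← Summable.tsum_sub, ← tsum_mul_left]
  · refine tsum_congr fun n => ?_
    rw [phiTerm_mul, phiTerm_mul, ← one_sub_mul, phiTerm, phiTerm, triangle_succ,
      qFactorial_succ' b, qFactorial_succ p]
    have h1 : 1 - p * p ^ n ≠ 0 := sub_ne_zero.mpr (hpn n).symm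
    have h2 := qFactorial_ne_zero hpn n
    have h3 : qFactorial (b * p) p n ≠ 0 := qFactorial_ne_zero
      (fun n => by have := hb (n + 1); rwa [pow_succ', ← mul_assoc] at this) n
    rw [pow_succ' p n]
    field_simp
    ring
  · exact (summable_nat_add_iff 1).mpr (summable_phiTerm hp b z)
  · exact (summable_nat_add_iff 1).mpr (summable_phiTerm hp b (p * z))

/-- Termwise this is `(b;p)_{n+1}` factored in two ways: `(1 - b p ^ n)(b;p)_n = (1 - b)(bp;p)_n`.
-/
theorem phi_sub_mul_phi_mul (hp : ‖p‖ < 1) (hb : ∀ n : ℕ, b * p ^ n ≠ 1) (z : ℂ) :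
    phi₁₁ 0 (b * p) p z - b * phi₁₁ 0 (b * p) p (p * z) = (1 - b) * phi₁₁ 0 b p z := by
  rw [phi_eq_tsum, phi_eq_tsum, phi_eq_tsum, ← tsum_mul_left, ← tsum_mul_left,
    ← (summable_phiTerm hp (b * p) z).tsum_sub ((summable_phiTerm hp (b * p) (p * z)).mul_left b)]
  refine tsum_congr fun n => ?_
  have h1 := qFactorial_succ' b p n
  rw [qFactorial_succ] at h1
  have h2 := qFactorial_ne_zero hb n
  have h3 : qFactorial (b * p) p n ≠ 0 := qFactorial_ne_zero
    (fun n => by have := hb (n + 1); rwa [pow_succ', ← mul_assoc] at this) n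
  rw [phiTerm_mul, phiTerm, phiTerm, ← div_div, ← div_div]
  field_simp
  linear_combination p ^ (n * (n - 1) / 2) * z ^ n / qFactorial p p n * h1

/-- Dominated convergence, the series at `z` itself being the bound since `|p ^ (kn)| ≤ 1`. -/
theorem tendsto_phi_pow_mul (hp : ‖p‖ < 1) (b z : ℂ) :
    Tendsto (fun k : ℕ => phi₁₁ 0 b p (p ^ k * z)) atTop (𝓝 1) := by
  have h0 : ∑' n, (if n = 0 then (1 : ℂ) else 0) = 1 := by simp
  rw [← h0]
  simp only [phi_eq_tsum]
  refine tendsto_tsum_of_dominated_convergence (summable_norm_phiTerm hp b z) (fun n => ?_)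
    (Eventually.of_forall fun k n => ?_)
  · rcases eq_or_ne n 0 with rfl | hn
    · simp [phiTerm_zero]
    · simp only [phiTerm_mul, hn, if_false]
      have h1 : Tendsto (fun k : ℕ => p ^ k) atTop (𝓝 0) :=
        tendsto_pow_atTop_nhds_zero_of_norm_lt_one hp
      have := (h1.pow n).mul_const (phiTerm b p z n)
      simpa [hn] using this
  · rw [phiTerm_mul, norm_mul]
    refine mul_le_of_le_one_left (norm_nonneg _) ?_
    rw [norm_pow, norm_pow]
    exact pow_le_one₀ (by positivity) (pow_le_one₀ (norm_nonneg _) hp.le)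

end BasicHypergeometric

/-! ### q-analogues of sine and cosine, and their Pythagorean identity -/

section QTrigonometric

open Filter Topology

variable {q : ℂ}

/-- `₁φ₁(0; q; q², z)`, an analogue of the cosine. -/
noncomputable def qCos (q z : ℂ) : ℂ := phi₁₁ 0 q (q ^ 2) z

/-- `₁φ₁(0; q³; q², z) / (1 - q)`, an analogue of the sine. -/
noncomputable def qSin (q z : ℂ) : ℂ := phi₁₁ 0 (q ^ 3) (q ^ 2) z / (1 - q)

theorem pow_succ_ne_one (hq : ‖q‖ < 1) (n : ℕ) : q ^ (n + 1) ≠ 1 := by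
  intro h
  have := congrArg norm h
  rw [norm_pow, norm_one] at this
  exact (pow_lt_one₀ (norm_nonneg _) hq n.succ_ne_zero).ne this

theorem one_sub_ne_zero (hq : ‖q‖ < 1) : 1 - q ≠ 0 :=
  sub_ne_zero.mpr (by simpa using (pow_succ_ne_one hq 0).symm)

theorem norm_sq_lt_one (hq : ‖q‖ < 1) : ‖q ^ 2‖ < 1 := by
  rw [norm_pow]
  exact pow_lt_one₀ (norm_nonneg _) hq two_ne_zero

theorem qCos_eq (hq : ‖q‖ < 1) (z : ℂ) :
    qCos q z = qCos q (q ^ 2 * z) - z * qSin q (q ^ 2 * z) := by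
  have := phi_sub_phi_mul (norm_sq_lt_one hq) (b := q)
    (fun n => by rw [← pow_mul, ← pow_succ']; exact pow_succ_ne_one hq _)
    (fun n => by rw [← pow_succ', ← pow_mul]; exact pow_succ_ne_one hq (2 * n + 1)) z
  rw [← pow_succ'] at this
  rw [qCos, qCos, qSin]
  linear_combination this

theorem qSin_eq (hq : ‖q‖ < 1) (z : ℂ) : qSin q z = q * qSin q (q ^ 2 * z) + qCos q z := by
  have := phi_sub_mul_phi_mul (norm_sq_lt_one hq) (b := q)
    (fun n => by rw [← pow_mul, ← pow_succ']; exact pow_succ_ne_one hq _) z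
  rw [← pow_succ'] at this
  have h1 := one_sub_ne_zero hq
  rw [qCos, qSin, qSin]
  field_simp
  linear_combination this

/-- The analogue of `cos² + sin² = 1`. -/
theorem qCos_mul_qCos_add (hq : ‖q‖ < 1) (z : ℂ) :
    q ^ 2 * z * qSin q (q ^ 3 * z) * qSin q (q ^ 4 * z) + qCos q (q ^ 2 * z) * qCos q (q ^ 3 * z)
      = 1 := by
  -- The two contiguity relations make this expression invariant under `z ↦ q z`, so its value is
  -- its limit as the argument tends to 0.
  set W : ℂ → ℂ := fun z => q ^ 2 * z * qSin q (q ^ 3 * z) * qSin q (q ^ 4 * z)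
    + qCos q (q ^ 2 * z) * qCos q (q ^ 3 * z) with hW
  have hstep : ∀ z, W (q * z) = W z := by
    intro z
    have h1 := qCos_eq hq (q ^ 2 * z)
    have h2 := qSin_eq hq (q ^ 3 * z)
    simp only [hW]
    ring_nf at h1 h2 ⊢
    rw [h1, h2]
    ring
  have hiter : ∀ (k : ℕ) z, W (q ^ k * z) = W z := by
    intro k
    induction k with
    | zero => simp
    | succ k ih => intro z; rw [pow_succ', mul_assoc, hstep, ih]
  have hq2 := norm_sq_lt_one hq
  have hc : ∀ z, Tendsto (fun k : ℕ => qCos q ((q ^ 2) ^ k * z)) atTop (𝓝 1) :=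
    fun z => tendsto_phi_pow_mul hq2 q z
  have hs : ∀ z, Tendsto (fun k : ℕ => qSin q ((q ^ 2) ^ k * z)) atTop (𝓝 (1 / (1 - q))) :=
    fun z => (tendsto_phi_pow_mul hq2 (q ^ 3) z).div_const _
  -- Only even powers are used because the base of both series is `q ^ 2`.
  have hlim : Tendsto (fun k : ℕ => W (q ^ (2 * k) * z)) atTop (𝓝 1) := by
    have hz : Tendsto (fun k : ℕ => q ^ 2 * ((q ^ 2) ^ k * z)) atTop (𝓝 (q ^ 2 * (0 * z))) :=
      ((tendsto_pow_atTop_nhds_zero_of_norm_lt_one hq2).mul_const z).const_mul _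
    have := ((hz.mul (hs (q ^ 3 * z))).mul (hs (q ^ 4 * z))).add
      ((hc (q ^ 2 * z)).mul (hc (q ^ 3 * z)))
    simp only [zero_mul, mul_zero, zero_add, mul_one] at this
    refine this.congr fun k => ?_
    simp only [hW, pow_mul]
    rw [mul_left_comm (q ^ 3), mul_left_comm (q ^ 4), mul_left_comm (q ^ 2) _ z]
  simp only [hiter] at hlim
  exact tendsto_nhds_unique tendsto_const_nhds hlim

end QTrigonometric

/-! ### The entries of the Toeplitz determinants on the line `α₂ = Q^{1/2}`

Here `y` stands for `Q^{1/2}` and `w` for `α₀`; further `q = y ^ 12`. -/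

section Entries

variable {Q y : ℂ}

/-- The ratio `Θ(q w¹²; q²) / Θ(w¹²; q²)`. -/
noncomputable def thetaRatio (q w : ℂ) : ℂ := theta (q * w ^ 12) (q ^ 2) / theta (w ^ 12) (q ^ 2)

/-- The theta factor of the τ functions at `n = m = 0`. -/
noncomputable def thetaFactor (q y w : ℂ) : ℂ :=
  theta (-(w ^ 6)⁻¹) q * theta (-(y ^ 6)⁻¹) q / theta ((w ^ 6)⁻¹ * (y ^ 6)⁻¹) q

/-- The elliptic gamma factor of the τ functions at `n = m = 0`. -/
noncomputable def gammaFactor (Q y w : ℂ) : ℂ :=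
  ellGamma (Q * w ^ 2 * y) Q Q * ellGamma w⁻¹ Q Q * ellGamma (Q * y * w⁻¹) Q Q

/-- The entry `F` at `n = 0`, `m = -1`, with coefficients `A = a(w)` and `B = a(y w)`. -/
noncomputable def entryFun (q y : ℂ) (a : ℂ → ℂ) (w : ℂ) : ℂ :=
  (a (y * w) * thetaRatio q w * qCos q (q ^ 2 * w ^ 12) - q * a w * qSin q (q ^ 3 * w ^ 12))
    / qInf q (q ^ 2)

/-- The entry multiplied by the theta factor. -/
noncomputable def gaugedEntry (q y : ℂ) (a : ℂ → ℂ) (w : ℂ) : ℂ :=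
  thetaFactor q y w * entryFun q y a w

theorem zpow_injective_of_norm_lt_one (hQ₀ : Q ≠ 0) (hQ₁ : ‖Q‖ < 1) {i j : ℤ} (h : Q ^ i = Q ^ j) :
    i = j := by
  have := congrArg norm h
  rw [norm_zpow, norm_zpow] at this
  exact zpow_right_injective₀ (norm_pos_iff.mpr hQ₀) hQ₁.ne this

theorem norm_pow_lt_one {z : ℂ} (hz : ‖z‖ < 1) {n : ℕ} (hn : n ≠ 0) : ‖z ^ n‖ < 1 := by
  rw [norm_pow]
  exact pow_lt_one₀ (norm_nonneg _) hz hn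

theorem zpow_pow_comm (z : ℂ) (k : ℤ) (n : ℕ) : (z ^ k) ^ n = (z ^ n) ^ k := by
  rw [← zpow_natCast, ← zpow_natCast, ← zpow_mul, ← zpow_mul, mul_comm]

theorem generic_zpow_mul (hQ₀ : Q ≠ 0) (hy : y ^ 2 = Q) (k : ℤ) {w : ℂ} (hw : w ∈ generic Q y) :
    y ^ k * w ∈ generic Q y := by
  have hy0 : y ≠ 0 := by rintro rfl; simp at hy; exact hQ₀ hy.symm
  refine ⟨mul_ne_zero (zpow_ne_zero _ hy0) hw.1, fun j => ⟨fun h => ?_, fun h => ?_⟩⟩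
  · refine (hw.2 (j - k)).1 ?_
    have e : Q ^ (6 * k) = (y ^ 12) ^ k := by
      rw [zpow_mul, ← hy]
      norm_cast
      rw [← pow_mul]
    rw [mul_sub, zpow_sub₀ hQ₀, ← h, e, mul_pow, zpow_pow_comm]
    field_simp
  · refine (hw.2 (j - k)).2 ?_
    rw [zpow_sub₀ hQ₀, ← h, mul_pow, zpow_pow_comm, hy]
    field_simp

theorem generic_mul (hQ₀ : Q ≠ 0) (hy : y ^ 2 = Q) {w : ℂ} (hw : w ∈ generic Q y) :
    y * w ∈ generic Q y := by
  simpa using generic_zpow_mul hQ₀ hy 1 hw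

theorem generic_pow_ne (hy : y ^ 2 = Q) {w : ℂ} (hw : w ∈ generic Q y) (j : ℤ) :
    w ≠ y ^ j := by
  intro h
  refine (hw.2 j).1 ?_
  rw [h, ← hy]
  rw [← zpow_natCast, ← zpow_natCast, ← zpow_mul, ← zpow_mul]
  congr 1
  push_cast
  ring

theorem pow_twelve_generic (hy : y ^ 2 = Q) {w : ℂ} (hw : w ∈ generic Q y) (j : ℤ) :
    w ^ 12 ≠ (y ^ 12) ^ j := by
  intro h
  refine (hw.2 j).1 ?_
  rw [h, ← hy, zpow_mul]
  norm_cast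
  rw [← pow_mul]

theorem norm_lt_one_of_sq (hQ₁ : ‖Q‖ < 1) (hy : y ^ 2 = Q) : ‖y‖ < 1 := by
  rw [← hy, norm_pow] at hQ₁
  by_contra h
  exact absurd hQ₁ (not_lt.mpr (one_le_pow₀ (not_lt.mp h)))

theorem theta_pow_twelve_ne_zero (hQ₀ : Q ≠ 0) (hQ₁ : ‖Q‖ < 1) (hy : y ^ 2 = Q) {w : ℂ}
    (hw : w ∈ generic Q y) : theta (w ^ 12) ((y ^ 12) ^ 2) ≠ 0 := by
  have hy0 : y ≠ 0 := by rintro rfl; simp at hy; exact hQ₀ hy.symm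
  have hy1 := norm_lt_one_of_sq hQ₁ hy
  refine theta_ne_zero (norm_pow_lt_one (norm_pow_lt_one hy1 (by norm_num)) two_ne_zero)
    (by positivity) (pow_ne_zero _ hw.1) fun j h => ?_
  refine pow_twelve_generic hy hw (2 * j) ?_
  rw [h, zpow_mul]
  norm_cast

theorem theta_mul_pow_twelve_ne_zero (hQ₀ : Q ≠ 0) (hQ₁ : ‖Q‖ < 1) (hy : y ^ 2 = Q) {w : ℂ}
    (hw : w ∈ generic Q y) : theta (y ^ 12 * w ^ 12) ((y ^ 12) ^ 2) ≠ 0 := by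
  rw [← mul_pow]
  exact theta_pow_twelve_ne_zero hQ₀ hQ₁ hy (generic_mul hQ₀ hy hw)

theorem theta_neg_inv_pow_six_ne_zero (hQ₀ : Q ≠ 0) (hQ₁ : ‖Q‖ < 1) (hy : y ^ 2 = Q) {w : ℂ}
    (hw : w ∈ generic Q y) : theta (-(w ^ 6)⁻¹) (y ^ 12) ≠ 0 ∧ theta ((w ^ 6)⁻¹) (y ^ 12) ≠ 0 := by
  have hy0 : y ≠ 0 := by rintro rfl; simp at hy; exact hQ₀ hy.symm
  have hy1 := norm_lt_one_of_sq hQ₁ hy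
  have hw0 := hw.1
  -- Squaring handles both signs at once and reduces to the condition on `w ^ 12`.
  have key : ∀ j : ℤ, ((w ^ 6)⁻¹) ^ 2 ≠ ((y ^ 12) ^ j) ^ 2 := by
    intro j h
    refine pow_twelve_generic hy hw (-(2 * j)) ?_
    rw [zpow_neg, mul_comm 2 j, zpow_mul, ← inv_inj, inv_inv]
    norm_cast at h ⊢
    rw [← h, inv_pow, ← pow_mul]
  refine ⟨theta_ne_zero (norm_pow_lt_one hy1 (by norm_num)) (by positivity)
    (by simpa using hw0) fun j h => key j ?_, theta_ne_zero (norm_pow_lt_one hy1 (by norm_num))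
    (by positivity) (by simpa using hw0) fun j h => key j ?_⟩
  · rw [← h, neg_sq]
  · rw [h]

theorem theta_neg_inv_sqrt_ne_zero (hQ₀ : Q ≠ 0) (hQ₁ : ‖Q‖ < 1) (hy : y ^ 2 = Q) :
    theta (-(y ^ 6)⁻¹) (y ^ 12) ≠ 0 := by
  have hy0 : y ≠ 0 := by rintro rfl; simp at hy; exact hQ₀ hy.symm
  have hy1 := norm_lt_one_of_sq hQ₁ hy
  refine theta_ne_zero (norm_pow_lt_one hy1 (by norm_num)) (by positivity) (by simpa using hy0)
    fun j h => ?_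
  -- Squaring removes the sign; the exponents `-12` and `24 j` can never agree.
  have h2 : y ^ (-12 : ℤ) = y ^ (24 * j) := by
    have := congrArg (· ^ 2) h
    simp only [neg_sq, inv_pow] at this
    rw [zpow_neg]
    have e : y ^ (24 * j) = ((y ^ 12) ^ j) ^ 2 := by
      rw [← zpow_natCast, ← zpow_natCast, ← zpow_mul, ← zpow_mul]
      congr 1
      push_cast
      ring
    rw [e, ← this]
    norm_cast
    ring
  have := zpow_injective_of_norm_lt_one hy0 hy1 h2
  lia

theorem thetaRatio_ne_zero (hQ₀ : Q ≠ 0) (hQ₁ : ‖Q‖ < 1) (hy : y ^ 2 = Q) {w : ℂ}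
    (hw : w ∈ generic Q y) : thetaRatio (y ^ 12) w ≠ 0 :=
  div_ne_zero (theta_mul_pow_twelve_ne_zero hQ₀ hQ₁ hy hw) (theta_pow_twelve_ne_zero hQ₀ hQ₁ hy hw)

theorem theta_inv_mul_ne_zero (hQ₀ : Q ≠ 0) (hQ₁ : ‖Q‖ < 1) (hy : y ^ 2 = Q) {w : ℂ}
    (hw : w ∈ generic Q y) : theta ((w ^ 6)⁻¹ * (y ^ 6)⁻¹) (y ^ 12) ≠ 0 ∧
      theta (-((w ^ 6)⁻¹ * (y ^ 6)⁻¹)) (y ^ 12) ≠ 0 := by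
  have := theta_neg_inv_pow_six_ne_zero hQ₀ hQ₁ hy (generic_mul hQ₀ hy hw)
  rw [mul_pow, mul_inv, mul_comm] at this
  exact ⟨this.2, this.1⟩

theorem thetaFactor_ne_zero (hQ₀ : Q ≠ 0) (hQ₁ : ‖Q‖ < 1) (hy : y ^ 2 = Q) {w : ℂ}
    (hw : w ∈ generic Q y) : thetaFactor (y ^ 12) y w ≠ 0 :=
  div_ne_zero (mul_ne_zero (theta_neg_inv_pow_six_ne_zero hQ₀ hQ₁ hy hw).1
    (theta_neg_inv_sqrt_ne_zero hQ₀ hQ₁ hy)) (theta_inv_mul_ne_zero hQ₀ hQ₁ hy hw).1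

theorem gammaFactor_ne_zero (hQ₀ : Q ≠ 0) (hQ₁ : ‖Q‖ < 1) (hy : y ^ 2 = Q) {w : ℂ}
    (hw : w ∈ generic Q y) : gammaFactor Q y w ≠ 0 := by
  have hy0 : y ≠ 0 := by rintro rfl; simp at hy; exact hQ₀ hy.symm
  have hw0 := hw.1
  refine mul_ne_zero (mul_ne_zero ?_ ?_) ?_
  · refine ellGamma_ne_zero hQ₁ hQ₀ (by positivity) fun j h => (hw.2 (j - 1)).2 ?_
    rw [zpow_sub_one₀ hQ₀, ← h]
    field_simp
  · refine ellGamma_ne_zero hQ₁ hQ₀ (by positivity) fun j h =>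
      generic_pow_ne hy hw (-(2 * j)) ?_
    rw [zpow_neg, zpow_mul, ← inv_inj, inv_inv, h, ← hy]
    norm_cast
  · refine ellGamma_ne_zero hQ₁ hQ₀ (by positivity) fun j h =>
      generic_pow_ne hy hw (3 - 2 * j) ?_
    rw [zpow_sub₀ hy0, zpow_mul, eq_div_iff (by positivity)]
    have h2 : (y ^ (2 : ℤ)) ^ j = Q ^ j := by rw [← hy]; norm_cast
    rw [h2, ← h, ← hy]
    field_simp

/-- `R₁` acts on the theta ratio by an inversion. -/
theorem thetaRatio_mul (hQ₀ : Q ≠ 0) (hQ₁ : ‖Q‖ < 1) (hy : y ^ 2 = Q) {w : ℂ}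
    (hw : w ∈ generic Q y) :
    thetaRatio (y ^ 12) (y * w) = -(w ^ 12 * thetaRatio (y ^ 12) w)⁻¹ := by
  have hy0 : y ≠ 0 := by rintro rfl; simp at hy; exact hQ₀ hy.symm
  have hy1 := norm_lt_one_of_sq hQ₁ hy
  have hw0 := hw.1
  have h1 := theta_pow_twelve_ne_zero hQ₀ hQ₁ hy hw
  have h2 := theta_mul_pow_twelve_ne_zero hQ₀ hQ₁ hy hw
  rw [thetaRatio, thetaRatio, mul_pow, ← mul_assoc, ← sq,
    theta_mul_self (norm_pow_lt_one (norm_pow_lt_one hy1 (by norm_num)) two_ne_zero)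
      (by positivity) (pow_ne_zero 12 hw0)]
  field_simp

theorem thetaRatio_mul_mul (hQ₀ : Q ≠ 0) (hQ₁ : ‖Q‖ < 1) (hy : y ^ 2 = Q) {w : ℂ}
    (hw : w ∈ generic Q y) :
    thetaRatio (y ^ 12) (y * (y * w)) = (y ^ 12)⁻¹ * thetaRatio (y ^ 12) w := by
  have hy0 : y ≠ 0 := by rintro rfl; simp at hy; exact hQ₀ hy.symm
  have hw0 := hw.1
  have h1 := thetaRatio_ne_zero hQ₀ hQ₁ hy hw
  rw [thetaRatio_mul hQ₀ hQ₁ hy (generic_mul hQ₀ hy hw), thetaRatio_mul hQ₀ hQ₁ hy hw]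
  field_simp

/-- The theta factor at `n = m = 1`, compared with the one at `n = m = 0`. -/
theorem thetaFactor_odd (hQ₀ : Q ≠ 0) (hQ₁ : ‖Q‖ < 1) (hy : y ^ 2 = Q) {w : ℂ}
    (hw : w ∈ generic Q y) :
    theta (-((w ^ 6)⁻¹ * (y ^ 6)⁻¹)) (y ^ 12) * theta (-(y ^ 12 * (y ^ 6)⁻¹)) (y ^ 12)
        / theta ((w ^ 6)⁻¹) (y ^ 12)
      = (y ^ 6)⁻¹ * (thetaRatio (y ^ 12) w * thetaFactor (y ^ 12) y w) := by
  have hy0 : y ≠ 0 := by rintro rfl; simp at hy; exact hQ₀ hy.symm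
  have hy1 := norm_pow_lt_one (norm_lt_one_of_sq hQ₁ hy) (show 12 ≠ 0 by norm_num)
  have hw0 := hw.1
  have h1 := theta_pow_twelve_ne_zero hQ₀ hQ₁ hy hw
  have h3 := theta_inv_mul_ne_zero hQ₀ hQ₁ hy hw
  have h4 := theta_neg_inv_pow_six_ne_zero hQ₀ hQ₁ hy hw
  have e1 := theta_mul_self hy1 (by positivity) (w := -(y ^ 6)⁻¹) (by simpa using hy0)
  -- The ratio has base `q ^ 2` and the theta factor has base `q`; `Θ(w;q) Θ(-w;q) = Θ(w²;q²)`
  -- connects them.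
  have e2 := theta_mul_theta_neg hy1 ((w ^ 6)⁻¹ * (y ^ 6)⁻¹)
  have e3 := theta_mul_theta_neg hy1 ((w ^ 6)⁻¹)
  have hy2 := norm_pow_lt_one hy1 two_ne_zero
  have e4 : theta (((w ^ 6)⁻¹) ^ 2) ((y ^ 12) ^ 2)
      = -(w ^ 12)⁻¹ * theta (w ^ 12) ((y ^ 12) ^ 2) := by
    rw [← theta_mul_self hy2 (by positivity) (by positivity), ← theta_div (by positivity)]
    congr 1
    field_simp
  have e5 : theta (((w ^ 6)⁻¹ * (y ^ 6)⁻¹) ^ 2) ((y ^ 12) ^ 2)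
      = -(y ^ 12 * w ^ 12)⁻¹ * theta (y ^ 12 * w ^ 12) ((y ^ 12) ^ 2) := by
    rw [← theta_mul_self hy2 (by positivity) (by positivity), ← theta_div (by positivity)]
    congr 1
    field_simp
  rw [e4] at e3
  rw [e5] at e2
  rw [mul_neg] at e1
  have e6 : theta (y ^ 12 * w ^ 12) ((y ^ 12) ^ 2) = -(y ^ 12 * w ^ 12)
      * (theta ((w ^ 6)⁻¹ * (y ^ 6)⁻¹) (y ^ 12) * theta (-((w ^ 6)⁻¹ * (y ^ 6)⁻¹)) (y ^ 12)) := by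
    rw [e2]
    field_simp
  have e7 : theta (w ^ 12) ((y ^ 12) ^ 2) = -(w ^ 12)
      * (theta ((w ^ 6)⁻¹) (y ^ 12) * theta (-(w ^ 6)⁻¹) (y ^ 12)) := by
    rw [e3]
    field_simp
  rw [thetaRatio, thetaFactor, e1, e6, e7]
  have h5 := h3.1
  have h6 := h4.1
  have h7 := h4.2
  generalize theta ((w ^ 6)⁻¹ * (y ^ 6)⁻¹) (y ^ 12) = t₁ at h5 ⊢
  generalize theta (-(w ^ 6)⁻¹) (y ^ 12) = t₂ at h6 ⊢
  generalize theta ((w ^ 6)⁻¹) (y ^ 12) = t₃ at h7 ⊢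
  field_simp

/-- Quasi-periodicity relates the theta quotient at `y w` to the quotient of `thetaFactor_odd` by a
monomial. -/
theorem thetaFactor_mul (hQ₀ : Q ≠ 0) (hQ₁ : ‖Q‖ < 1) (hy : y ^ 2 = Q) {w : ℂ}
    (hw : w ∈ generic Q y) :
    thetaFactor (y ^ 12) y (y * w)
      = -w ^ 6 * thetaRatio (y ^ 12) w * thetaFactor (y ^ 12) y w := by
  have hy0 : y ≠ 0 := by rintro rfl; simp at hy; exact hQ₀ hy.symm
  have hy1 := norm_pow_lt_one (norm_lt_one_of_sq hQ₁ hy) (show 12 ≠ 0 by norm_num)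
  have hw0 := hw.1
  have h := thetaFactor_odd hQ₀ hQ₁ hy hw
  have h4 := (theta_neg_inv_pow_six_ne_zero hQ₀ hQ₁ hy hw).2
  have e1 := theta_mul_self hy1 (by positivity) (w := -(y ^ 6)⁻¹) (by simpa using hy0)
  have e2 := theta_mul_self hy1 (by positivity) (w := ((y * w) ^ 6)⁻¹ * (y ^ 6)⁻¹) (by positivity)
  rw [show y ^ 12 * (((y * w) ^ 6)⁻¹ * (y ^ 6)⁻¹) = (w ^ 6)⁻¹ by field_simp] at e2
  rw [mul_neg] at e1
  rw [e1] at h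
  rw [e2] at h h4
  have h5 := right_ne_zero_of_mul h4
  have e3 : thetaRatio (y ^ 12) w * thetaFactor (y ^ 12) y w
     = y ^ 6 * ((y ^ 6)⁻¹ * (thetaRatio (y ^ 12) w * thetaFactor (y ^ 12) y w)) := by
    field_simp
  rw [mul_assoc, e3, ← h, thetaFactor, show ((y * w) ^ 6)⁻¹ = (w ^ 6)⁻¹ * (y ^ 6)⁻¹ by
    rw [mul_pow, mul_inv, mul_comm]] at *
  field_simp

theorem thetaFactor_mul_mul (hQ₀ : Q ≠ 0) (hQ₁ : ‖Q‖ < 1) (hy : y ^ 2 = Q) {w : ℂ}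
    (hw : w ∈ generic Q y) :
    thetaFactor (y ^ 12) y (y * (y * w)) = -y ^ 6 * thetaFactor (y ^ 12) y w := by
  have hy0 : y ≠ 0 := by rintro rfl; simp at hy; exact hQ₀ hy.symm
  have hw0 := hw.1
  have h1 := thetaRatio_ne_zero hQ₀ hQ₁ hy hw
  rw [thetaFactor_mul hQ₀ hQ₁ hy (generic_mul hQ₀ hy hw), thetaFactor_mul hQ₀ hQ₁ hy hw,
    thetaRatio_mul hQ₀ hQ₁ hy hw]
  field_simp

/-- The bilinear relation of the elliptic gamma factors. -/
theorem gammaFactor_bilinear (hQ₀ : Q ≠ 0) (hQ₁ : ‖Q‖ < 1) (hy : y ^ 2 = Q) {w : ℂ}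
    (hw : w ∈ generic Q y) :
    gammaFactor Q y (y ^ (0 : ℤ) * w) * gammaFactor Q y (y ^ (3 : ℤ) * w)
      = -(y ^ 6 * w ^ 3)⁻¹
        * (gammaFactor Q y (y ^ (1 : ℤ) * w) * gammaFactor Q y (y ^ (2 : ℤ) * w)) := by
  have hy0 : y ≠ 0 := by rintro rfl; simp at hy; exact hQ₀ hy.symm
  have hw0 := hw.1
  have hQy : ∀ (z : ℂ) (k : ℤ), Q * (y ^ k * z) = y ^ (k + 2) * z := by
    intro z k
    rw [zpow_add₀ hy0, ← hy]
    norm_cast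
    ring
  have hA : ∀ k : ℤ, ellGamma (y ^ (2 * k + 1 + 2) * w ^ 2) Q Q
      = theta (y ^ (2 * k + 1) * w ^ 2) Q * ellGamma (y ^ (2 * k + 1) * w ^ 2) Q Q := by
    intro k
    rw [← hQy]
    refine ellGamma_mul_self hQ₁ hQ₀ (by positivity) fun j h => (hw.2 (j - k)).2 ?_
    have e : y ^ (2 * k) = Q ^ k := by
      rw [zpow_mul, ← hy]
      norm_cast
    rw [zpow_sub₀ hQ₀, ← h, zpow_add_one₀ hy0, e]
    field_simp
  have hU : ∀ k : ℤ, ellGamma (y ^ (k + 2) * w⁻¹) Q Q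
      = theta (y ^ k * w⁻¹) Q * ellGamma (y ^ k * w⁻¹) Q Q := by
    intro k
    rw [← hQy]
    refine ellGamma_mul_self hQ₁ hQ₀ (by positivity) fun j h => generic_pow_ne hy hw (k - 2 * j) ?_
    have e : y ^ (2 * j) = Q ^ j := by
      rw [zpow_mul, ← hy]
      norm_cast
    rw [zpow_sub₀ hy0, e, ← h]
    field_simp
  have hT : ∀ (z : ℂ) (k : ℤ), z ≠ 0 →
      theta (y ^ (k + 2) * z) Q = -(y ^ k * z)⁻¹ * theta (y ^ k * z) Q := by
    intro z k hz
    rw [← hQy]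
    exact theta_mul_self hQ₁ hQ₀ (by positivity)
  have hg : ∀ k : ℤ, gammaFactor Q y (y ^ k * w) = ellGamma (y ^ (2 * k + 1 + 2) * w ^ 2) Q Q
      * ellGamma (y ^ (-k) * w⁻¹) Q Q * ellGamma (y ^ (-k + 1 + 2) * w⁻¹) Q Q := by
    intro k
    have e1 : Q * (y ^ k * w) ^ 2 * y = y ^ (2 * k + 1 + 2) * w ^ 2 := by
      rw [← hQy, zpow_add_one₀ hy0, mul_pow, zpow_pow_comm, zpow_mul]
      norm_cast
      ring
    have e2 : (y ^ k * w)⁻¹ = y ^ (-k) * w⁻¹ := by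
      rw [mul_inv, zpow_neg]
    have e3 : Q * y * (y ^ k * w)⁻¹ = y ^ (-k + 1 + 2) * w⁻¹ := by
      rw [e2, ← hQy, zpow_add_one₀ hy0]
      ring
    rw [gammaFactor, e1, e3, e2]
  have hw2 : w ^ 2 ≠ 0 := pow_ne_zero 2 hw0
  have hw1 : w⁻¹ ≠ 0 := inv_ne_zero hw0
  replace hT := fun (z : ℂ) (hz : z ≠ 0) (k : ℤ) => hT z k hz
  replace hT := And.intro (hT (w ^ 2) hw2) (hT w⁻¹ hw1)
  have hpow : ∀ k : ℤ, y ^ k ≠ 0 := fun k => zpow_ne_zero k hy0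
  rw [hg, hg, hg, hg]
  -- Since `Q = y ^ 2`, only the shift of the exponent `k` by 2 matters. All gamma values are
  -- reduced to those of least exponent in their parity class, then all theta values likewise; the
  -- two sides then differ by a monomial only.
  generalize hfA : (fun k : ℤ => ellGamma (y ^ k * w ^ 2) Q Q) = fA
  generalize hfU : (fun k : ℤ => ellGamma (y ^ k * w⁻¹) Q Q) = fU
  generalize htA : (fun k : ℤ => theta (y ^ k * w ^ 2) Q) = tA
  generalize htU : (fun k : ℤ => theta (y ^ k * w⁻¹) Q) = tU
  simp only [fun k => congrFun hfA k, fun k => congrFun hfU k, fun k => congrFun htA k,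
    fun k => congrFun htU k] at hA hU hT ⊢
  have A1 : fA 5 = tA 3 * fA 3 := hA 1
  have A2 : fA 7 = tA 5 * fA 5 := hA 2
  have A3 : fA 9 = tA 7 * fA 7 := hA 3
  have U0 : fU 0 = tU (-2) * fU (-2) := by
    have := hU (-2)
    rwa [show (-2 : ℤ) + 2 = 0 by norm_num] at this
  have U2 : fU 2 = tU 0 * fU 0 := hU 0
  have Um : fU (-1) = tU (-3) * fU (-3) := by
    have := hU (-3)
    rwa [show (-3 : ℤ) + 2 = -1 by norm_num] at this
  have U1 : fU 1 = tU (-1) * fU (-1) := by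
    have := hU (-1)
    rwa [show (-1 : ℤ) + 2 = 1 by norm_num] at this
  have U3 : fU 3 = tU 1 * fU 1 := hU 1
  have T5 : tA 5 = -(y ^ (3 : ℤ) * w ^ 2)⁻¹ * tA 3 := hT.1 3
  have T7 : tA 7 = -(y ^ (5 : ℤ) * w ^ 2)⁻¹ * tA 5 := hT.1 5
  have T0 : tU 0 = -(y ^ (-2 : ℤ) * w⁻¹)⁻¹ * tU (-2) := by
    have := hT.2 (-2)
    rwa [show (-2 : ℤ) + 2 = 0 by norm_num] at this
  have Tm : tU (-1) = -(y ^ (-3 : ℤ) * w⁻¹)⁻¹ * tU (-3) := by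
    have := hT.2 (-3)
    rwa [show (-3 : ℤ) + 2 = -1 by norm_num] at this
  have T1 : tU 1 = -(y ^ (-1 : ℤ) * w⁻¹)⁻¹ * tU (-1) := by
    have := hT.2 (-1)
    rwa [show (-1 : ℤ) + 2 = 1 by norm_num] at this
  change fA 3 * fU 0 * fU 3 * (fA 9 * fU (-3) * fU 0)
    = -(y ^ 6 * w ^ 3)⁻¹ * (fA 5 * fU (-1) * fU 2 * (fA 7 * fU (-2) * fU 1))
  rw [U3, U2, U1, Um, U0, A3, A2, A1, T1, Tm, T0, T7, T5]
  field_simp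

end Entries

/-! ### The τ functions on the line `α₂ = Q^{1/2}` and their bilinear relations -/

section TauLine

variable {Q y : ℂ}

/-- Because `a (y (y w)) = a w`, the step `w ↦ y w` exchanges the coefficients `a w` and `a (y w)`,
while the theta ratio is inverted. The part with `a (y w)` is then the contiguity relation of
`qCos`, and the part with `a w` that of `qSin`. -/
theorem entryFun_recurrence (hQ₀ : Q ≠ 0) (hQ₁ : ‖Q‖ < 1) (hy : y ^ 2 = Q) {a : ℂ → ℂ}
    (ha : ∀ x, x ≠ 0 → a (Q * x) = a x) {w : ℂ} (hw : w ∈ generic Q y) :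
    entryFun (y ^ 12) y a w = y ^ 12 * entryFun (y ^ 12) y a (y * (y * w))
      + y ^ 12 * w ^ 12 * thetaRatio (y ^ 12) w * entryFun (y ^ 12) y a (y * w) := by
  have hy0 : y ≠ 0 := by rintro rfl; simp at hy; exact hQ₀ hy.symm
  have hy1 := norm_pow_lt_one (norm_lt_one_of_sq hQ₁ hy) (show 12 ≠ 0 by norm_num)
  have hw0 := hw.1
  have hr := thetaRatio_ne_zero hQ₀ hQ₁ hy hw
  have hyy : ∀ x, x ≠ 0 → a (y * (y * x)) = a x := fun x hx => by
    rw [← mul_assoc, ← sq, hy, ha x hx]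
  have hc := qCos_eq hy1 ((y ^ 12) ^ 2 * w ^ 12)
  have hs := qSin_eq hy1 ((y ^ 12) ^ 3 * w ^ 12)
  have e1 : (y ^ 12) ^ 2 * (y * (y * w)) ^ 12 = (y ^ 12) ^ 2 * ((y ^ 12) ^ 2 * w ^ 12) := by ring
  have e2 : (y ^ 12) ^ 3 * (y * (y * w)) ^ 12 = (y ^ 12) ^ 2 * ((y ^ 12) ^ 3 * w ^ 12) := by ring
  have e3 : (y ^ 12) ^ 2 * (y * w) ^ 12 = (y ^ 12) ^ 3 * w ^ 12 := by ring
  have e4 : (y ^ 12) ^ 3 * (y * w) ^ 12 = (y ^ 12) ^ 2 * ((y ^ 12) ^ 2 * w ^ 12) := by ring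
  rw [entryFun, entryFun, entryFun, hyy _ (mul_ne_zero hy0 hw0), hyy w hw0,
    thetaRatio_mul_mul hQ₀ hQ₁ hy hw, thetaRatio_mul hQ₀ hQ₁ hy hw, e1, e2, e3, e4, hc, hs]
  generalize qInf (y ^ 12) ((y ^ 12) ^ 2) = I
  field_simp
  ring

/-- The step of the theta factor contains `thetaRatio` exactly once, which absorbs the only
transcendental coefficient of the recurrence. -/
theorem gaugedEntry_recurrence (hQ₀ : Q ≠ 0) (hQ₁ : ‖Q‖ < 1) (hy : y ^ 2 = Q) {a : ℂ → ℂ}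
    (ha : ∀ x, x ≠ 0 → a (Q * x) = a x) {w : ℂ} (hw : w ∈ generic Q y) :
    gaugedEntry (y ^ 12) y a w = -y ^ 6 * gaugedEntry (y ^ 12) y a (y * (y * w))
      + -(y ^ 12 * w ^ 6) * gaugedEntry (y ^ 12) y a (y * w) := by
  rw [gaugedEntry, gaugedEntry, gaugedEntry, entryFun_recurrence hQ₀ hQ₁ hy ha hw,
    thetaFactor_mul_mul hQ₀ hQ₁ hy hw, thetaFactor_mul hQ₀ hQ₁ hy hw]
  ring

/-- The sequence of gauged entries along the orbit of `w`. -/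
noncomputable def gaugedSeq (y : ℂ) (a : ℂ → ℂ) (w : ℂ) (k : ℤ) : ℂ :=
  gaugedEntry (y ^ 12) y a (y ^ k * w)

theorem gaugedSeq_recurrence (hQ₀ : Q ≠ 0) (hQ₁ : ‖Q‖ < 1) (hy : y ^ 2 = Q) {a : ℂ → ℂ}
    (ha : ∀ x, x ≠ 0 → a (Q * x) = a x) {w : ℂ} (hw : w ∈ generic Q y) (k : ℤ) :
    gaugedSeq y a w k = -y ^ 6 * gaugedSeq y a w (k + 2)
      + -(y ^ 12 * (y ^ k * w) ^ 6) * gaugedSeq y a w (k + 1) := by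
  have hy0 : y ≠ 0 := by rintro rfl; simp at hy; exact hQ₀ hy.symm
  have := gaugedEntry_recurrence hQ₀ hQ₁ hy ha (generic_zpow_mul hQ₀ hy k hw)
  rw [gaugedSeq, this, gaugedSeq, gaugedSeq, ← mul_assoc, ← mul_assoc, ← mul_assoc,
    mul_assoc y, ← zpow_one_add₀ hy0, ← zpow_one_add₀ hy0, add_comm 1, add_comm 1, add_assoc]
  norm_num

/-- The τ function `τ_N^0` of q-P_II at `α₀ = w`. -/
noncomputable def tauLine (Q y : ℂ) (a : ℂ → ℂ) (N : ℤ) (w : ℂ) : ℂ :=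
  (-1) ^ (N * (N + 1) / 2) * w ^ (-4 * N ^ 2 + 6 * N) * y ^ (-2 * N ^ 2) * gammaFactor Q y w
    * toeplitzInt (gaugedSeq y a w) N 0

theorem toeplitzInt_shift (h : ℤ → ℂ) (N j : ℤ) :
    toeplitzInt (fun k => h (k + j)) N 0 = toeplitzInt h N j := by
  unfold toeplitzInt toeplitz
  simp only [zero_add, show ∀ u v : ℤ, 2 * u - 2 * v + j = j + 2 * u - 2 * v by intros; ring]

theorem toeplitzInt_gaugedSeq (hy0 : y ≠ 0) (a : ℂ → ℂ) (w : ℂ) (N j : ℤ) :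
    toeplitzInt (gaugedSeq y a (y ^ j * w)) N 0 = toeplitzInt (gaugedSeq y a w) N j := by
  have h : gaugedSeq y a (y ^ j * w) = fun k => gaugedSeq y a w (k + j) := by
    funext k
    rw [gaugedSeq, gaugedSeq, zpow_add₀ hy0, mul_assoc]
  rw [h, toeplitzInt_shift]

/-- The part of the τ function that depends on `N` and not on the position in the orbit. -/
noncomputable def tauScale (y w : ℂ) (N : ℤ) : ℂ :=
  (-1) ^ (N * (N + 1) / 2) * w ^ (-4 * N ^ 2 + 6 * N) * y ^ (-2 * N ^ 2)

/-- Separates what depends on the orbit position `j`. In a bilinear relation whose positions have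
equal sums (`0 + 3 = 1 + 2`) the remaining work is the gamma factors, the determinants and powers of
`y`. -/
theorem tauLine_orbit (hy0 : y ≠ 0) (a : ℂ → ℂ) (w : ℂ) (N j : ℤ) :
    tauLine Q y a N (y ^ j * w) = tauScale y w N * (y ^ (-4 * N ^ 2 + 6 * N)) ^ j
      * gammaFactor Q y (y ^ j * w) * toeplitzInt (gaugedSeq y a w) N j := by
  rw [tauLine, toeplitzInt_gaugedSeq hy0, tauScale, mul_zpow, ← zpow_mul, ← zpow_mul, mul_comm j]
  ring

theorem zpow_exponent_succ (hy0 : y ≠ 0) (N : ℤ) :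
    y ^ (-4 * (N + 1) ^ 2 + 6 * (N + 1)) = y ^ (-4 * N ^ 2 + 6 * N) * y ^ 2 / (y ^ N) ^ 8 := by
  rw [show -4 * (N + 1) ^ 2 + 6 * (N + 1) = -4 * N ^ 2 + 6 * N + 2 - N * 8 by ring,
    zpow_sub₀ hy0, zpow_add₀ hy0, zpow_mul]
  norm_cast

theorem zpow_exponent_pred (hy0 : y ≠ 0) (N : ℤ) :
    y ^ (-4 * (N - 1) ^ 2 + 6 * (N - 1)) = y ^ (-4 * N ^ 2 + 6 * N) * (y ^ N) ^ 8 / y ^ 10 := by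
  rw [show -4 * (N - 1) ^ 2 + 6 * (N - 1) = -4 * N ^ 2 + 6 * N + N * 8 - 10 by ring,
    zpow_sub₀ hy0, zpow_add₀ hy0, zpow_mul]
  norm_cast

theorem tauScale_mul (hy0 : y ≠ 0) {w : ℂ} (hw0 : w ≠ 0) (N : ℤ) :
    tauScale y w (N + 1) * tauScale y w (N - 1)
      = -(w ^ 8 * y ^ 4)⁻¹ * (tauScale y w N * tauScale y w N) := by
  -- The triangular numbers have second difference 1, hence the minus sign.
  have hsign : ((-1 : ℂ) ^ ((N + 1) * (N + 1 + 1) / 2)) * (-1) ^ ((N - 1) * (N - 1 + 1) / 2)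
      = -((-1) ^ (N * (N + 1) / 2) * (-1) ^ (N * (N + 1) / 2)) := by
    have h1 : (N + 1) * (N + 1 + 1) / 2 = N * (N + 1) / 2 + (N + 1) := by
      rw [show (N + 1) * (N + 1 + 1) = N * (N + 1) + (N + 1) * 2 by ring,
        Int.add_mul_ediv_right _ _ two_ne_zero]
    have h2 : N * (N + 1) / 2 = (N - 1) * (N - 1 + 1) / 2 + N := by
      rw [show N * (N + 1) = (N - 1) * (N - 1 + 1) + N * 2 by ring,
        Int.add_mul_ediv_right _ _ two_ne_zero]
    have hn : (-1 : ℂ) ≠ 0 := by norm_num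
    rw [h1, zpow_add₀ hn, zpow_add₀ hn, h2, zpow_add₀ hn, zpow_one]
    ring
  have hw8 : w ^ (-4 * (N + 1) ^ 2 + 6 * (N + 1)) * w ^ (-4 * (N - 1) ^ 2 + 6 * (N - 1))
      = (w ^ 8)⁻¹ * (w ^ (-4 * N ^ 2 + 6 * N) * w ^ (-4 * N ^ 2 + 6 * N)) := by
    rw [zpow_exponent_succ hw0, zpow_exponent_pred hw0]
    have := zpow_ne_zero N hw0
    field_simp
  have hy4 : y ^ (-2 * (N + 1) ^ 2) * y ^ (-2 * (N - 1) ^ 2)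
      = (y ^ 4)⁻¹ * (y ^ (-2 * N ^ 2) * y ^ (-2 * N ^ 2)) := by
    rw [← zpow_add₀ hy0, ← zpow_add₀ hy0, show -2 * (N + 1) ^ 2 + -2 * (N - 1) ^ 2
      = -2 * N ^ 2 + -2 * N ^ 2 - 4 by ring, zpow_sub₀ hy0]
    norm_cast
    rw [div_eq_mul_inv, mul_comm]
  rw [tauScale, tauScale, tauScale, mul_inv]
  linear_combination (w ^ (-4 * (N + 1) ^ 2 + 6 * (N + 1)) * w ^ (-4 * (N - 1) ^ 2 + 6 * (N - 1)))
      * (y ^ (-2 * (N + 1) ^ 2) * y ^ (-2 * (N - 1) ^ 2)) * hsign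
    - ((-1) ^ (N * (N + 1) / 2) * (-1) ^ (N * (N + 1) / 2))
      * (y ^ (-2 * (N + 1) ^ 2) * y ^ (-2 * (N - 1) ^ 2)) * hw8
    - ((-1) ^ (N * (N + 1) / 2) * (-1) ^ (N * (N + 1) / 2))
      * ((w ^ 8)⁻¹ * (w ^ (-4 * N ^ 2 + 6 * N) * w ^ (-4 * N ^ 2 + 6 * N))) * hy4

theorem tauLine_relation_last (hQ₀ : Q ≠ 0) (hQ₁ : ‖Q‖ < 1) (hy : y ^ 2 = Q)
    {a : ℂ → ℂ} (ha : ∀ x, x ≠ 0 → a (Q * x) = a x) {w : ℂ} (hw : w ∈ generic Q y) (N : ℤ) :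
    tauLine Q y a (N + 1) (y ^ (0 : ℤ) * w) * tauLine Q y a N (y ^ (3 : ℤ) * w)
      = y ^ 4 * w ^ 3 / (y ^ N) ^ 4
          * (tauLine Q y a (N + 1) (y ^ (1 : ℤ) * w) * tauLine Q y a N (y ^ (2 : ℤ) * w))
        + (y ^ N) ^ 4 / (y ^ 4 * w ^ 3)
          * (tauLine Q y a N (y ^ (1 : ℤ) * w) * tauLine Q y a (N + 1) (y ^ (2 : ℤ) * w)) := by
  have hy0 : y ≠ 0 := by rintro rfl; simp at hy; exact hQ₀ hy.symm
  have hw0 := hw.1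
  have hg := gammaFactor_bilinear hQ₀ hQ₁ hy hw
  -- Here `δ = y ^ 12`, and the relation taken at position 1 involves exactly the positions 0 to 3.
  have hD := toeplitzInt_relation_last (gaugedSeq_recurrence hQ₀ hQ₁ hy ha hw) (δ := y ^ 12)
    (fun k => by rw [zpow_add₀ hy0]; norm_cast; ring) (by simpa using hy0) (by positivity) N 1
  rw [← zpow_pow_comm, show (1 : ℤ) - 1 = 0 by norm_num, show (1 : ℤ) + 1 = 2 by norm_num,
    show (1 : ℤ) + 2 = 3 by norm_num, zpow_zero, one_mul] at hD
  have hL := zpow_ne_zero N hy0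
  have hE := zpow_ne_zero (-4 * N ^ 2 + 6 * N) hy0
  simp only [tauLine_orbit hy0, zpow_exponent_succ hy0]
  generalize y ^ (-4 * N ^ 2 + 6 * N) = E at *
  generalize y ^ N = L at *
  generalize toeplitzInt (gaugedSeq y a w) N 1 = d₁ at *
  generalize toeplitzInt (gaugedSeq y a w) N 2 = d₂ at *
  generalize toeplitzInt (gaugedSeq y a w) N 3 = d₃ at *
  generalize toeplitzInt (gaugedSeq y a w) (N + 1) 0 = u₀ at *
  generalize toeplitzInt (gaugedSeq y a w) (N + 1) 1 = u₁ at *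
  generalize toeplitzInt (gaugedSeq y a w) (N + 1) 2 = u₂ at *
  generalize gammaFactor Q y (y ^ (0 : ℤ) * w) = g₀ at *
  generalize gammaFactor Q y (y ^ (1 : ℤ) * w) = g₁ at *
  generalize gammaFactor Q y (y ^ (2 : ℤ) * w) = g₂ at *
  generalize gammaFactor Q y (y ^ (3 : ℤ) * w) = g₃ at *
  simp only [zpow_ofNat]
  have hD' : u₀ * d₃ = (-(y ^ 12 * w ^ 6) * (u₁ * d₂) - y ^ 6 * (d₁ * u₂)) / L ^ 12 := by
    rw [eq_div_iff (by positivity)]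
    linear_combination 1 * hD
  calc _ = tauScale y w (N + 1) * tauScale y w N * ((E * y ^ 2 / L ^ 8) ^ 0 * E ^ 3) * (g₀ * g₃) * (u₀ * d₃) := by
        ring
    _ = _ := by
      rw [hg, hD']
      field_simp
      ring

theorem tauLine_relation_first (hQ₀ : Q ≠ 0) (hQ₁ : ‖Q‖ < 1) (hy : y ^ 2 = Q)
    {a : ℂ → ℂ} (ha : ∀ x, x ≠ 0 → a (Q * x) = a x) {w : ℂ} (hw : w ∈ generic Q y) (N : ℤ) :
    tauLine Q y a N (y ^ (0 : ℤ) * w) * tauLine Q y a (N + 1) (y ^ (3 : ℤ) * w)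
      = y ^ 8 * w ^ 3 * (y ^ N) ^ 4
          * (tauLine Q y a N (y ^ (1 : ℤ) * w) * tauLine Q y a (N + 1) (y ^ (2 : ℤ) * w))
        + 1 / (y ^ 8 * w ^ 3 * (y ^ N) ^ 4)
          * (tauLine Q y a (N + 1) (y ^ (1 : ℤ) * w) * tauLine Q y a N (y ^ (2 : ℤ) * w)) := by
  have hy0 : y ≠ 0 := by rintro rfl; simp at hy; exact hQ₀ hy.symm
  have hw0 := hw.1
  have hg := gammaFactor_bilinear hQ₀ hQ₁ hy hw
  have hD := toeplitzInt_relation_first (gaugedSeq_recurrence hQ₀ hQ₁ hy ha hw) (δ := y ^ 12)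
    (fun k => by rw [zpow_add₀ hy0]; norm_cast; ring) (by simpa using hy0) (by positivity) N 2
  rw [← zpow_pow_comm, show (2 : ℤ) - 1 = 1 by norm_num, show (2 : ℤ) - 2 = 0 by norm_num,
    show (2 : ℤ) + 1 = 3 by norm_num, zpow_one] at hD
  have hL := zpow_ne_zero N hy0
  have hE := zpow_ne_zero (-4 * N ^ 2 + 6 * N) hy0
  simp only [tauLine_orbit hy0, zpow_exponent_succ hy0]
  generalize y ^ (-4 * N ^ 2 + 6 * N) = E at *
  generalize y ^ N = L at *
  generalize toeplitzInt (gaugedSeq y a w) N 0 = d₀ at *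
  generalize toeplitzInt (gaugedSeq y a w) N 1 = d₁ at *
  generalize toeplitzInt (gaugedSeq y a w) N 2 = d₂ at *
  generalize toeplitzInt (gaugedSeq y a w) (N + 1) 1 = u₁ at *
  generalize toeplitzInt (gaugedSeq y a w) (N + 1) 2 = u₂ at *
  generalize toeplitzInt (gaugedSeq y a w) (N + 1) 3 = u₃ at *
  generalize gammaFactor Q y (y ^ (0 : ℤ) * w) = g₀ at *
  generalize gammaFactor Q y (y ^ (1 : ℤ) * w) = g₁ at *
  generalize gammaFactor Q y (y ^ (2 : ℤ) * w) = g₂ at *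
  generalize gammaFactor Q y (y ^ (3 : ℤ) * w) = g₃ at *
  simp only [zpow_ofNat]
  have hD' : d₀ * u₃ = (-(L ^ 12 * (u₁ * d₂ + (y ^ 12 * (y * w) ^ 6) * (u₂ * d₁)))) / y ^ 6 := by
    rw [eq_div_iff (by positivity)]
    linear_combination (-1) * hD
  calc _ = tauScale y w (N + 1) * tauScale y w N * (E ^ 0 * (E * y ^ 2 / L ^ 8) ^ 3) * (g₀ * g₃) * (d₀ * u₃) := by
        ring
    _ = _ := by
      rw [hg, hD']
      field_simp
      ring

theorem tauLine_relation_upper (hQ₀ : Q ≠ 0) (hQ₁ : ‖Q‖ < 1) (hy : y ^ 2 = Q)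
    {a : ℂ → ℂ} (ha : ∀ x, x ≠ 0 → a (Q * x) = a x) {w : ℂ} (hw : w ∈ generic Q y) (N : ℤ) :
    tauLine Q y a (N + 1) (y ^ (1 : ℤ) * w) * tauLine Q y a (N - 1) (y ^ (2 : ℤ) * w)
      = y ^ 2 * w / (y ^ N) ^ 4
          * (tauLine Q y a N (y ^ (0 : ℤ) * w) * tauLine Q y a N (y ^ (3 : ℤ) * w))
        + (y ^ N) ^ 8 / (y ^ 4 * w ^ 2)
          * (tauLine Q y a N (y ^ (1 : ℤ) * w) * tauLine Q y a N (y ^ (2 : ℤ) * w)) := by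
  have hy0 : y ≠ 0 := by rintro rfl; simp at hy; exact hQ₀ hy.symm
  have hw0 := hw.1
  have hg := gammaFactor_bilinear hQ₀ hQ₁ hy hw
  have hD := toeplitzInt_relation_upper (gaugedSeq_recurrence hQ₀ hQ₁ hy ha hw) (δ := y ^ 12)
    (fun k => by rw [zpow_add₀ hy0]; norm_cast; ring) (by simpa using hy0) (by positivity) N 2
  rw [← zpow_pow_comm, show (2 : ℤ) - 1 = 1 by norm_num, show (2 : ℤ) - 2 = 0 by norm_num,
    show (2 : ℤ) + 1 = 3 by norm_num, zpow_one] at hD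
  have hL := zpow_ne_zero N hy0
  have hE := zpow_ne_zero (-4 * N ^ 2 + 6 * N) hy0
  have hc := tauScale_mul hy0 hw0 N
  simp only [tauLine_orbit hy0, zpow_exponent_succ hy0, zpow_exponent_pred hy0]
  generalize y ^ (-4 * N ^ 2 + 6 * N) = E at *
  generalize y ^ N = L at *
  generalize toeplitzInt (gaugedSeq y a w) N 0 = d₀ at *
  generalize toeplitzInt (gaugedSeq y a w) N 1 = d₁ at *
  generalize toeplitzInt (gaugedSeq y a w) N 2 = d₂ at *
  generalize toeplitzInt (gaugedSeq y a w) N 3 = d₃ at *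
  generalize toeplitzInt (gaugedSeq y a w) (N - 1) 2 = l₂ at *
  generalize toeplitzInt (gaugedSeq y a w) (N + 1) 1 = u₁ at *
  generalize gammaFactor Q y (y ^ (0 : ℤ) * w) = g₀ at *
  generalize gammaFactor Q y (y ^ (1 : ℤ) * w) = g₁ at *
  generalize gammaFactor Q y (y ^ (2 : ℤ) * w) = g₂ at *
  generalize gammaFactor Q y (y ^ (3 : ℤ) * w) = g₃ at *
  simp only [zpow_ofNat]
  have hD' : u₁ * l₂ = (-(y ^ 12 * (y * w) ^ 6) * (L ^ 12 * (d₂ * d₁) - d₀ * d₃)) / L ^ 12 := by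
    rw [eq_div_iff (by positivity)]
    linear_combination 1 * hD
  calc _ = (tauScale y w (N + 1) * tauScale y w (N - 1)) * ((E * y ^ 2 / L ^ 8) ^ 1 * (E * L ^ 8 / y ^ 10) ^ 2) * (g₁ * g₂) * (u₁ * l₂) := by
        ring
    _ = _ := by
      -- The left side sits at positions 1 and 2, so only the term at 0 and 3 needs the gamma
      -- relation.
      have hg' : g₁ * g₂ = -(y ^ 6 * w ^ 3) * (g₀ * g₃) := by
        rw [hg]
        field_simp
      rw [hc, hD']
      field_simp
      linear_combination -(tauScale y w N ^ 2 * d₀ * d₃) * hg'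

theorem tauLine_relation_lower (hQ₀ : Q ≠ 0) (hQ₁ : ‖Q‖ < 1) (hy : y ^ 2 = Q)
    {a : ℂ → ℂ} (ha : ∀ x, x ≠ 0 → a (Q * x) = a x) {w : ℂ} (hw : w ∈ generic Q y) (N : ℤ) :
    tauLine Q y a (N + 1) (y ^ (2 : ℤ) * w) * tauLine Q y a (N - 1) (y ^ (1 : ℤ) * w)
      = y ^ 2 * w * (y ^ N) ^ 4
          * (tauLine Q y a N (y ^ (0 : ℤ) * w) * tauLine Q y a N (y ^ (3 : ℤ) * w))
        + 1 / (y ^ 4 * w ^ 2 * (y ^ N) ^ 8)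
          * (tauLine Q y a N (y ^ (1 : ℤ) * w) * tauLine Q y a N (y ^ (2 : ℤ) * w)) := by
  have hy0 : y ≠ 0 := by rintro rfl; simp at hy; exact hQ₀ hy.symm
  have hw0 := hw.1
  have hg := gammaFactor_bilinear hQ₀ hQ₁ hy hw
  have hD := toeplitzInt_relation_lower (gaugedSeq_recurrence hQ₀ hQ₁ hy ha hw) (δ := y ^ 12)
    (fun k => by rw [zpow_add₀ hy0]; norm_cast; ring) (by simpa using hy0) (by positivity) N 1
  rw [← zpow_pow_comm, show (1 : ℤ) - 1 = 0 by norm_num, show (1 : ℤ) + 1 = 2 by norm_num,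
    show (1 : ℤ) + 2 = 3 by norm_num, zpow_zero, one_mul] at hD
  have hL := zpow_ne_zero N hy0
  have hE := zpow_ne_zero (-4 * N ^ 2 + 6 * N) hy0
  have hc := tauScale_mul hy0 hw0 N
  simp only [tauLine_orbit hy0, zpow_exponent_succ hy0, zpow_exponent_pred hy0]
  generalize y ^ (-4 * N ^ 2 + 6 * N) = E at *
  generalize y ^ N = L at *
  generalize toeplitzInt (gaugedSeq y a w) N 0 = d₀ at *
  generalize toeplitzInt (gaugedSeq y a w) N 1 = d₁ at *
  generalize toeplitzInt (gaugedSeq y a w) N 2 = d₂ at *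
  generalize toeplitzInt (gaugedSeq y a w) N 3 = d₃ at *
  generalize toeplitzInt (gaugedSeq y a w) (N - 1) 1 = l₁ at *
  generalize toeplitzInt (gaugedSeq y a w) (N + 1) 2 = u₂ at *
  generalize gammaFactor Q y (y ^ (0 : ℤ) * w) = g₀ at *
  generalize gammaFactor Q y (y ^ (1 : ℤ) * w) = g₁ at *
  generalize gammaFactor Q y (y ^ (2 : ℤ) * w) = g₂ at *
  generalize gammaFactor Q y (y ^ (3 : ℤ) * w) = g₃ at *
  simp only [zpow_ofNat]
  have hD' : u₂ * l₁ = ((y ^ 12 * w ^ 6) * (L ^ 12 * (d₀ * d₃) - d₂ * d₁)) / y ^ 6 := by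
    rw [eq_div_iff (by positivity)]
    linear_combination (-1) * hD
  calc _ = (tauScale y w (N + 1) * tauScale y w (N - 1)) * ((E * y ^ 2 / L ^ 8) ^ 2 * (E * L ^ 8 / y ^ 10) ^ 1) * (g₂ * g₁) * (u₂ * l₁) := by
        ring
    _ = _ := by
      have hg' : g₁ * g₂ = -(y ^ 6 * w ^ 3) * (g₀ * g₃) := by
        rw [hg]
        field_simp
      rw [hc, hD']
      field_simp
      linear_combination -(tauScale y w N ^ 2 * L ^ 12 * d₀ * d₃) * hg'

end TauLine

/-! ### From the `τ` functions of q-P_III to the function `tauLine` -/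

section Bridge

variable {Q y : ℂ}

theorem latticeFun_eq_of_periodOne {A : ℂ → ℂ → ℂ} (hA : PeriodOne Q A) {u v : ℂ}
    (hu : u ≠ 0) (hv : v ≠ 0) (n m : ℤ) : latticeFun Q A n m u v = A u v := by
  have h1 : ∀ n m : ℤ, latticeFun Q A n m u v = latticeFun Q A 0 m u v := by
    intro n m
    induction n using Int.induction_on with
    | zero => rfl
    | succ n ih => rw [(hA u v hu hv n m).1, ih]
    | pred n ih =>
      have := (hA u v hu hv (-(n : ℤ) - 1) m).1
      rw [sub_add_cancel] at this
      rw [← this, ih]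
  have h2 : ∀ m : ℤ, latticeFun Q A 0 m u v = latticeFun Q A 0 0 u v := by
    intro m
    induction m using Int.induction_on with
    | zero => rfl
    | succ m ih => rw [(hA u v hu hv 0 m).2, ih]
    | pred m ih =>
      have := (hA u v hu hv 0 (-(m : ℤ) - 1)).2
      rw [sub_add_cancel] at this
      rw [← this, ih]
  rw [h1, h2, latticeFun]
  simp

/-- `R₁` sends `(α₀, y)` to `(y α₀, y)`, since `α₁ α₀ = Q / y = y`. -/
theorem Symmetrized.apply_mul {A B : ℂ → ℂ → ℂ} (h : Symmetrized Q y A B) (hy : y ^ 2 = Q)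
    (hQ₀ : Q ≠ 0) {u : ℂ} (hu : u ≠ 0) : B u y = A (y * u) y := by
  have h1 := h.R₁_A 0 0 u hu
  have hy0 : y ≠ 0 := by rintro rfl; simp at hy; exact hQ₀ hy.symm
  have e0 : R₁Par (parPt Q u y) 0 = y * u := by
    simp [R₁Par, sPar, piPar, parPt, cartan]
  have e2 : R₁Par (parPt Q u y) 2 = y := by
    have e : R₁Par (parPt Q u y) 2 = Q / (u * y) * u := by
      simp [R₁Par, sPar, piPar, parPt, cartan]
    rw [e, ← hy]
    field_simp
  rw [e0, e2, latticeFun_eq_of_periodOne h.periodA (mul_ne_zero hy0 hu) hy0,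
    latticeFun_eq_of_periodOne h.periodB hu hy0] at h1
  exact h1.symm

theorem Symmetrized.apply_Q_mul {A B : ℂ → ℂ → ℂ} (h : Symmetrized Q y A B) (hy0 : y ≠ 0)
    {u : ℂ} (hu : u ≠ 0) : A (Q * u) y = A u y := by
  have := latticeFun_eq_of_periodOne h.periodA hu hy0 1 0
  simpa [latticeFun] using this

theorem qInf_sqrt_ne_zero (hy1 : ‖y‖ < 1) : qInf (y ^ 12) ((y ^ 12) ^ 2) ≠ 0 := by
  have h := norm_pow_lt_one hy1 (show 12 ≠ 0 by norm_num)
  refine qInf_ne_zero (norm_pow_lt_one h two_ne_zero) fun i => ?_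
  rw [← pow_mul, ← pow_succ']
  exact pow_succ_ne_one h _

theorem qInf_inv (hy0 : y ≠ 0) (hy1 : ‖y‖ < 1) : qInf (y ^ 12)⁻¹ ((y ^ 12) ^ 2)
    = (1 - (y ^ 12)⁻¹) * qInf (y ^ 12) ((y ^ 12) ^ 2) := by
  have h := norm_pow_lt_one hy1 (show 12 ≠ 0 by norm_num)
  rw [qInf_eq_mul (norm_pow_lt_one h two_ne_zero), show (y ^ 12) ^ 2 * (y ^ 12)⁻¹ = y ^ 12 by
    field_simp]

/-- At `m = -1` the series of `A` is the sine and that of `B` the cosine; `qInf_inv` brings both to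
the common denominator `(q;q²)_∞` and supplies the factor `-q` of the sine term. -/
theorem entryF_even (hQ₀ : Q ≠ 0) (hQ₁ : ‖Q‖ < 1) (hy : y ^ 2 = Q) {A B : ℂ → ℂ → ℂ}
    (h : Symmetrized Q y A B) {x : ℂ} (hx : x ≠ 0) (n : ℤ) :
    entryF Q A B n (-1) x y = entryFun (y ^ 12) y (fun u => A u y) (y ^ (2 * n) * x) := by
  have hy0 : y ≠ 0 := by rintro rfl; simp at hy; exact hQ₀ hy.symm
  have hy1 := norm_lt_one_of_sq hQ₁ hy
  have hI := qInf_sqrt_ne_zero hy1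
  have hq1 := one_sub_ne_zero (norm_pow_lt_one hy1 (show 12 ≠ 0 by norm_num))
  have hAw : A (y ^ (2 * n) * x) y = A x y := by
    rw [← latticeFun_eq_of_periodOne h.periodA hx hy0 n 0, latticeFun, zpow_mul, neg_zero,
      zpow_zero, one_mul, ← hy]
    norm_cast
  have hBw : A (y * (y ^ (2 * n) * x)) y = B x y := by
    rw [← h.apply_mul hy hQ₀ (by positivity),
      ← latticeFun_eq_of_periodOne h.periodB hx hy0 n 0, latticeFun, zpow_mul, neg_zero,
      zpow_zero, one_mul, ← hy]
    norm_cast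
  have hQ6 : Q ^ 6 = y ^ 12 := by rw [← hy]; ring
  have hw : (y ^ (2 * n) * x) ^ 12 = (y ^ 12) ^ (2 * n) * x ^ 12 := by
    rw [mul_pow, zpow_pow_comm]
  have hq0 : y ^ 12 ≠ 0 := by positivity
  simp only [entryF]
  rw [latticeFun_eq_of_periodOne h.periodA hx hy0, latticeFun_eq_of_periodOne h.periodB hx hy0]
  have e1 : (y ^ 6) ^ (-2 : ℤ) * (Q ^ 6) ^ (2 * (-1 : ℤ) + 2) = (y ^ 12)⁻¹ := by
    rw [hQ6]; norm_num; rw [← pow_mul]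
  have e2 : (y ^ 6) ^ 2 * (Q ^ 6) ^ (-2 * (-1 : ℤ)) = (y ^ 12) ^ 3 := by
    rw [hQ6]; norm_num; ring
  have e3 : (y ^ 6) ^ 2 * (x ^ 6) ^ 2 * (Q ^ 6) ^ (2 * n - 2 * (-1))
      = (y ^ 12) ^ 3 * (y ^ (2 * n) * x) ^ 12 := by
    rw [hQ6, hw, show 2 * n - 2 * (-1) = 2 * n + 2 by ring, zpow_add₀ hq0, zpow_ofNat]; ring
  have e4 : (x ^ 6) ^ 2 * (y ^ 6) ^ 2 * (Q ^ 6) ^ (2 * n - 2 * (-1) - 2)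
      = y ^ 12 * (y ^ (2 * n) * x) ^ 12 := by
    rw [hQ6, hw, show 2 * n - 2 * (-1) - 2 = 2 * n by ring]; ring
  have e5 : (y ^ 6) ^ 2 * (Q ^ 6) ^ (-2 * (-1 : ℤ) - 2) = y ^ 12 := by
    norm_num; ring
  have e6 : (x ^ 6) ^ 2 * (Q ^ 6) ^ (2 * n) = (y ^ (2 * n) * x) ^ 12 := by
    rw [hQ6, hw]; ring
  have e7 : (y ^ 6) ^ (-2 : ℤ) * (Q ^ 6) ^ (2 * (-1 : ℤ) + 4) = y ^ 12 := by
    rw [hQ6, zpow_neg]; norm_num; field_simp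
  have e8 : (x ^ 6) ^ 2 * (Q ^ 6) ^ (2 * n + 2) = (y ^ 12) ^ 2 * (y ^ (2 * n) * x) ^ 12 := by
    rw [hQ6, hw, zpow_add₀ hq0, zpow_ofNat]; ring
  have ht : theta (y ^ 12 * (y ^ (2 * n) * x) ^ 12) ((y ^ 12) ^ 2)
      / (qInf (y ^ 12) ((y ^ 12) ^ 2) * theta ((y ^ (2 * n) * x) ^ 12) ((y ^ 12) ^ 2))
      = thetaRatio (y ^ 12) (y ^ (2 * n) * x) / qInf (y ^ 12) ((y ^ 12) ^ 2) := by
    rw [thetaRatio, div_div, mul_comm (theta _ _) (qInf _ _)]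
  rw [e1, e2, e3, e4, e5, e6, e7, e8, hQ6, ht, entryFun, hAw, hBw, qInf_inv hy0 hy1, qCos, qSin]
  have hq2 : 1 - (y ^ 12)⁻¹ = -((1 - y ^ 12) / y ^ 12) := by
    field_simp
    ring
  rw [hq2]
  generalize qInf (y ^ 12) ((y ^ 12) ^ 2) = I at *
  generalize thetaRatio _ _ = t at *
  field_simp
  ring

/-- At `m = 0` sine and cosine change places. Since `y` times the argument is `Q ^ n x`, the values
`A` and `B` at `x` also change roles, and the same function reappears, divided by the theta ratio.
-/
theorem entryF_odd (hQ₀ : Q ≠ 0) (hQ₁ : ‖Q‖ < 1) (hy : y ^ 2 = Q) {A B : ℂ → ℂ → ℂ}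
    (h : Symmetrized Q y A B) {x : ℂ} (hx : x ∈ generic Q y) (n : ℤ) :
    entryF Q A B n 0 x y = (thetaRatio (y ^ 12) (y ^ (2 * n - 1) * x))⁻¹
      * entryFun (y ^ 12) y (fun u => A u y) (y ^ (2 * n - 1) * x) := by
  have hy0 : y ≠ 0 := by rintro rfl; simp at hy; exact hQ₀ hy.symm
  have hy1 := norm_lt_one_of_sq hQ₁ hy
  have hI := qInf_sqrt_ne_zero hy1
  have hq1 := one_sub_ne_zero (norm_pow_lt_one hy1 (show 12 ≠ 0 by norm_num))
  have hx0 := hx.1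
  have hr := thetaRatio_ne_zero hQ₀ hQ₁ hy (generic_zpow_mul hQ₀ hy (2 * n - 1) hx)
  have hAw : A (y * (y ^ (2 * n - 1) * x)) y = A x y := by
    rw [← latticeFun_eq_of_periodOne h.periodA hx0 hy0 n 0, latticeFun, ← mul_assoc,
      ← zpow_one_add₀ hy0, add_sub_cancel, zpow_mul, neg_zero, zpow_zero, one_mul, ← hy]
    norm_cast
  have hBw : A (y ^ (2 * n - 1) * x) y = B x y := by
    rw [h.apply_mul hy hQ₀ hx0, ← latticeFun_eq_of_periodOne h.periodA (mul_ne_zero hy0 hx0) hy0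
      (n - 1) 0, latticeFun, neg_zero, zpow_zero, one_mul, ← hy, ← mul_assoc]
    have : (y ^ 2) ^ (n - 1) * y = y ^ (2 * n - 1) := by
      rw [show 2 * n - 1 = 2 * (n - 1) + 1 by ring, zpow_add_one₀ hy0, zpow_mul]
      norm_cast
    rw [this]
  have hQ6 : Q ^ 6 = y ^ 12 := by rw [← hy]; ring
  have hq0 : y ^ 12 ≠ 0 := by positivity
  have hw : (y ^ 12) ^ (2 * n) * x ^ 12 = y ^ 12 * (y ^ (2 * n - 1) * x) ^ 12 := by
    rw [mul_pow, zpow_pow_comm, zpow_sub_one₀ hq0]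
    field_simp
  simp only [entryF]
  rw [latticeFun_eq_of_periodOne h.periodA hx0 hy0, latticeFun_eq_of_periodOne h.periodB hx0 hy0]
  have e1 : (y ^ 6) ^ (-2 : ℤ) * (Q ^ 6) ^ (2 * (0 : ℤ) + 2) = y ^ 12 := by
    rw [hQ6, zpow_neg]; norm_num; field_simp
  have e2 : (y ^ 6) ^ 2 * (Q ^ 6) ^ (-2 * (0 : ℤ)) = y ^ 12 := by
    norm_num; ring
  have e3 : (y ^ 6) ^ 2 * (x ^ 6) ^ 2 * (Q ^ 6) ^ (2 * n - 2 * 0)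
      = (y ^ 12) ^ 2 * (y ^ (2 * n - 1) * x) ^ 12 := by
    rw [hQ6, mul_zero, sub_zero]; linear_combination y ^ 12 * hw
  have e4 : (x ^ 6) ^ 2 * (y ^ 6) ^ 2 * (Q ^ 6) ^ (2 * n - 2 * 0 - 2)
      = (y ^ (2 * n - 1) * x) ^ 12 := by
    rw [hQ6, mul_zero, sub_zero, zpow_sub₀ hq0]
    norm_cast
    rw [mul_div_assoc', div_eq_iff (by positivity)]
    linear_combination y ^ 12 * hw
  have e5 : (y ^ 6) ^ 2 * (Q ^ 6) ^ (-2 * (0 : ℤ) - 2) = (y ^ 12)⁻¹ := by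
    rw [hQ6, mul_zero, zero_sub, zpow_neg]; norm_cast; field_simp
  have e6 : (x ^ 6) ^ 2 * (Q ^ 6) ^ (2 * n) = y ^ 12 * (y ^ (2 * n - 1) * x) ^ 12 := by
    rw [hQ6, ← hw]; ring
  have e7 : (y ^ 6) ^ (-2 : ℤ) * (Q ^ 6) ^ (2 * (0 : ℤ) + 4) = (y ^ 12) ^ 3 := by
    rw [hQ6, zpow_neg]; norm_num; field_simp
  have e8 : (x ^ 6) ^ 2 * (Q ^ 6) ^ (2 * n + 2) = (y ^ 12) ^ 3 * (y ^ (2 * n - 1) * x) ^ 12 := by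
    rw [hQ6, zpow_add₀ hq0, zpow_ofNat]; linear_combination (y ^ 12) ^ 2 * hw
  have ht : theta ((y ^ (2 * n - 1) * x) ^ 12) ((y ^ 12) ^ 2)
      / (qInf (y ^ 12)⁻¹ ((y ^ 12) ^ 2)
        * theta (y ^ 12 * (y ^ (2 * n - 1) * x) ^ 12) ((y ^ 12) ^ 2))
      = (thetaRatio (y ^ 12) (y ^ (2 * n - 1) * x))⁻¹ / qInf (y ^ 12)⁻¹ ((y ^ 12) ^ 2) := by
    rw [thetaRatio, inv_div, div_div, mul_comm (theta _ _) (qInf _ _)]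
  rw [e1, e2, e3, e4, e5, e6, e7, e8, hQ6, ht, entryFun, hAw, hBw, qInf_inv hy0 hy1, qCos, qSin]
  have hq2 : 1 - (y ^ 12)⁻¹ = -((1 - y ^ 12) / y ^ 12) := by
    field_simp
    ring
  rw [hq2]
  generalize qInf (y ^ 12) ((y ^ 12) ^ 2) = I at *
  generalize thetaRatio _ _ = t at *
  field_simp
  ring

/-- The factor `r ^ (j - i)` is conjugation by a diagonal matrix and does not change the
determinant. -/
theorem det_gauge {n : ℕ} {c d r : ℂ} (hr : r ≠ 0) {f g : Fin n → Fin n → ℂ}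
    (h : ∀ i j, c * f i j = d * r ^ (((j : ℕ) : ℤ) - ((i : ℕ) : ℤ)) * g i j) :
    c ^ n * (Matrix.of f).det = d ^ n * (Matrix.of g).det := by
  have h1 := Matrix.det_mul_row (fun _ : Fin n => c) (Matrix.of f)
  have h2 := Matrix.det_mul_row (fun j : Fin n => 1 * r ^ (j : ℕ))
    (Matrix.of fun i j : Fin n => (d * r⁻¹ ^ (i : ℕ)) * (Matrix.of g) i j)
  rw [Matrix.det_mul_column, prod_mul_pow_fin, prod_mul_pow_fin] at h2
  rw [Finset.prod_const, Finset.card_univ, Fintype.card_fin] at h1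
  rw [← h1]
  have h3 : (Matrix.of fun i j : Fin n => c * (Matrix.of f) i j) = Matrix.of fun i j : Fin n =>
      1 * r ^ (j : ℕ) * (Matrix.of fun i j : Fin n => (d * r⁻¹ ^ (i : ℕ)) * (Matrix.of g) i j)
        i j := by
    ext i j
    simp only [Matrix.of_apply, h, zpow_sub₀ hr, zpow_natCast, inv_pow]
    field_simp
  rw [h3, h2, inv_pow, one_pow, one_mul]
  field_simp

theorem apply_zpow_two_mul (hQ₀ : Q ≠ 0) (hy : y ^ 2 = Q) {f : ℂ → ℂ} {c : ℂ} (hc : c ≠ 0)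
    (hf : ∀ w ∈ generic Q y, f (y * (y * w)) = c * f w) {w : ℂ} (hw : w ∈ generic Q y) (l : ℤ) :
    f (y ^ (2 * l) * w) = c ^ l * f w := by
  have hy0 : y ≠ 0 := by rintro rfl; simp at hy; exact hQ₀ hy.symm
  have hs : ∀ l : ℤ, f (y ^ (2 * (l + 1)) * w) = c * f (y ^ (2 * l) * w) := by
    intro l
    rw [← hf _ (generic_zpow_mul hQ₀ hy _ hw), ← mul_assoc, ← mul_assoc, ← sq,
      show 2 * (l + 1) = 2 + 2 * l by ring, zpow_add₀ hy0]
    norm_cast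
  induction l using Int.induction_on with
  | zero => simp
  | succ l ih => rw [hs, ih, zpow_add_one₀ hc]; ring
  | pred l ih =>
    have := hs (-(l : ℤ) - 1)
    rw [sub_add_cancel, ih] at this
    rw [zpow_sub_one₀ hc]
    field_simp
    rw [mul_comm, this, mul_comm]

theorem gaugedSeq_even (hQ₀ : Q ≠ 0) (hQ₁ : ‖Q‖ < 1) (hy : y ^ 2 = Q) (a : ℂ → ℂ) {w : ℂ}
    (hw : w ∈ generic Q y) (l : ℤ) : gaugedSeq y a w (2 * l)
      = (-y ^ 6) ^ l * (thetaFactor (y ^ 12) y w * entryFun (y ^ 12) y a (y ^ (2 * l) * w)) := by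
  have hy0 : y ≠ 0 := by rintro rfl; simp at hy; exact hQ₀ hy.symm
  rw [gaugedSeq, gaugedEntry, apply_zpow_two_mul hQ₀ hy (by simpa using hy0)
    (fun _ h => thetaFactor_mul_mul hQ₀ hQ₁ hy h) hw, mul_assoc]

theorem thetaFactor_pow_mul_detPsi_even (hQ₀ : Q ≠ 0) (hQ₁ : ‖Q‖ < 1) (hy : y ^ 2 = Q)
    {A B : ℂ → ℂ → ℂ} (h : Symmetrized Q y A B) {x : ℂ} (hx : x ∈ generic Q y) (n N : ℤ) :
    thetaFactor (y ^ 12) y (y ^ (2 * n) * x) ^ N * detPsi Q A B n (-1) N x y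
      = toeplitzInt (gaugedSeq y (fun u => A u y) (y ^ (2 * n) * x)) N 0 := by
  have hy0 : y ≠ 0 := by rintro rfl; simp at hy; exact hQ₀ hy.symm
  have hw := generic_zpow_mul hQ₀ hy (2 * n) hx
  rcases lt_or_ge N 0 with hN | hN
  · rw [toeplitzInt_of_neg _ hN, detPsi, if_pos hN, mul_zero]
  · lift N to ℕ using hN
    rw [toeplitzInt_natCast, detPsi, if_neg (by lia), zpow_natCast, Int.toNat_natCast, toeplitz]
    have := det_gauge (n := N) (c := thetaFactor (y ^ 12) y (y ^ (2 * n) * x)) (d := 1)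
      (r := (-y ^ 6)⁻¹) (by simpa using hy0)
      (f := fun i j : Fin N => entryF Q A B (n - ((i : ℕ) : ℤ) + ((j : ℕ) : ℤ)) (-1) x y)
      (g := fun i j : Fin N => gaugedSeq y (fun u => A u y) (y ^ (2 * n) * x)
        (0 + 2 * ((j : ℕ) : ℤ) - 2 * ((i : ℕ) : ℤ))) ?_
    · rw [this, one_pow, one_mul]
    · intro i j
      rw [entryF_even hQ₀ hQ₁ hy h hx.1, show (0 + 2 * ((j : ℕ) : ℤ) - 2 * ((i : ℕ) : ℤ))
        = 2 * (((j : ℕ) : ℤ) - ((i : ℕ) : ℤ)) by ring, gaugedSeq_even hQ₀ hQ₁ hy _ hw, one_mul,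
        inv_zpow, inv_mul_cancel_left₀ (zpow_ne_zero _ (by simpa using hy0)), ← mul_assoc (y ^ _),
        ← zpow_add₀ hy0]
      congr 4
      ring

/-- The inverse theta ratio of an entry changes by `q ^ (j - i)` along the matrix. This is the
square of the gauge factor `(-y ^ 6) ^ (j - i)`: one copy goes into the gauged sequence, the other
is removed by conjugation. -/
theorem thetaFactor_pow_mul_detPsi_odd (hQ₀ : Q ≠ 0) (hQ₁ : ‖Q‖ < 1) (hy : y ^ 2 = Q)
    {A B : ℂ → ℂ → ℂ} (h : Symmetrized Q y A B) {x : ℂ} (hx : x ∈ generic Q y) (n N : ℤ) :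
    ((y ^ 6)⁻¹ * (thetaRatio (y ^ 12) (y ^ (2 * n - 1) * x)
        * thetaFactor (y ^ 12) y (y ^ (2 * n - 1) * x))) ^ N * detPsi Q A B n 0 N x y
      = ((y ^ 6)⁻¹) ^ N
        * toeplitzInt (gaugedSeq y (fun u => A u y) (y ^ (2 * n - 1) * x)) N 0 := by
  have hy0 : y ≠ 0 := by rintro rfl; simp at hy; exact hQ₀ hy.symm
  have hw := generic_zpow_mul hQ₀ hy (2 * n - 1) hx
  have hr := thetaRatio_ne_zero hQ₀ hQ₁ hy hw
  rcases lt_or_ge N 0 with hN | hN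
  · rw [toeplitzInt_of_neg _ hN, detPsi, if_pos hN, mul_zero, mul_zero]
  · lift N to ℕ using hN
    rw [toeplitzInt_natCast, detPsi, if_neg (by lia), zpow_natCast, zpow_natCast,
      Int.toNat_natCast, toeplitz]
    refine det_gauge (r := -y ^ 6) (by simpa using hy0) ?_
    intro i j
    have e : y ^ (2 * (n - ((i : ℕ) : ℤ) + ((j : ℕ) : ℤ)) - 1) * x
        = y ^ (2 * (((j : ℕ) : ℤ) - ((i : ℕ) : ℤ))) * (y ^ (2 * n - 1) * x) := by
      rw [← mul_assoc, ← zpow_add₀ hy0]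
      congr 2
      ring
    rw [entryF_odd hQ₀ hQ₁ hy h hx, show (0 + 2 * ((j : ℕ) : ℤ) - 2 * ((i : ℕ) : ℤ))
        = 2 * (((j : ℕ) : ℤ) - ((i : ℕ) : ℤ)) by ring, gaugedSeq_even hQ₀ hQ₁ hy _ hw, e,
      apply_zpow_two_mul hQ₀ hy (by simpa using hy0)
        (fun _ h => thetaRatio_mul_mul hQ₀ hQ₁ hy h) hw]
    generalize ((j : ℕ) : ℤ) - ((i : ℕ) : ℤ) = l
    have h1 : (-y ^ 6) ^ l * (-y ^ 6) ^ l = (y ^ 12) ^ l := by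
      rw [← mul_zpow]
      congr 1
      ring
    have h2 : (y ^ 12) ^ l ≠ 0 := zpow_ne_zero _ (by positivity)
    rw [inv_zpow, mul_inv, inv_inv]
    generalize entryFun _ _ _ _ = F
    generalize thetaRatio _ _ = t at *
    generalize thetaFactor _ _ _ = C
    field_simp
    linear_combination (-C * F) * h1

theorem tauIII_even (hQ₀ : Q ≠ 0) (hQ₁ : ‖Q‖ < 1) (hy : y ^ 2 = Q)
    {A B : ℂ → ℂ → ℂ} (h : Symmetrized Q y A B) {x : ℂ} (hx : x ∈ generic Q y) (n N : ℤ) :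
    tauIII Q A B n 0 N x y = tauLine Q y (fun u => A u y) N (y ^ (2 * n) * x) := by
  have hy0 : y ≠ 0 := by rintro rfl; simp at hy; exact hQ₀ hy.symm
  have hx0 := hx.1
  have hQ6 : Q ^ 6 = y ^ 12 := by rw [← hy]; ring
  have hQz : ∀ k : ℤ, Q ^ k = y ^ (2 * k) := fun k => by rw [zpow_mul, ← hy]; norm_cast
  rw [tauLine, ← thetaFactor_pow_mul_detPsi_even hQ₀ hQ₁ hy h hx n N]
  simp only [tauIII, zero_sub]
  have e1 : Q ^ (-6 * n) * x ^ (-6 : ℤ) = ((y ^ (2 * n) * x) ^ 6)⁻¹ := by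
    rw [hQz, mul_pow, mul_inv, ← zpow_natCast, ← zpow_natCast, ← zpow_mul, ← zpow_neg, ← zpow_neg]
    congr 2
    push_cast
    ring
  have e2 : Q ^ (6 * (0 : ℤ)) * y ^ (-6 : ℤ) = (y ^ 6)⁻¹ := by
    rw [mul_zero, zpow_zero, one_mul, zpow_neg, zpow_ofNat]
  have e3 : Q ^ (-6 * (n - 0)) * x ^ (-6 : ℤ) * y ^ (-6 : ℤ)
      = ((y ^ (2 * n) * x) ^ 6)⁻¹ * (y ^ 6)⁻¹ := by
    rw [sub_zero, e1, zpow_neg, zpow_ofNat]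
  have e4 : Q ^ (-2 * (2 * n - 0) * N ^ 2 + 6 * n * N) * x ^ (-4 * N ^ 2 + 6 * N)
      = (y ^ (2 * n) * x) ^ (-4 * N ^ 2 + 6 * N) := by
    rw [hQz, mul_zpow, ← zpow_mul]
    congr 2
    ring
  have e5 : Q ^ (2 * n - 0 + 1) * x ^ 2 * y = Q * (y ^ (2 * n) * x) ^ 2 * y := by
    rw [zpow_add_one₀ hQ₀, sub_zero, mul_pow, zpow_pow_comm, hy]
    ring
  have e6 : Q ^ (-n + 2 * 0 - 1) * (Q / (x * y)) ^ 2 * x = (y ^ (2 * n) * x)⁻¹ := by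
    rw [mul_zero, add_zero, zpow_sub_one₀ hQ₀, ← hQz, zpow_neg, mul_inv, div_pow, mul_pow, hy]
    field_simp
  have e7 : Q ^ (-n - 0) * y ^ 2 * (Q / (x * y)) = Q * y * (y ^ (2 * n) * x)⁻¹ := by
    rw [sub_zero, ← hQz, zpow_neg, mul_inv]
    field_simp
  rw [e1, e2, e3, e5, e6, e7, hQ6, gammaFactor, thetaFactor, ← e4]
  ring

theorem tauIII_odd (hQ₀ : Q ≠ 0) (hQ₁ : ‖Q‖ < 1) (hy : y ^ 2 = Q)
    {A B : ℂ → ℂ → ℂ} (h : Symmetrized Q y A B) {x : ℂ} (hx : x ∈ generic Q y) (n N : ℤ) :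
    tauIII Q A B n 1 N x y = tauLine Q y (fun u => A u y) N (y ^ (2 * n - 1) * x) := by
  have hy0 : y ≠ 0 := by rintro rfl; simp at hy; exact hQ₀ hy.symm
  have hx0 := hx.1
  have hw := generic_zpow_mul hQ₀ hy (2 * n - 1) hx
  have hQ6 : Q ^ 6 = y ^ 12 := by rw [← hy]; ring
  have hQz : ∀ k : ℤ, Q ^ k = y ^ (2 * k) := fun k => by rw [zpow_mul, ← hy]; norm_cast
  have hdet := thetaFactor_pow_mul_detPsi_odd hQ₀ hQ₁ hy h hx n N
  rw [← thetaFactor_odd hQ₀ hQ₁ hy hw] at hdet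
  have hQw : Q ^ n = y ^ (2 * n - 1) * y := by
    rw [hQz, ← zpow_add_one₀ hy0, sub_add_cancel]
  have e0 : Q ^ (-6 * n) * x ^ (-6 : ℤ) = ((y ^ (2 * n - 1) * x) ^ 6)⁻¹ * (y ^ 6)⁻¹ := by
    rw [mul_comm (-6) n, zpow_mul, hQw, zpow_neg, zpow_neg, zpow_ofNat, zpow_ofNat, mul_pow,
      mul_pow, mul_inv, mul_inv]
    ring
  have e2 : Q ^ (6 * (1 : ℤ)) * y ^ (-6 : ℤ) = y ^ 12 * (y ^ 6)⁻¹ := by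
    rw [mul_one, zpow_neg, zpow_ofNat, zpow_ofNat, hQ6]
  have e3 : Q ^ (-6 * (n - 1)) * x ^ (-6 : ℤ) * y ^ (-6 : ℤ)
      = ((y ^ (2 * n - 1) * x) ^ 6)⁻¹ := by
    rw [show -6 * (n - 1) = -6 * n + 6 by ring, zpow_add₀ hQ₀, mul_right_comm (Q ^ (-6 * n)), e0,
      zpow_ofNat, hQ6, zpow_neg, zpow_ofNat]
    field_simp
  -- The power `(y⁻⁶) ^ N` left over from the theta quotient at `m = 1` corrects the linear term in
  -- `N`, from `12 n N` to `6 (2 n - 1) N` as an exponent of `y`.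
  have e4 : Q ^ (-2 * (2 * n - 1) * N ^ 2 + 6 * n * N) * x ^ (-4 * N ^ 2 + 6 * N)
      * ((y ^ 6)⁻¹) ^ N = (y ^ (2 * n - 1) * x) ^ (-4 * N ^ 2 + 6 * N) := by
    rw [hQz, mul_zpow, ← zpow_mul, ← zpow_natCast, ← zpow_neg, ← zpow_mul, mul_right_comm,
      ← zpow_add₀ hy0]
    congr 2
    push_cast
    ring
  have e5 : Q ^ (2 * n - 1 + 1) * x ^ 2 * y = Q * (y ^ (2 * n - 1) * x) ^ 2 * y := by
    rw [sub_add_cancel, mul_comm 2 n, zpow_mul, zpow_ofNat, hQw, ← hy]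
    ring_nf
  have e6 : Q ^ (-n + 2 * 1 - 1) * (Q / (x * y)) ^ 2 * x = Q * y * (y ^ (2 * n - 1) * x)⁻¹ := by
    rw [show -n + 2 * 1 - 1 = 1 - n by ring, zpow_sub₀ hQ₀, hQw, zpow_one, mul_inv, ← hy]
    field_simp
  have e7 : Q ^ (-n - 1) * y ^ 2 * (Q / (x * y)) = (y ^ (2 * n - 1) * x)⁻¹ := by
    rw [zpow_sub_one₀ hQ₀, zpow_neg, hQw, mul_inv, ← hy]
    field_simp
  simp only [tauIII, sub_self]
  rw [tauLine, ← e4, e0, e2, e3, e5, e6, e7, hQ6, gammaFactor]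
  linear_combination ((-1) ^ (N * (N + 1) / 2)
    * Q ^ (-2 * (2 * n - 1) * N ^ 2 + 6 * n * N) * x ^ (-4 * N ^ 2 + 6 * N) * y ^ (-2 * N ^ 2)
    * (ellGamma (Q * (y ^ (2 * n - 1) * x) ^ 2 * y) Q Q
      * ellGamma (y ^ (2 * n - 1) * x)⁻¹ Q Q
      * ellGamma (Q * y * (y ^ (2 * n - 1) * x)⁻¹) Q Q)) * hdet

theorem tauII_eq_tauLine (hQ₀ : Q ≠ 0) (hQ₁ : ‖Q‖ < 1) (hy : y ^ 2 = Q)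
    {A B : ℂ → ℂ → ℂ} (h : Symmetrized Q y A B) {x : ℂ} (hx : x ∈ generic Q y) (k N : ℤ) :
    tauII Q y A B k N x = tauLine Q y (fun u => A u y) N (y ^ k * x) := by
  rw [tauII]
  split_ifs with hk
  · obtain ⟨n, rfl⟩ := hk
    rw [← two_mul, Int.mul_ediv_cancel_left n two_ne_zero, tauIII_even hQ₀ hQ₁ hy h hx]
  · obtain ⟨n, rfl⟩ := Int.not_even_iff_odd.mp hk
    rw [show 2 * n + 1 + 1 = 2 * (n + 1) by ring, Int.mul_ediv_cancel_left _ two_ne_zero,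
      tauIII_odd hQ₀ hQ₁ hy h hx, show 2 * (n + 1) - 1 = 2 * n + 1 by ring]

end Bridge

/-! ### The birational action and the relations with cleared denominators -/

section Action

variable {Q : ℂ}

theorem R₁_eq_of_rel {p p' : Pt} (h : R₁Rel Q p p') (hQ : Q ≠ 0) (hγ : p.γ ≠ 0)
    (hα : p.α 0 ≠ 0) (hτ : p.τ 0 ≠ 0) (hτb : p.τb 0 ≠ 0) : R₁ Q p = p' := by
  have hu : uHalf Q p.γ (p.α 0) ≠ 0 := by
    unfold uHalf
    positivity
  have hv : vHalf Q p.γ (p.α 0) ≠ 0 := by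
    unfold vHalf
    positivity
  ext i
  · exact (congrFun h.α i).symm
  · exact h.γ.symm
  · fin_cases i
    · exact h.τ₀.symm
    · change (uPar Q p.γ (p.α 0) * p.τ 1 * p.τb 2 + p.τb 1 * p.τ 2)
        / (uHalf Q p.γ (p.α 0) * p.τb 0) = p'.τ 1
      rw [← h.τ₁, mul_div_cancel_left₀ _ (mul_ne_zero hu hτb)]
    · exact h.τ₂.symm
  · fin_cases i
    · exact h.τb₀.symm
    · change (vPar Q p.γ (p.α 0) * p.τb 1 * p.τ 2 + p.τ 1 * p.τb 2)
        / (vHalf Q p.γ (p.α 0) * p.τ 0) = p'.τb 1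
      rw [← h.τb₁, mul_div_cancel_left₀ _ (mul_ne_zero hv hτ)]
    · exact h.τb₂.symm

/-- Under `r` the parameters `u` become `v`, which is why `T₄ = r w₀` involves `v`. -/
theorem uPar_inv_gamma (hQ : Q ≠ 0) (γ α : ℂ) : uPar Q (Q * γ)⁻¹ α = vPar Q γ α := by
  rw [uPar, vPar, inv_zpow, ← zpow_neg, neg_neg, mul_zpow, zpow_neg, zpow_ofNat, zpow_ofNat,
    zpow_ofNat]
  field_simp

theorem T₄_eq_of_rel {p p' : Pt} (h : T₄Rel Q p p') (hQ : Q ≠ 0)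
    (hα : ∀ i, p.α i ≠ 0) (hτ : ∀ i, p.τ i ≠ 0) : T₄ Q p = p' := by
  ext i
  · exact (congrFun h.α i).symm
  · rw [h.γ]
    exact inv_inv _
  · exact (congrFun h.τ i).symm
  · have := h.τb i
    change p.α (i + 1) ^ 2
        * (p.τ i * p.τb (i + 1) * p.τb (i + 2)
          + uPar Q (Q * p.γ)⁻¹ (p.α (i - 1)) * p.τb i * p.τ (i + 1) * p.τb (i + 2)
          + (uPar Q (Q * p.γ)⁻¹ (p.α (i + 1)))⁻¹ * p.τb i * p.τb (i + 1) * p.τ (i + 2))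
      / (p.α (i + 2) ^ 2 * p.τ (i + 1) * p.τ (i + 2)) = _
    rw [uPar_inv_gamma hQ, uPar_inv_gamma hQ, ← this]
    exact mul_div_cancel_left₀ _
      (mul_ne_zero (mul_ne_zero (pow_ne_zero 2 (hα _)) (hτ _)) (hτ _))

theorem T₄Inv_eq_of_rel {p p' : Pt} (h : T₄InvRel Q p p') (hQ : Q ≠ 0)
    (hα : ∀ i, p.α i ≠ 0) (hτb : ∀ i, p.τb i ≠ 0) : T₄Inv Q p = p' := by
  ext i
  · exact (congrFun h.α i).symm
  · change (Q * p.γ⁻¹)⁻¹ = p'.γ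
    rw [← h.γ]
    field_simp
  · have := h.τ i
    change p.α (i + 1) ^ 2
        * (p.τb i * p.τ (i + 1) * p.τ (i + 2)
          + uPar Q p.γ (p.α (i - 1)) * p.τ i * p.τb (i + 1) * p.τ (i + 2)
          + (uPar Q p.γ (p.α (i + 1)))⁻¹ * p.τ i * p.τ (i + 1) * p.τb (i + 2))
      / (p.α (i + 2) ^ 2 * p.τb (i + 1) * p.τb (i + 2)) = _
    rw [← this]
    exact mul_div_cancel_left₀ _
      (mul_ne_zero (mul_ne_zero (pow_ne_zero 2 (hα _)) (hτb _)) (hτb _))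
  · exact (congrFun h.τb i).symm

end Action

/-- The bilinear relations along the orbit of `x`, with denominators cleared, for
`T k N = τ_N^k`. -/
structure OrbitRelations (y x : ℂ) (T : ℤ → ℤ → ℂ) : Prop where
  last : ∀ k N : ℤ, y ^ 2 * (y ^ N) ^ 4 * (y ^ k * x) ^ 3 * (T (k - 2) (N + 1) * T (k + 1) N)
    = (y ^ k * x) ^ 6 * (T (k - 1) (N + 1) * T k N)
      + y ^ 4 * (y ^ N) ^ 8 * (T (k - 1) N * T k (N + 1))
  first : ∀ k N : ℤ, y ^ 2 * (y ^ N) ^ 4 * (y ^ k * x) ^ 3 * (T (k - 2) N * T (k + 1) (N + 1))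
    = y ^ 4 * (y ^ N) ^ 8 * (y ^ k * x) ^ 6 * (T (k - 1) N * T k (N + 1))
      + T (k - 1) (N + 1) * T k N
  upper : ∀ k N : ℤ, y ^ 2 * (y ^ N) ^ 4 * (y ^ k * x) ^ 2 * (T k (N + 1) * T (k + 1) (N - 1))
    = y ^ 3 * (y ^ k * x) ^ 3 * (T (k - 1) N * T (k + 2) N) + (y ^ N) ^ 12 * (T k N * T (k + 1) N)
  lower : ∀ k N : ℤ, y ^ 2 * (y ^ N) ^ 8 * (y ^ k * x) ^ 2 * (T (k + 1) (N + 1) * T k (N - 1))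
    = y ^ 3 * (y ^ N) ^ 12 * (y ^ k * x) ^ 3 * (T (k - 1) N * T (k + 2) N) + T k N * T (k + 1) N

theorem orbitRelations {Q y : ℂ} (hQ₀ : Q ≠ 0) (hQ₁ : ‖Q‖ < 1) (hy : y ^ 2 = Q) {a : ℂ → ℂ}
    (ha : ∀ x, x ≠ 0 → a (Q * x) = a x) {x : ℂ} (hx : x ∈ generic Q y) :
    OrbitRelations y x fun k N => tauLine Q y a N (y ^ k * x) := by
  have hy0 : y ≠ 0 := by rintro rfl; simp at hy; exact hQ₀ hy.symm
  have hx0 := hx.1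
  have hsh : ∀ (k l j : ℤ), k + l = j → y ^ l * (y ^ k * x) = y ^ j * x := by
    rintro k l j rfl
    rw [← mul_assoc, ← zpow_add₀ hy0, add_comm]
  -- The relations `last` and `first` are based at position `k - 2` of the orbit, `upper` and
  -- `lower` at `k - 1`.
  have hz2 : ∀ k : ℤ, y ^ k * x = y ^ 2 * (y ^ (k - 2) * x) := by
    intro k
    rw [zpow_sub₀ hy0, zpow_ofNat]
    field_simp
  have hz1 : ∀ k : ℤ, y ^ k * x = y * (y ^ (k - 1) * x) := by
    intro k
    rw [zpow_sub₀ hy0, zpow_one]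
    field_simp
  constructor <;> intro k N <;> have hL := zpow_ne_zero N hy0
  · have h := tauLine_relation_last hQ₀ hQ₁ hy ha (generic_zpow_mul hQ₀ hy (k - 2) hx) N
    rw [hsh _ _ (k - 2) (by ring), hsh _ _ (k + 1) (by ring), hsh _ _ (k - 1) (by ring),
      hsh _ _ k (by ring)] at h
    have hz := hz2 k
    have hw0 : y ^ (k - 2) * x ≠ 0 := by positivity
    simp only [h]
    rw [hz]
    field_simp
  · have h := tauLine_relation_first hQ₀ hQ₁ hy ha (generic_zpow_mul hQ₀ hy (k - 2) hx) N
    rw [hsh _ _ (k - 2) (by ring), hsh _ _ (k + 1) (by ring), hsh _ _ (k - 1) (by ring),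
      hsh _ _ k (by ring)] at h
    have hz := hz2 k
    have hw0 : y ^ (k - 2) * x ≠ 0 := by positivity
    simp only [h]
    rw [hz]
    field_simp
  · have h := tauLine_relation_upper hQ₀ hQ₁ hy ha (generic_zpow_mul hQ₀ hy (k - 1) hx) N
    rw [hsh _ _ k (by ring), hsh _ _ (k + 1) (by ring), hsh _ _ (k - 1) (by ring),
      hsh _ _ (k + 2) (by ring)] at h
    have hz := hz1 k
    have hw0 : y ^ (k - 1) * x ≠ 0 := by positivity
    simp only [h]
    rw [hz]
    field_simp
  · have h := tauLine_relation_lower hQ₀ hQ₁ hy ha (generic_zpow_mul hQ₀ hy (k - 1) hx) N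
    rw [hsh _ _ (k + 1) (by ring), hsh _ _ k (by ring), hsh _ _ (k - 1) (by ring),
      hsh _ _ (k + 2) (by ring)] at h
    have hz := hz1 k
    have hw0 : y ^ (k - 1) * x ≠ 0 := by positivity
    simp only [h]
    rw [hz]
    field_simp

/-! ### The action on the τ lattice -/

section Lattice

variable {y x : ℂ} {T : ℤ → ℤ → ℂ → ℂ}

theorem uPar_zpow (y : ℂ) (N : ℤ) (α : ℂ) :
    uPar (y ^ 2) ((y ^ 2) ^ N) α = α ^ 6 / (y ^ 4 * (y ^ N) ^ 8) := by
  have h : (y ^ 2) ^ N = (y ^ N) ^ 2 := (zpow_pow_comm y N 2).symm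
  rw [uPar, h, zpow_neg, zpow_neg, zpow_ofNat, zpow_ofNat]
  ring

theorem uHalf_zpow (y : ℂ) (N : ℤ) (α : ℂ) :
    uHalf (y ^ 2) ((y ^ 2) ^ N) α = α ^ 3 / (y ^ 2 * (y ^ N) ^ 4) := by
  have h : (y ^ 2) ^ N = (y ^ N) ^ 2 := (zpow_pow_comm y N 2).symm
  rw [uHalf, h, zpow_neg, zpow_neg, zpow_ofNat, zpow_ofNat]
  ring

theorem vPar_zpow (y : ℂ) (N : ℤ) (α : ℂ) :
    vPar (y ^ 2) ((y ^ 2) ^ N) α = y ^ 4 * (y ^ N) ^ 8 * α ^ 6 := by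
  rw [vPar, ← zpow_pow_comm]
  ring

theorem vHalf_zpow (y : ℂ) (N : ℤ) (α : ℂ) :
    vHalf (y ^ 2) ((y ^ 2) ^ N) α = y ^ 2 * (y ^ N) ^ 4 * α ^ 3 := by
  rw [vHalf, ← zpow_pow_comm]
  ring

theorem parPt_one (hy0 : y ≠ 0) (z : ℂ) : parPt (y ^ 2) z y 1 = y / z := by
  change y ^ 2 / (z * y) = y / z
  rw [sq, mul_div_mul_right _ _ hy0]

theorem R₁Par_parPt (hy0 : y ≠ 0) (hx : x ≠ 0) (k : ℤ) :
    R₁Par (parPt (y ^ 2) (y ^ k * x) y) = parPt (y ^ 2) (y ^ (k + 1) * x) y := by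
  rw [zpow_add_one₀ hy0]
  have := zpow_ne_zero k hy0
  ext i
  fin_cases i <;> simp [R₁Par, sPar, piPar, parPt, cartan] <;> field_simp

theorem R₁InvPar_parPt (hy0 : y ≠ 0) (hx : x ≠ 0) (k : ℤ) :
    piPar (sPar 1 (parPt (y ^ 2) (y ^ k * x) y)) = parPt (y ^ 2) (y ^ (k - 1) * x) y := by
  rw [zpow_sub_one₀ hy0]
  have := zpow_ne_zero k hy0
  ext i
  fin_cases i <;> simp [sPar, piPar, parPt, cartan] <;> field_simp

theorem zpow_succ_pow (hy0 : y ≠ 0) (N : ℤ) (n : ℕ) :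
    (y ^ (N + 1)) ^ n = (y ^ N) ^ n * y ^ n := by
  rw [zpow_add_one₀ hy0, mul_pow]

theorem OrbitRelations.R₁Rel (h : OrbitRelations y x fun k N => T k N x) (hy0 : y ≠ 0)
    (hx : x ≠ 0) (k N : ℤ) :
    R₁Rel (y ^ 2) (latticePt (y ^ 2) y T k N x) (latticePt (y ^ 2) y T (k + 1) N x) := by
  have hL := zpow_ne_zero N hy0
  have e1 : k + 1 - 2 = k - 1 := by ring
  have e2 : k + 1 - 1 = k := by ring
  constructor
  · exact (R₁Par_parPt hy0 hx k).symm
  · rfl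
  · change T (k + 1 - 2) N x = _
    rw [e1]
    rfl
  · change T (k + 1 - 1) N x = _
    rw [e2]
    rfl
  · change T (k + 1 - 2) (N + 1) x = _
    rw [e1]
    rfl
  · change T (k + 1 - 1) (N + 1) x = _
    rw [e2]
    rfl
  · change uHalf (y ^ 2) ((y ^ 2) ^ N) (y ^ k * x) * T (k - 2) (N + 1) x
        * T (k + 1) N x
      = uPar (y ^ 2) ((y ^ 2) ^ N) (y ^ k * x) * T k N x * T (k - 1) (N + 1) x
        + T k (N + 1) x * T (k - 1) N x
    rw [uHalf_zpow, uPar_zpow]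
    have := h.last k N
    generalize y ^ k * x = z at *
    generalize y ^ N = L at *
    field_simp
    linear_combination this
  · change vHalf (y ^ 2) ((y ^ 2) ^ N) (y ^ k * x) * T (k - 2) N x * T (k + 1) (N + 1) x
      = vPar (y ^ 2) ((y ^ 2) ^ N) (y ^ k * x) * T k (N + 1) x * T (k - 1) N x
        + T k N x * T (k - 1) (N + 1) x
    rw [vHalf_zpow, vPar_zpow]
    linear_combination h.first k N

theorem OrbitRelations.R₁Inv_eq (h : OrbitRelations y x fun k N => T k N x) (hy0 : y ≠ 0)
    (hx : x ≠ 0) (k N : ℤ) (hτ : T k N x ≠ 0) (hτb : T k (N + 1) x ≠ 0) :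
    R₁Inv (y ^ 2) (latticePt (y ^ 2) y T k N x) = latticePt (y ^ 2) y T (k - 1) N x := by
  have hL := zpow_ne_zero N hy0
  have hz : y ^ k * x ≠ 0 := mul_ne_zero (zpow_ne_zero k hy0) hx
  have ez : y ^ (k - 1) * x = y ^ k * x / y := by
    rw [zpow_sub_one₀ hy0]
    ring
  have e1 : k - 1 - 2 = k - 3 := by ring
  have e2 : k - 1 - 1 = k - 2 := by ring
  -- The parameter is now `α₁ = y / z`; inversion exchanges the roles of the two relations, so `τ`
  -- comes from `first` and `τ̄` from `last`.
  have hlast := h.last (k - 1) N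
  have hfirst := h.first (k - 1) N
  rw [ez, e1, e2, sub_add_cancel] at hlast hfirst
  ext i
  · exact congrFun (R₁InvPar_parPt hy0 hx k) i
  · rfl
  · fin_cases i
    · change (uPar (y ^ 2) ((y ^ 2) ^ N) (parPt (y ^ 2) (y ^ k * x) y 1) * T (k - 1) N x
          * T (k - 2) (N + 1) x + T (k - 1) (N + 1) x * T (k - 2) N x)
        / (uHalf (y ^ 2) ((y ^ 2) ^ N) (parPt (y ^ 2) (y ^ k * x) y 1) * T k (N + 1) x)
        = T (k - 1 - 2) N x
      rw [parPt_one hy0, uHalf_zpow, uPar_zpow, e1]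
      generalize y ^ k * x = z at *
      generalize y ^ N = L at *
      field_simp at hfirst hlast ⊢
      linear_combination -hfirst
    · rfl
    · change T (k - 2) N x = T (k - 1 - 1) N x
      rw [e2]
  · fin_cases i
    · change (vPar (y ^ 2) ((y ^ 2) ^ N) (parPt (y ^ 2) (y ^ k * x) y 1) * T (k - 1) (N + 1) x
          * T (k - 2) N x + T (k - 1) N x * T (k - 2) (N + 1) x)
        / (vHalf (y ^ 2) ((y ^ 2) ^ N) (parPt (y ^ 2) (y ^ k * x) y 1) * T k N x)
        = T (k - 1 - 2) (N + 1) x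
      rw [parPt_one hy0, vHalf_zpow, vPar_zpow, e1]
      generalize y ^ k * x = z at *
      generalize y ^ N = L at *
      field_simp at hfirst hlast ⊢
      linear_combination -hlast
    · rfl
    · change T (k - 2) (N + 1) x = T (k - 1 - 1) (N + 1) x
      rw [e2]

theorem OrbitRelations.T₄Rel (h : OrbitRelations y x fun k N => T k N x) (hy0 : y ≠ 0)
    (hx : x ≠ 0) (k N : ℤ) :
    T₄Rel (y ^ 2) (latticePt (y ^ 2) y T k N x) (latticePt (y ^ 2) y T k (N + 1) x) := by
  have hL := zpow_ne_zero N hy0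
  have hz : y ^ k * x ≠ 0 := mul_ne_zero (zpow_ne_zero k hy0) hx
  have ez1 : y ^ (k - 1) * x = y ^ k * x / y := by
    rw [zpow_sub_one₀ hy0]
    ring
  have ez2 : y ^ (k - 2) * x = y ^ k * x / y ^ 2 := by
    rw [zpow_sub₀ hy0, zpow_ofNat]
    ring
  have e1 : k - 1 - 2 = k - 3 := by ring
  have e2 : k - 1 - 1 = k - 2 := by ring
  have e3 : k - 2 - 1 = k - 3 := by ring
  have e4 : k - 2 + 1 = k - 1 := by ring
  have e5 : k - 1 + 2 = k + 1 := by ring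
  constructor
  · rfl
  · change (y ^ 2) ^ (N + 1) = y ^ 2 * (y ^ 2) ^ N
    rw [zpow_add_one₀ (pow_ne_zero 2 hy0), mul_comm]
  · rfl
  -- In each component one bilinear relation merges two of the three terms sharing a `τ̄`. The
  -- result and the remaining term then have a common factor `τ`, and their sum is a relation
  -- `upper` or `lower` at level `N + 1`.
  intro i
  fin_cases i
  · change y ^ 2 * T k N x * T (k - 1) N x * T (k - 2) (N + 1 + 1) x
      = parPt (y ^ 2) (y ^ k * x) y 1 ^ 2
        * (T (k - 2) N x * T k (N + 1) x * T (k - 1) (N + 1) x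
          + vPar (y ^ 2) ((y ^ 2) ^ N) y * T (k - 2) (N + 1) x * T k N x * T (k - 1) (N + 1) x
          + (vPar (y ^ 2) ((y ^ 2) ^ N) (parPt (y ^ 2) (y ^ k * x) y 1))⁻¹
            * T (k - 2) (N + 1) x * T k (N + 1) x * T (k - 1) N x)
    have h1 := h.upper (k - 2) (N + 1)
    have h2 := h.last (k - 1) N
    rw [ez1, e1, e2, sub_add_cancel] at h2
    simp only [ez2, e3, e4, sub_add_cancel, add_sub_cancel_right, zpow_succ_pow hy0] at h1
    rw [parPt_one hy0, vPar_zpow, vPar_zpow]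
    generalize y ^ k * x = z at *
    generalize y ^ N = L at *
    field_simp at h1 h2 ⊢
    linear_combination y ^ 5 * L ^ 4 * T k N x * h1 + T k (N + 1) x * h2
  · change (y ^ k * x) ^ 2 * T (k - 1) N x * T (k - 2) N x * T k (N + 1 + 1) x
      = y ^ 2
        * (T k N x * T (k - 1) (N + 1) x * T (k - 2) (N + 1) x
          + vPar (y ^ 2) ((y ^ 2) ^ N) (y ^ k * x) * T k (N + 1) x * T (k - 1) N x
            * T (k - 2) (N + 1) x
          + (vPar (y ^ 2) ((y ^ 2) ^ N) y)⁻¹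
            * T k (N + 1) x * T (k - 1) (N + 1) x * T (k - 2) N x)
    have h1 := h.lower (k - 1) (N + 1)
    have h2 := h.first k N
    simp only [ez1, e2, e5, sub_add_cancel, add_sub_cancel_right, zpow_succ_pow hy0] at h1
    rw [vPar_zpow, vPar_zpow]
    generalize y ^ k * x = z at *
    generalize y ^ N = L at *
    field_simp at h1 h2 ⊢
    linear_combination T (k - 2) N x * h1 + y ^ 10 * L ^ 8 * T (k - 2) (N + 1) x * h2
  · change parPt (y ^ 2) (y ^ k * x) y 1 ^ 2 * T (k - 2) N x * T k N x * T (k - 1) (N + 1 + 1) x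
      = (y ^ k * x) ^ 2
        * (T (k - 1) N x * T (k - 2) (N + 1) x * T k (N + 1) x
          + vPar (y ^ 2) ((y ^ 2) ^ N) (parPt (y ^ 2) (y ^ k * x) y 1)
            * T (k - 1) (N + 1) x * T (k - 2) N x * T k (N + 1) x
          + (vPar (y ^ 2) ((y ^ 2) ^ N) (y ^ k * x))⁻¹
            * T (k - 1) (N + 1) x * T (k - 2) (N + 1) x * T k N x)
    have h1 := h.upper (k - 1) (N + 1)
    have h2 := h.first k N
    simp only [ez1, e2, e5, sub_add_cancel, add_sub_cancel_right, zpow_succ_pow hy0] at h1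
    rw [parPt_one hy0, vPar_zpow, vPar_zpow]
    generalize y ^ k * x = z at *
    generalize y ^ N = L at *
    field_simp at h1 h2 ⊢
    linear_combination y ^ 2 * L ^ 4 * T (k - 2) N x * h1 + T (k - 2) (N + 1) x * h2

theorem OrbitRelations.T₄InvRel (h : OrbitRelations y x fun k N => T k N x) (hy0 : y ≠ 0)
    (hx : x ≠ 0) (k N : ℤ) :
    T₄InvRel (y ^ 2) (latticePt (y ^ 2) y T k N x) (latticePt (y ^ 2) y T k (N - 1) x) := by
  have hL := zpow_ne_zero N hy0
  have hz : y ^ k * x ≠ 0 := mul_ne_zero (zpow_ne_zero k hy0) hx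
  have ez1 : y ^ (k - 1) * x = y ^ k * x / y := by
    rw [zpow_sub_one₀ hy0]
    ring
  have ez2 : y ^ (k - 2) * x = y ^ k * x / y ^ 2 := by
    rw [zpow_sub₀ hy0, zpow_ofNat]
    ring
  have e1 : k - 1 - 2 = k - 3 := by ring
  have e2 : k - 1 - 1 = k - 2 := by ring
  have e3 : k - 2 - 1 = k - 3 := by ring
  have e4 : k - 2 + 1 = k - 1 := by ring
  have e5 : k - 1 + 2 = k + 1 := by ring
  constructor
  · rfl
  · change y ^ 2 * (y ^ 2) ^ (N - 1) = (y ^ 2) ^ N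
    rw [zpow_sub_one₀ (pow_ne_zero 2 hy0)]
    field_simp
  · change ![T (k - 2) (N - 1 + 1) x, T k (N - 1 + 1) x, T (k - 1) (N - 1 + 1) x] = _
    rw [sub_add_cancel]
    rfl
  -- As for `T₄` with `τ` and `τ̄` exchanged: `first` or `last` merges two terms sharing a `τ`, then
  -- `upper` or `lower` at level `N` finishes.
  intro i
  fin_cases i
  · change y ^ 2 * T k (N + 1) x * T (k - 1) (N + 1) x * T (k - 2) (N - 1) x
      = parPt (y ^ 2) (y ^ k * x) y 1 ^ 2
        * (T (k - 2) (N + 1) x * T k N x * T (k - 1) N x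
          + uPar (y ^ 2) ((y ^ 2) ^ N) y * T (k - 2) N x * T k (N + 1) x * T (k - 1) N x
          + (uPar (y ^ 2) ((y ^ 2) ^ N) (parPt (y ^ 2) (y ^ k * x) y 1))⁻¹
            * T (k - 2) N x * T k N x * T (k - 1) (N + 1) x)
    have h1 := h.lower (k - 2) N
    have h2 := h.first (k - 1) N
    rw [ez1, e1, e2, sub_add_cancel] at h2
    simp only [ez2, e3, e4, sub_add_cancel] at h1
    rw [parPt_one hy0, uPar_zpow, uPar_zpow]
    generalize y ^ k * x = z at *
    generalize y ^ N = L at *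
    field_simp at h1 h2 ⊢
    linear_combination y * T k (N + 1) x * h1 + L ^ 8 * T k N x * h2
  · change (y ^ k * x) ^ 2 * T (k - 1) (N + 1) x * T (k - 2) (N + 1) x * T k (N - 1) x
      = y ^ 2
        * (T k (N + 1) x * T (k - 1) N x * T (k - 2) N x
          + uPar (y ^ 2) ((y ^ 2) ^ N) (y ^ k * x) * T k N x * T (k - 1) (N + 1) x
            * T (k - 2) N x
          + (uPar (y ^ 2) ((y ^ 2) ^ N) y)⁻¹
            * T k N x * T (k - 1) N x * T (k - 2) (N + 1) x)
    have h1 := h.upper (k - 1) N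
    have h2 := h.last k N
    simp only [ez1, e2, e5, sub_add_cancel] at h1
    rw [uPar_zpow, uPar_zpow]
    generalize y ^ k * x = z at *
    generalize y ^ N = L at *
    field_simp at h1 h2 ⊢
    linear_combination y ^ 2 * L ^ 4 * T (k - 2) (N + 1) x * h1 + T (k - 2) N x * h2
  · change parPt (y ^ 2) (y ^ k * x) y 1 ^ 2 * T (k - 2) (N + 1) x * T k (N + 1) x
        * T (k - 1) (N - 1) x
      = (y ^ k * x) ^ 2
        * (T (k - 1) (N + 1) x * T (k - 2) N x * T k N x
          + uPar (y ^ 2) ((y ^ 2) ^ N) (parPt (y ^ 2) (y ^ k * x) y 1)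
            * T (k - 1) N x * T (k - 2) (N + 1) x * T k N x
          + (uPar (y ^ 2) ((y ^ 2) ^ N) (y ^ k * x))⁻¹
            * T (k - 1) N x * T (k - 2) N x * T k (N + 1) x)
    have h1 := h.lower (k - 1) N
    have h2 := h.last k N
    simp only [ez1, e2, e5, sub_add_cancel] at h1
    rw [parPt_one hy0, uPar_zpow, uPar_zpow]
    generalize y ^ k * x = z at *
    generalize y ^ N = L at *
    field_simp at h1 h2 ⊢
    linear_combination y ^ 2 * T (k - 2) (N + 1) x * h1 + L ^ 8 * T (k - 2) N x * h2

end Lattice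

/-! ### The bilinear equation and q-P_II -/

section PainleveTwo

variable {y x : ℂ} {T : ℤ → ℤ → ℂ → ℂ}

theorem OrbitRelations.bilinear (h : OrbitRelations y x fun k N => T k N x) (hy0 : y ≠ 0)
    (hx : x ≠ 0) (k N : ℤ) :
    T k (N + 1) x * T (k + 1) (N - 1) x
      - y ^ (k - 4 * N + 1) * x * T (k + 2) N x * T (k - 1) N x
      - (y ^ 2) ^ (-k + 4 * N - 1) * x ^ (-2 : ℤ) * T (k + 1) N x * T k N x = 0 := by
  have hL := zpow_ne_zero N hy0
  have hz : y ^ k * x ≠ 0 := mul_ne_zero (zpow_ne_zero k hy0) hx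
  have e1 : y ^ (k - 4 * N + 1) * x = y * (y ^ k * x) / (y ^ N) ^ 4 := by
    rw [zpow_add_one₀ hy0, zpow_sub₀ hy0, mul_comm 4 N, zpow_mul, zpow_ofNat]
    ring
  have e2 : (y ^ 2) ^ (-k + 4 * N - 1) * x ^ (-2 : ℤ)
      = (y ^ N) ^ 8 / (y ^ 2 * (y ^ k * x) ^ 2) := by
    have hs : (y ^ 2) ^ (-k + 4 * N - 1) = (y ^ (-k + 4 * N - 1)) ^ 2 :=
      (zpow_pow_comm y _ 2).symm
    rw [hs, zpow_sub_one₀ hy0, zpow_add₀ hy0, mul_comm 4 N, zpow_mul, zpow_neg, zpow_neg,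
      zpow_ofNat, zpow_ofNat]
    ring
  have := h.upper k N
  rw [e1, e2]
  generalize y ^ k * x = z at *
  generalize y ^ N = L at *
  field_simp
  linear_combination this

theorem OrbitRelations.qPII (h : OrbitRelations y x fun k N => T k N x) (hy0 : y ≠ 0)
    (hx : x ≠ 0) (k N : ℤ)
    (hT : ∀ j ∈ Finset.Icc (k - 2) (k + 1), T j N x ≠ 0 ∧ T j (N + 1) x ≠ 0) :
    x ^ 6 * y ^ (6 * k) + fromTau (y ^ 2) T k N x ≠ 0 ∧
      fromTau (y ^ 2) T (k + 1) N x =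
        ((y ^ 2) ^ 6) ^ (2 * N + 1) / (fromTau (y ^ 2) T k N x * fromTau (y ^ 2) T (k - 1) N x)
          * ((1 + x ^ 6 * y ^ (6 * k) * fromTau (y ^ 2) T k N x)
            / (x ^ 6 * y ^ (6 * k) + fromTau (y ^ 2) T k N x)) := by
  have hL := zpow_ne_zero N hy0
  have hz : y ^ k * x ≠ 0 := mul_ne_zero (zpow_ne_zero k hy0) hx
  obtain ⟨h0, h0'⟩ := hT (k - 2) (by rw [Finset.mem_Icc]; lia)
  obtain ⟨h1, h1'⟩ := hT (k - 1) (by rw [Finset.mem_Icc]; lia)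
  obtain ⟨h2, h2'⟩ := hT k (by rw [Finset.mem_Icc]; lia)
  obtain ⟨h3, h3'⟩ := hT (k + 1) (by rw [Finset.mem_Icc]; lia)
  have hs : (y ^ 2) ^ N = (y ^ N) ^ 2 := (zpow_pow_comm y N 2).symm
  have e1 : x ^ 6 * y ^ (6 * k) = (y ^ k * x) ^ 6 := by
    rw [mul_comm 6 k, zpow_mul, zpow_ofNat]
    ring
  have e2 : (y ^ 2) ^ (2 * (2 * N + 1)) = y ^ 4 * (y ^ N) ^ 8 := by
    rw [show 2 * (2 * N + 1) = N * 4 + 2 by ring, zpow_add₀ (pow_ne_zero 2 hy0), zpow_mul, hs,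
      zpow_ofNat, zpow_ofNat]
    ring
  have e3 : ((y ^ 2) ^ 6) ^ (2 * N + 1) = y ^ 12 * (y ^ N) ^ 24 := by
    rw [← zpow_pow_comm, show 2 * N + 1 = N * 2 + 1 by ring, zpow_add₀ (pow_ne_zero 2 hy0),
      zpow_mul, hs, zpow_ofNat, zpow_one]
    ring
  have hlast := h.last k N
  have hfirst := h.first k N
  have e4 : k - 1 - 1 = k - 2 := by ring
  simp only [fromTau, e1, e2, e3, e4, add_sub_cancel_right]
  generalize y ^ k * x = z at *
  generalize y ^ N = L at *
  -- `last` factors `a₀ q^{k/2} + X_k` and `first` factors `1 + a₀ q^{k/2} X_k`. The quotient of the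
  -- two is what the product `X_{k+1} X_k X_{k-1}` telescopes to, apart from `q ^ (2 N + 1)`; the
  -- first factorization also shows that the denominator is nonzero.
  have f1 : z ^ 6 + y ^ 4 * L ^ 8 * (T k (N + 1) x * T (k - 1) N x / (T k N x * T (k - 1) (N + 1) x))
      = y ^ 2 * L ^ 4 * z ^ 3 * (T (k - 2) (N + 1) x * T (k + 1) N x)
        / (T k N x * T (k - 1) (N + 1) x) := by
    rw [hlast]
    field_simp
  have f2 : 1 + z ^ 6 * (y ^ 4 * L ^ 8
        * (T k (N + 1) x * T (k - 1) N x / (T k N x * T (k - 1) (N + 1) x)))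
      = y ^ 2 * L ^ 4 * z ^ 3 * (T (k - 2) N x * T (k + 1) (N + 1) x)
        / (T k N x * T (k - 1) (N + 1) x) := by
    rw [hfirst]
    field_simp
    ring
  rw [f1, f2]
  constructor
  · positivity
  · field_simp

end PainleveTwo

/-! ### Assembly, and the one-parameter family -/

section Main

variable {Q y : ℂ}

theorem isHypergeometricTauII (hQ₀ : Q ≠ 0) (hQ₁ : ‖Q‖ < 1) (hy : y ^ 2 = Q)
    {A B : ℂ → ℂ → ℂ} (h : Symmetrized Q y A B) :
    IsHypergeometricTauII Q y (generic Q y) (tauII Q y A B) := by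
  have hy0 : y ≠ 0 := by rintro rfl; simp at hy; exact hQ₀ hy.symm
  have hτ := fun {x} (hx : x ∈ generic Q y) => tauII_eq_tauLine hQ₀ hQ₁ hy h hx
  have hrel : ∀ x ∈ generic Q y, OrbitRelations y x fun k N => tauII Q y A B k N x := by
    intro x hx
    simp only [hτ hx]
    exact orbitRelations hQ₀ hQ₁ hy (fun u hu => h.apply_Q_mul hy0 hu) hx
  have hpar : ∀ (k : ℤ) (x : ℂ), x ∈ generic Q y → ∀ i, parPt Q (y ^ k * x) y i ≠ 0 := by
    intro k x hx i
    have := mul_ne_zero (zpow_ne_zero k hy0) hx.1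
    fin_cases i
    · exact this
    · exact div_ne_zero hQ₀ (mul_ne_zero this hy0)
    · exact hy0
  have hR₁ : ∀ k N x, x ∈ generic Q y → R₁Rel Q (latticePt Q y (tauII Q y A B) k N x)
      (latticePt Q y (tauII Q y A B) (k + 1) N x) := by
    intro k N x hx
    have := (hrel x hx).R₁Rel hy0 hx.1 k N
    rwa [hy] at this
  have hT₄ : ∀ k N x, x ∈ generic Q y → T₄Rel Q (latticePt Q y (tauII Q y A B) k N x)
      (latticePt Q y (tauII Q y A B) k (N + 1) x) := by
    intro k N x hx
    have := (hrel x hx).T₄Rel hy0 hx.1 k N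
    rwa [hy] at this
  have hT₄Inv : ∀ k N x, x ∈ generic Q y → T₄InvRel Q (latticePt Q y (tauII Q y A B) k N x)
      (latticePt Q y (tauII Q y A B) k (N - 1) x) := by
    intro k N x hx
    have := (hrel x hx).T₄InvRel hy0 hx.1 k N
    rwa [hy] at this
  constructor
  · intro k N hN x hx
    rw [hτ hx, tauLine, toeplitzInt_of_neg _ hN, mul_zero]
  · intro k x hx
    rw [hτ hx, tauLine, toeplitzInt_zero]
    simpa using gammaFactor_ne_zero hQ₀ hQ₁ hy (generic_zpow_mul hQ₀ hy k hx)
  · intro k N x hx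
    have hk := generic_zpow_mul hQ₀ hy k hx
    refine ⟨hk, ?_⟩
    rw [hτ hx, hτ hk, zpow_zero, one_mul]
  · intro k N x hx h0 h0'
    exact R₁_eq_of_rel (hR₁ k N x hx) hQ₀ (zpow_ne_zero N hQ₀) (hpar k x hx 0) h0 h0'
  · intro k N x hx h0 h0'
    have := (hrel x hx).R₁Inv_eq hy0 hx.1 k N h0 h0'
    rwa [hy] at this
  · intro k N x hx h0
    exact T₄_eq_of_rel (hT₄ k N x hx) hQ₀ (hpar k x hx) h0
  · intro k N x hx h0
    exact T₄Inv_eq_of_rel (hT₄Inv k N x hx) hQ₀ (hpar k x hx) h0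
  · exact hR₁
  · exact hT₄
  · exact hT₄Inv
  · intro k N x hx
    have := (hrel x hx).bilinear hy0 hx.1 k N
    rwa [hy] at this
  · intro k N x hx hT
    have := (hrel x hx).qPII hy0 hx.1 k N hT
    rwa [hy] at this

/-- The two equations are linear in `d w` and `d (y w)`. Eliminating `d (y w)` leaves `d w` times
the expression of `qCos_mul_qCos_add`, which equals 1. -/
theorem eq_zero_of_entryFun_eq_zero (hQ₀ : Q ≠ 0) (hQ₁ : ‖Q‖ < 1) (hy : y ^ 2 = Q) {d : ℂ → ℂ}
    (hd : ∀ x, x ≠ 0 → d (Q * x) = d x) {w : ℂ} (hw : w ∈ generic Q y)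
    (h1 : entryFun (y ^ 12) y d w = 0) (h2 : entryFun (y ^ 12) y d (y * w) = 0) : d w = 0 := by
  have hy0 : y ≠ 0 := by rintro rfl; simp at hy; exact hQ₀ hy.symm
  have hy1 := norm_pow_lt_one (norm_lt_one_of_sq hQ₁ hy) (show 12 ≠ 0 by norm_num)
  have hI : qInf (y ^ 12) ((y ^ 12) ^ 2) ≠ 0 := qInf_sqrt_ne_zero (norm_lt_one_of_sq hQ₁ hy)
  have hw0 := hw.1
  have hr := thetaRatio_ne_zero hQ₀ hQ₁ hy hw
  have hcs := qCos_mul_qCos_add hy1 (w ^ 12)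
  have hyy : d (y * (y * w)) = d w := by rw [← mul_assoc, ← sq, hy, hd w hw0]
  have e3 : (y ^ 12) ^ 2 * (y * w) ^ 12 = (y ^ 12) ^ 3 * w ^ 12 := by ring
  have e4 : (y ^ 12) ^ 3 * (y * w) ^ 12 = (y ^ 12) ^ 4 * w ^ 12 := by ring
  rw [entryFun, div_eq_zero_iff, or_iff_left hI] at h1 h2
  rw [hyy, thetaRatio_mul hQ₀ hQ₁ hy hw, e3, e4] at h2
  generalize thetaRatio (y ^ 12) w = t at *
  generalize d (y * w) = d' at *
  generalize qCos (y ^ 12) ((y ^ 12) ^ 2 * w ^ 12) = c at *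
  generalize qCos (y ^ 12) ((y ^ 12) ^ 3 * w ^ 12) = c' at *
  generalize qSin (y ^ 12) ((y ^ 12) ^ 3 * w ^ 12) = s at *
  generalize qSin (y ^ 12) ((y ^ 12) ^ 4 * w ^ 12) = s' at *
  field_simp at h2
  linear_combination (-d w) * hcs - c * h2 - w ^ 12 * y ^ 12 * s' * h1

theorem tauLine_one (y : ℂ) (a : ℂ → ℂ) (w : ℂ) : tauLine Q y a 1 w
    = -(w ^ 2 * (y ^ 2)⁻¹ * gammaFactor Q y w * thetaFactor (y ^ 12) y w)
      * entryFun (y ^ 12) y a w := by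
  have e : (-1 : ℂ) ^ ((1 : ℤ) * (1 + 1) / 2) = -1 := by norm_num
  rw [tauLine, toeplitzInt_one, gaugedSeq, gaugedEntry, e, zpow_zero, one_mul,
    show -4 * (1 : ℤ) ^ 2 + 6 * 1 = 2 by norm_num, show -2 * (1 : ℤ) ^ 2 = -2 by norm_num, zpow_neg,
    zpow_ofNat, zpow_ofNat]
  ring

theorem tauII_eq_iff (hQ₀ : Q ≠ 0) (hQ₁ : ‖Q‖ < 1) (hy : y ^ 2 = Q)
    {A B A' B' : ℂ → ℂ → ℂ} (h : Symmetrized Q y A B) (h' : Symmetrized Q y A' B') :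
    (∀ k N : ℤ, ∀ x ∈ generic Q y, tauII Q y A B k N x = tauII Q y A' B' k N x) ↔
      ∀ x ∈ generic Q y, A x y = A' x y := by
  have hy0 : y ≠ 0 := by rintro rfl; simp at hy; exact hQ₀ hy.symm
  constructor
  · intro hT x hx
    -- The single function `τ_1^0` suffices: it is a nonvanishing multiple of the entry, and the
    -- entry is linear in the coefficient.
    have hE : ∀ w ∈ generic Q y, entryFun (y ^ 12) y (fun u => A u y - A' u y) w = 0 := by
      intro w hw
      have h1 := hT 0 1 w hw
      rw [tauII_eq_tauLine hQ₀ hQ₁ hy h hw, tauII_eq_tauLine hQ₀ hQ₁ hy h' hw, zpow_zero, one_mul,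
        tauLine_one, tauLine_one] at h1
      have h2 := mul_left_cancel₀ (neg_ne_zero.mpr (mul_ne_zero (mul_ne_zero (mul_ne_zero
        (pow_ne_zero 2 hw.1) (inv_ne_zero (pow_ne_zero 2 hy0))) (gammaFactor_ne_zero hQ₀ hQ₁ hy hw))
        (thetaFactor_ne_zero hQ₀ hQ₁ hy hw))) h1
      rw [← sub_eq_zero] at h2
      rw [← h2, entryFun, entryFun, entryFun]
      ring
    refine sub_eq_zero.mp (eq_zero_of_entryFun_eq_zero hQ₀ hQ₁ hy (d := fun u => A u y - A' u y)
      ?_ hx (hE x hx) (hE _ (generic_mul hQ₀ hy hx)))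
    intro u hu
    simp only [h.apply_Q_mul hy0 hu, h'.apply_Q_mul hy0 hu]
  · intro hA k N x hx
    have hk := generic_zpow_mul hQ₀ hy k hx
    have hE : ∀ w ∈ generic Q y, entryFun (y ^ 12) y (fun u => A u y) w
        = entryFun (y ^ 12) y (fun u => A' u y) w := by
      intro w hw
      rw [entryFun, entryFun, hA w hw, hA _ (generic_mul hQ₀ hy hw)]
    have hS : gaugedSeq y (fun u => A u y) (y ^ k * x)
        = gaugedSeq y (fun u => A' u y) (y ^ k * x) := by
      ext j
      rw [gaugedSeq, gaugedSeq, gaugedEntry, gaugedEntry, hE _ (generic_zpow_mul hQ₀ hy j hk)]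
    rw [tauII_eq_tauLine hQ₀ hQ₁ hy h hx, tauII_eq_tauLine hQ₀ hQ₁ hy h' hx, tauLine, tauLine, hS]

theorem periodOne_of_apply_mul {f : ℂ → ℂ} (hQ₀ : Q ≠ 0) (hf : ∀ x, x ≠ 0 → f (Q * x) = f x) :
    PeriodOne Q fun u _ => f u := by
  intro u v hu _ n m
  refine ⟨?_, rfl⟩
  rw [latticeFun, latticeFun, zpow_add_one₀ hQ₀, mul_comm _ Q, mul_assoc,
    hf _ (mul_ne_zero (zpow_ne_zero n hQ₀) hu)]

theorem exists_symmetrized (hQ₀ : Q ≠ 0) (hy : y ^ 2 = Q) {a : ℂ → ℂ}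
    (ha : ∀ x, x ≠ 0 → a (Q * x) = a x) :
    ∃ A B : ℂ → ℂ → ℂ, Symmetrized Q y A B ∧ ∀ x, x ≠ 0 → A x y = a x := by
  have hy0 : y ≠ 0 := by rintro rfl; simp at hy; exact hQ₀ hy.symm
  -- Coefficients independent of the second variable are trivially periodic in `m`, and `R₁` then
  -- forces `B(u) = a (y u)`.
  refine ⟨fun u _ => a u, fun u _ => a (y * u), ⟨periodOne_of_apply_mul hQ₀ ha,
    periodOne_of_apply_mul hQ₀ fun u hu => ?_, fun n m u hu => ?_⟩, fun _ _ => rfl⟩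
  · rw [mul_left_comm, ha _ (mul_ne_zero hy0 hu)]
  · have e0 : R₁Par (parPt Q u y) 0 = y * u := by
      simp [R₁Par, sPar, piPar, parPt, cartan]
    rw [latticeFun, latticeFun, e0, mul_left_comm]

end Main

end QPainleve

theorem mainTheorem2 (Q α₂ : ℂ) (hQ₀ : Q ≠ 0) (hQ₁ : ‖Q‖ < 1) (hα₂ : α₂ ^ 2 = Q) :
    (∀ A B : ℂ → ℂ → ℂ, Symmetrized Q α₂ A B →
      IsHypergeometricTauII Q α₂ (generic Q α₂) (tauII Q α₂ A B)) ∧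
    (∀ A B A' B' : ℂ → ℂ → ℂ, Symmetrized Q α₂ A B → Symmetrized Q α₂ A' B' →
      ((∀ k N : ℤ, ∀ α₀ ∈ generic Q α₂,
          tauII Q α₂ A B k N α₀ = tauII Q α₂ A' B' k N α₀) ↔
        ∀ α₀ ∈ generic Q α₂, A α₀ α₂ = A' α₀ α₂)) ∧
    (∀ a : ℂ → ℂ, (∀ x : ℂ, x ≠ 0 → a (Q * x) = a x) →
      ∃ A B : ℂ → ℂ → ℂ, Symmetrized Q α₂ A B ∧ ∀ x : ℂ, x ≠ 0 → A x α₂ = a x) :=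
  ⟨fun _ _ h => isHypergeometricTauII hQ₀ hQ₁ hα₂ h,
    fun _ _ _ _ h h' => tauII_eq_iff hQ₀ hQ₁ hα₂ h h',
    fun _ ha => exists_symmetrized hQ₀ hα₂ ha⟩
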